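/- **Setting.** Let $\xi_1,\xi_2,\dots$ be i.i.d. data, let $x_0\in\mathbb R^d$ be a (possibly random) initial point independent of the data, let $(\mathcal F_t)_{t\ge 0}$ be a filtration such that $x_0$ is $\mathcal F_0$-measurable and $\xi_{t+1}$ is $\mathcal F_{t+1}$-measurable and independent of $\mathcal F_t$ (e.g. the one generated by $x_0$ and the data), and let $g(x)=\mathbb E[G(x,\xi)]$ with $G$ measurable. Consider $$x_{t+1}=x_t-\eta_t G(x_t,\xi_{t+1}),\qquad \eta_t=\eta_0t^{-a}\ (t\ge 1),\ \eta_0>0,\ a>0,$$ where the step at $t=0$ is $\eta_0$. Put $\bar x_t=\frac1t\sum_{s=1}^t x_s$, $\varepsilon_t=g(x_{t-1})-G(x_{t-1},\xi_t)$ and $\tilde\varepsilon_t=g(x^*)-G(x^*,\xi_t)$. Assume: 1. (Lyapunov function) There are a differentiable $V:\mathbb R^d\to\mathbb R$ and $\delta_V,\mu_V,L_V,\lambda_V>0$ with $V(0)=0$, $\nabla V$ $L_V$-Lipschitz, and, whenever $\|x-x^*\|\le\delta_V$: $V(x-x^*)\ge\mu_V\|x-x^*\|^2$, $\nabla V(x-x^*)^\top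 g(x)\ge\lambda_V V(x-x^*)$, and $\nabla V(x-x^*)^\top g(x)>0$ if $x\ne x^*$. 2. (Linearity) $g(x)=H(x-x^*)$ for all $x\in\mathbb R^d$, where all eigenvalues of $H\in\mathbb R^{d\times d}$ have positive real part. 3. (Lipschitzness) $\sqrt{\mathbb E\|G(x,\xi)-G(y,\xi)\|^2}\le L_G\|x-y\|$ for all $x,y$ and some $L_G>0$. 4. (Noise, with moment parameter $p>1$) (i) There is $L_\varepsilon>0$ with $\mathbb E(\|\varepsilon_t\|^2\mid\mathcal F_{t-1})+\|g(x_{t-1})\|^2\le L_\varepsilon(1+\|x_{t-1}-x^*\|^2)$ a.s. for all $t\ge1$. (ii) $\varepsilon_t=\varepsilon_t(0)+\zeta_t(x_{t-1})$ with $\varepsilon_t(0)$ square integrable, $\mathbb E(\varepsilon_t(0)\mid\mathcal F_{t-1})=0$ a.s.; $\mathbb E(\varepsilon_t(0)\varepsilon_t(0)^\top\mid\mathcal F_{t-1})\to S$ in probability for some symmetric positive definite $S$; $\sup_t\mathbb E(\|\varepsilon_t(0)\|^2\mathbf 1(\|\varepsilon_t(0)\|>C)\mid\mathcal F_{t-1})\to0$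 in probability as $C\to\infty$; and, for all large $t$, $\mathbb E(\|\zeta_t(x_{t-1})\|^2\mid\mathcal F_{t-1})\le\delta(x_{t-1}-x^*)$ a.s., where $\delta(\Delta)\to0$ as $\Delta\to0$. (iii) $\sup_{t\ge1}\mathbb E\|\varepsilon_t\|^{2p}<\infty$ and $\mathbb E\|G(x^*,\xi)\|^{2p}<\infty$. "$p=\infty$" means that the noise assumption holds for every finite $p>1$. Write $X_t=\tilde o(r_t)$ a.s. if there is a $k\in\mathbb R$ with $X_t=o(r_t(\log t)^k)$ a.s., and for $\epsilon>0$ let (with $1/p=0$ when $p=\infty$) $$r_{t,\epsilon}(p,a)=t^{-1}(\log t)^{\epsilon}+t^{\frac1{2p}-\frac{2-a}2}(\log t)^{\frac1{2p}+\epsilon}+t^{-\frac{1+a}2}(\log t)^{\frac12+\epsilon}.$$ **Claim.** (a) If $1<p<\infty$ and $0<a<\frac{p-1}p$, then for every $\epsilon>0$, $\bar x_t-x^*=\frac1t\sum_{j=1}^tH^{-1}\tilde\varepsilon_j+o(r_{t,\epsilon}(p,a))$ a.s. In particular, with $a=\frac{p-1}{2p}$, $$\bar x_t-x^*=\frac1t\sum_{j=1}^tH^{-1}\tilde\varepsilon_j+\tilde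 o\big(t^{-\frac{3p-1}{4p}}\big)\quad\text{a.s.}$$ (b) If $p=\infty$ and $0<a<1$, the expansion holds a.s. with error $\tilde o(r_{t,\epsilon}(\infty,a))$ for every $\epsilon>0$; with $a=\frac12$ the error is $\tilde o(t^{-3/4})$. (c) These rates are optimal in the choice of $a$: for $1<p<\infty$ and every $b\in(0,\frac{p-1}p)$ with $b\ne\frac{p-1}{2p}$, one has $t^{-\frac{3p-1}{4p}}(\log t)^k=o(r_{t,\epsilon}(p,b))$ for all $k\in\mathbb R$, $\epsilon>0$; and for every $b\in(0,1)$ with $b\neq\frac12$, $t^{-3/4}(\log t)^k=o(r_{t,\epsilon}(\infty,b))$ for all $k\in\mathbb R$, $\epsilon>0$. -/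

import Mathlib

open MeasureTheory ProbabilityTheory Filter Asymptotics
open scoped Topology ENNReal NNReal

namespace LinearSA

noncomputable section

/-- The Euclidean space `ℝ^d`. -/
abbrev Vec (d : ℕ) : Type := EuclideanSpace ℝ (Fin d)

/-- The matrix-vector product on Euclidean space. -/
def mulVec {d : ℕ} (A : Matrix (Fin d) (Fin d) ℝ) (v : Vec d) : Vec d :=
  WithLp.toLp 2 (A.mulVec v.ofLp)

section Algorithm

variable {d : ℕ} {Ω Ξ : Type*}

/-- Polynomial step sizes: `η_t = η₀ t^{-a}` for `t ≥ 1`, and the very first step is `η₀`. -/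
def stepSize (η₀ a : ℝ) (t : ℕ) : ℝ :=
  if t = 0 then η₀ else η₀ * (t : ℝ) ^ (-a)

/-- The stochastic approximation recursion `x_{t+1} = x_t - η_t G(x_t, ξ_{t+1})`.
The data points are `ξ 1, ξ 2, …`; the value `ξ 0` is never used. -/
def iter (G : Vec d → Ξ → Vec d) (ξ : ℕ → Ω → Ξ) (x₀ : Ω → Vec d) (η : ℕ → ℝ) :
    ℕ → Ω → Vec d
  | 0 => x₀
  | t + 1 => fun ω =>
      iter G ξ x₀ η t ω - η t • G (iter G ξ x₀ η t ω) (ξ (t + 1) ω)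

/-- The average `(1/t) ∑_{s=1}^t x_s`. -/
def average (x : ℕ → Ω → Vec d) (t : ℕ) (ω : Ω) : Vec d :=
  (t : ℝ)⁻¹ • ∑ s ∈ Finset.Icc 1 t, x s ω

variable [MeasurableSpace Ω] [MeasurableSpace Ξ]

/-- The mean field `g(x) = E[G(x, ξ)]`, where `ξ` has the law of the data. -/
def meanField (P : Measure Ω) (G : Vec d → Ξ → Vec d) (ξ : ℕ → Ω → Ξ) (x : Vec d) : Vec d :=
  ∫ ω, G x (ξ 1 ω) ∂P

/-- The noise `ε_t = g(x_{t-1}) - G(x_{t-1}, ξ_t)` for `t ≥ 1` along a sequence `x`. -/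
def noise (P : Measure Ω) (G : Vec d → Ξ → Vec d) (ξ : ℕ → Ω → Ξ) (x : ℕ → Ω → Vec d)
    (t : ℕ) (ω : Ω) : Vec d :=
  meanField P G ξ (x (t - 1) ω) - G (x (t - 1) ω) (ξ t ω)

/-- The i.i.d. noise at the root, `ε̃_t = g(x*) - G(x*, ξ_t)` for `t ≥ 1`. -/
def rootNoise (P : Measure Ω) (G : Vec d → Ξ → Vec d) (ξ : ℕ → Ω → Ξ) (xs : Vec d)
    (t : ℕ) (ω : Ω) : Vec d :=
  meanField P G ξ xs - G xs (ξ t ω)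

/-- The approximation error `(x̄_t - x*) - (1/t) ∑_{j=1}^t H⁻¹ ε̃_j`. -/
def approxError (P : Measure Ω) (G : Vec d → Ξ → Vec d) (ξ : ℕ → Ω → Ξ) (x : ℕ → Ω → Vec d)
    (xs : Vec d) (H : Matrix (Fin d) (Fin d) ℝ) (t : ℕ) (ω : Ω) : Vec d :=
  (average x t ω - xs)
    - (t : ℝ)⁻¹ • ∑ j ∈ Finset.Icc 1 t, mulVec H⁻¹ (rootNoise P G ξ xs j ω)

end Algorithm

section Assumptions

variable {d : ℕ} {Ω Ξ : Type*} [mΩ : MeasurableSpace Ω] [mΞ : MeasurableSpace Ξ]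

/-- The sampling scheme.  `ℱ` is a filtration to which the (possibly random) initial point and the
data are adapted, and each new data point is independent of the past and has the common law; in
particular `ξ 1, ξ 2, …` are i.i.d.  The filtration generated by an initial point and i.i.d. data
independent of it is the basic example. -/
structure Sampling (P : Measure Ω) (ℱ : Filtration ℕ mΩ) (G : Vec d → Ξ → Vec d)
    (ξ : ℕ → Ω → Ξ) (x₀ : Ω → Vec d) : Prop where
  measurable_G : Measurable (Function.uncurry G)
  measurable_init : Measurable[ℱ 0] x₀
  measurable_data : ∀ t : ℕ, Measurable[ℱ (t + 1)] (ξ (t + 1))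
  indep_past : ∀ t : ℕ, Indep (MeasurableSpace.comap (ξ (t + 1)) mΞ) (ℱ t) P
  identDistrib : ∀ t : ℕ, IdentDistrib (ξ (t + 1)) (ξ 1) P P

/-- Existence of a Lyapunov function for the vector field `g` at `xs`. -/
def HasLyapunov (g : Vec d → Vec d) (xs : Vec d) : Prop :=
  ∃ (V : Vec d → ℝ) (δV μV LV lamV : ℝ),
    Differentiable ℝ V ∧ 0 < δV ∧ 0 < μV ∧ 0 < LV ∧ 0 < lamV ∧
    V 0 = 0 ∧
    (∀ x, ‖x - xs‖ ≤ δV → μV * ‖x - xs‖ ^ 2 ≤ V (x - xs)) ∧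
    (∀ y z, ‖gradient V y - gradient V z‖ ≤ LV * ‖y - z‖) ∧
    (∀ x, ‖x - xs‖ ≤ δV → x ≠ xs → 0 < inner ℝ (gradient V (x - xs)) (g x)) ∧
    (∀ x, ‖x - xs‖ ≤ δV → lamV * V (x - xs) ≤ inner ℝ (gradient V (x - xs)) (g x))

/-- The vector field is linear, `g(x) = H (x - x*)`, and all eigenvalues of `H` have positive
real part. -/
structure IsLinearField (g : Vec d → Vec d) (xs : Vec d) (H : Matrix (Fin d) (Fin d) ℝ) :
    Prop where
  linear : ∀ x, g x = mulVec H (x - xs)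
  eigenvalues : ∀ z ∈ spectrum ℂ (H.map (algebraMap ℝ ℂ)), 0 < z.re

/-- Averaged Lipschitzness: `(E ‖G(x, ξ) - G(y, ξ)‖²)^{1/2} ≤ L_G ‖x - y‖`. -/
def IsMeanSquareLipschitz (P : Measure Ω) (G : Vec d → Ξ → Vec d) (ξ : ℕ → Ω → Ξ) : Prop :=
  ∃ LG : ℝ, 0 < LG ∧ ∀ x y : Vec d,
    eLpNorm (fun ω => G x (ξ 1 ω) - G y (ξ 1 ω)) 2 P ≤ ENNReal.ofReal (LG * ‖x - y‖)

/-- The decomposition `ε_t = ε_t(0) + ζ_t(x_{t-1})` of the noise, `t ≥ 1`; below the time index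
is shifted, so that `ε (t + 1)` is conditioned on `ℱ t`. -/
structure NoiseDecomposition (P : Measure Ω) (ℱ : Filtration ℕ mΩ) (x : ℕ → Ω → Vec d)
    (xs : Vec d) (ε ε0 : ℕ → Ω → Vec d) (ζ : ℕ → Vec d → Ω → Vec d)
    (S : Matrix (Fin d) (Fin d) ℝ) (δ : Vec d → ℝ) : Prop where
  decomp : ∀ t : ℕ, ∀ ω, ε (t + 1) ω = ε0 (t + 1) ω + ζ (t + 1) (x t ω) ω
  memLp : ∀ t : ℕ, MemLp (ε0 (t + 1)) 2 P
  condMean : ∀ t : ℕ, P[ε0 (t + 1) | ℱ t] =ᵐ[P] 0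
  posDef : S.PosDef
  condCov : ∀ i j : Fin d,
    TendstoInMeasure P (fun (t : ℕ) => P[fun ω => ε0 (t + 1) ω i * ε0 (t + 1) ω j | ℱ t])
      atTop (fun _ => S i j)
  /-- `sup_t E(‖ε_t(0)‖² 1(‖ε_t(0)‖ > C) | ℱ_{t-1}) → 0` in probability as `C → ∞`; the supremum
  is taken in `[0, ∞]`. -/
  lindeberg : ∀ c : ℝ, 0 < c →
    Tendsto (fun C : ℝ => P {ω | ENNReal.ofReal c ≤ ⨆ t : ℕ, ENNReal.ofReal
      ((P[Set.indicator {ω' | C < ‖ε0 (t + 1) ω'‖} (fun ω' => ‖ε0 (t + 1) ω'‖ ^ 2) | ℱ t]) ω)})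
      atTop (𝓝 0)
  remainder_lim : Tendsto δ (𝓝[≠] 0) (𝓝 0)
  remainder : ∀ᶠ t : ℕ in atTop, ∀ᵐ ω ∂P,
    (P[fun ω' => ‖ζ (t + 1) (x t ω') ω'‖ ^ 2 | ℱ t]) ω ≤ δ (x t ω - xs)

/-- The noise assumption with finite moments of order `2p`, along the iterates `x`. -/
structure NoiseAssumption (P : Measure Ω) (ℱ : Filtration ℕ mΩ) (G : Vec d → Ξ → Vec d)
    (ξ : ℕ → Ω → Ξ) (x : ℕ → Ω → Vec d) (xs : Vec d) (p : ℝ) : Prop where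
  growth : ∃ Lε : ℝ, 0 < Lε ∧ ∀ t : ℕ, ∀ᵐ ω ∂P,
    (P[fun ω' => ‖noise P G ξ x (t + 1) ω'‖ ^ 2 | ℱ t]) ω + ‖meanField P G ξ (x t ω)‖ ^ 2
      ≤ Lε * (1 + ‖x t ω - xs‖ ^ 2)
  decomposition : ∃ (ε0 : ℕ → Ω → Vec d) (ζ : ℕ → Vec d → Ω → Vec d)
    (S : Matrix (Fin d) (Fin d) ℝ) (δ : Vec d → ℝ),
    NoiseDecomposition P ℱ x xs (noise P G ξ x) ε0 ζ S δ
  moments : ∃ Cε : ℝ≥0,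
    (∀ t : ℕ, ∫⁻ ω, ‖noise P G ξ x (t + 1) ω‖ₑ ^ (2 * p) ∂P ≤ Cε) ∧
    ∫⁻ ω, ‖G xs (ξ 1 ω)‖ₑ ^ (2 * p) ∂P ≤ Cε

end Assumptions

section Rates

/-- `X_t = õ(r_t)` almost surely: `X_t = o(r_t (log t)^k)` almost surely, for some power `k`. -/
def AELittleOTilde {Ω E : Type*} [MeasurableSpace Ω] [Norm E] (P : Measure Ω)
    (X : ℕ → Ω → E) (r : ℕ → ℝ) : Prop :=
  ∃ k : ℝ, ∀ᵐ ω ∂P,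
    (fun t => X t ω) =o[atTop] fun t : ℕ => r t * Real.log t ^ k

/-- The error rate of linear stochastic approximation with step exponent `a` and moment
parameter `p`, written in terms of `s = 1/p` (so that `s = 0` stands for `p = ∞`):
`t⁻¹ (log t)^ε + t^{1/(2p) - (2-a)/2} (log t)^{1/(2p)+ε} + t^{-(1+a)/2} (log t)^{1/2+ε}`. -/
def linearRate (s a ε : ℝ) (t : ℕ) : ℝ :=
  (t : ℝ) ^ (-1 : ℝ) * Real.log t ^ ε
    + (t : ℝ) ^ (s / 2 - (2 - a) / 2) * Real.log t ^ (s / 2 + ε)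
    + (t : ℝ) ^ (-((1 + a) / 2)) * Real.log t ^ (1 / 2 + ε)

end Rates

end

end LinearSA

/-! Linearity makes the averaged error explicit. Write `Δ_t = x_t - x*`. The recursion reads
`Δ_{t+1} = (1 - η_t H) Δ_t + η_t ε_{t+1}`, hence `Δ_t = H⁻¹ η_t⁻¹ (Δ_t - Δ_{t+1}) + H⁻¹ ε_{t+1}`.
Summed over `t < T`, and with `ε` compared to the root noise, this leaves three errors
(`approxError_eq`): the boundary term `Δ_T - Δ_0`, the sum of `η_t⁻¹ (Δ_t - Δ_{t+1})`, and the
martingale of the differences between the noise at `x_t` and at `x*`. Summation by parts makes the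
second sum of order `T^a` times the size of `Δ_T`. The third has conditional variance at most `(2
L_G)² ‖Δ_t‖²`, so it needs only `E‖Δ_t‖² = O(t^{-a})` and a strong law for martingale differences.
Everything thus rests on almost sure and mean rates for `Δ_t`.

These come from a norm adapted to `H`, in which `1 - ηH` contracts by `1 - cη` for all small `η`
(`exists_contracting_seminorm`). For finite `p`, a one-dimensional expansion of `|x + ηy|^{2p}`,
applied to all linear functionals at once, gives `E|ℓ(Δ_t)|^{2p} = O(t^{-ap})`
(`exists_integral_abs_rpow_le`). Summing normalised moments yields `Δ_t = o(t^{1/(2p) - a/2} (log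
t)^{1/(2p)+ε})` almost surely. For `p = ∞`, the noise is truncated at `t^{a/4}`; the truncated
recursion has bounded exponential moments at scale `t^{a/2}` (`exists_integral_exp_le`), so it is
`O(t^{-a/2} log t)`. Truncation is almost surely inactive from some time on, after which the two
recursions merge faster than any power of `t`.

The initial point may lack moments, so expectations are taken on the events `‖x_0 - x*‖ ≤ K`, which
are known at time 0 and exhaust the space.

Optimality is arithmetic: the exponents `1/(2p) - (2-a)/2` and `-(1+a)/2` are respectively
increasing and decreasing in `a`, and they meet at `a = (p-1)/(2p)`. -/

namespace LinearSA

set_option linter.unusedSectionVars false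

noncomputable section

/-! ### A norm contracted by `1 - ηH`. -/

section ContractingSeminorm

/-- If the spectrum of `a` lies in the open right half plane, then some `1 - η a` has all its
spectrum in the open unit disc. -/
lemma exists_norm_lt_one_of_re_pos {A : Type*} [NormedRing A] [NormedAlgebra ℂ A]
    [CompleteSpace A] [Nontrivial A] (a : A) (ha : ∀ z ∈ spectrum ℂ a, 0 < z.re) :
    ∃ η : ℝ, 0 < η ∧ ∀ z ∈ spectrum ℂ (1 - (η : ℂ) • a), ‖z‖ < 1 := by
  obtain ⟨w, hw, hmin⟩ := (spectrum.isCompact (𝕜 := ℂ) a).exists_isMinOn (spectrum.nonempty a)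
    Complex.continuous_re.continuousOn
  set m := w.re
  have hm : 0 < m := ha w hw
  -- `R` bounds the spectrum; the factor `‖1‖` is kept because the algebra need not satisfy `‖1‖ =
  -- 1`.
  set R := ‖a‖ * ‖(1 : A)‖
  -- For `v` in the spectrum, `|1 - ηv|² = 1 - 2η Re v + η²|v|² ≤ 1 - 2ηm + η²R²`, and this choice
  -- gives `ηR² < m`.
  set η : ℝ := m / (R ^ 2 + 1)
  have hη : 0 < η := by positivity
  refine ⟨η, hη, fun z hz => ?_⟩
  have h1 : (1 : A) - (η : ℂ) • a = algebraMap ℂ A 1 - (η : ℂ) • a := by simp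
  rw [h1, ← spectrum.singleton_sub_eq, spectrum.smul_eq_smul _ _ (spectrum.nonempty a)] at hz
  obtain ⟨y, hy, z', hz', rfl⟩ := hz
  obtain ⟨v, hv, rfl⟩ := hz'
  obtain rfl : y = 1 := hy
  have hvm : m ≤ v.re := hmin hv
  have hvR : ‖v‖ ≤ R := spectrum.norm_le_norm_mul_of_mem hv
  have hsq : ‖(1 : ℂ) - (η : ℂ) • v‖ ^ 2 = 1 - 2 * η * v.re + η ^ 2 * ‖v‖ ^ 2 := by
    rw [← Complex.normSq_eq_norm_sq, ← Complex.normSq_eq_norm_sq, Complex.normSq_apply,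
      Complex.normSq_apply]
    simp
    ring
  have hηR : η * (R ^ 2 + 1) = m := by
    simp only [η]
    field_simp
  have hv2 : ‖v‖ ^ 2 ≤ R ^ 2 := by gcongr
  have : ‖(1 : ℂ) - (η : ℂ) • v‖ ^ 2 < 1 := by
    rw [hsq]
    have h2 : η ^ 2 * ‖v‖ ^ 2 ≤ η * (η * R ^ 2) := by nlinarith [sq_nonneg η]
    have h3 : η * R ^ 2 < m := by nlinarith
    nlinarith [mul_lt_mul_of_pos_left h3 hη, mul_le_mul_of_nonneg_left hvm hη.le]
  have h0 := norm_nonneg ((1 : ℂ) - (η : ℂ) • v)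
  simp only
  nlinarith

/-- If the spectrum lies in the open unit disc, some power is a strict contraction. -/
lemma exists_norm_pow_le_of_norm_lt_one {A : Type*} [NormedRing A] [NormedAlgebra ℂ A]
    [CompleteSpace A] [Nontrivial A] (a : A) (ha : ∀ z ∈ spectrum ℂ a, ‖z‖ < 1) :
    ∃ (r : ℝ) (M : ℕ), 0 < r ∧ r < 1 ∧ 0 < M ∧ ‖a ^ M‖ ≤ r ^ M := by
  have hlt : spectralRadius ℂ a < (1 : ℝ≥0) :=
    spectrum.spectralRadius_lt_of_forall_lt a fun z hz => by
      have := ha z hz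
      exact_mod_cast this
  obtain ⟨r, hr, hr1⟩ := ENNReal.lt_iff_exists_nnreal_btwn.1 hlt
  have hr1' : r < 1 := by exact_mod_cast hr1
  have hr0 : 0 < r := by
    have : (0 : ℝ≥0∞) < r := lt_of_le_of_lt (zero_le) hr
    exact_mod_cast this
  -- Gelfand's formula, with `r` strictly between the spectral radius and 1.
  have hev := (spectrum.pow_norm_pow_one_div_tendsto_nhds_spectralRadius a).eventually_lt_const hr
  obtain ⟨M, hM, hM1⟩ := (hev.and (eventually_ge_atTop 1)).exists
  refine ⟨r, M, by exact_mod_cast hr0, by exact_mod_cast hr1', hM1, ?_⟩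
  have h1 : ‖a ^ M‖ ^ (1 / M : ℝ) < r := by
    rw [← ENNReal.ofReal_coe_nnreal] at hM
    exact (ENNReal.ofReal_lt_ofReal_iff (by exact_mod_cast hr0)).1 hM
  have hM0 : (M : ℝ) ≠ 0 := by positivity
  calc ‖a ^ M‖ = (‖a ^ M‖ ^ (1 / M : ℝ)) ^ M := by
        rw [← Real.rpow_natCast, ← Real.rpow_mul (norm_nonneg _), one_div_mul_cancel hM0,
          Real.rpow_one]
    _ ≤ (r : ℝ) ^ M := by gcongr

/-- The continuous linear map of a matrix. -/
abbrev toCLM {d : ℕ} (H : Matrix (Fin d) (Fin d) ℝ) : Vec d →L[ℝ] Vec d :=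
  Matrix.toEuclideanCLM (n := Fin d) (𝕜 := ℝ) H

/-- The inclusion of `ℝ^d` in `ℂ^d`. -/
def complexify {d : ℕ} (z : Vec d) : EuclideanSpace ℂ (Fin d) :=
  WithLp.toLp 2 fun i => (z i : ℂ)

lemma norm_complexify {d : ℕ} (z : Vec d) : ‖complexify z‖ = ‖z‖ := by
  simp [complexify, EuclideanSpace.norm_eq]

lemma complexify_toCLM {d : ℕ} (A : Matrix (Fin d) (Fin d) ℝ) (z : Vec d) :
    complexify (toCLM A z) = Matrix.toEuclideanCLM (n := Fin d) (𝕜 := ℂ)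
      (A.map (algebraMap ℝ ℂ)) (complexify z) := by
  ext i
  simp [complexify, Matrix.mulVec, dotProduct]

/-- The spectral argument lives in the complex operator algebra. The inclusion of `ℝ^d` in `ℂ^d` is
isometric and intertwines the two actions, so the bound descends to real vectors. Dimension zero is
separate because there the operator algebra is trivial. -/
lemma exists_pow_contraction {d : ℕ} (H : Matrix (Fin d) (Fin d) ℝ)
    (hH : ∀ z ∈ spectrum ℂ (H.map (algebraMap ℝ ℂ)), 0 < z.re) :
    ∃ (η r : ℝ) (M : ℕ), 0 < η ∧ 0 < r ∧ r < 1 ∧ 0 < M ∧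
      ∀ z : Vec d, ‖((1 - η • toCLM H) ^ M) z‖ ≤ r ^ M * ‖z‖ := by
  rcases Nat.eq_zero_or_pos d with rfl | hd
  · exact ⟨1, 1 / 2, 1, by norm_num, by norm_num, by norm_num, by norm_num, fun z => by
      rw [Subsingleton.elim z 0]; simp⟩
  have : Nonempty (Fin d) := ⟨⟨0, hd⟩⟩
  have : Nontrivial (EuclideanSpace ℂ (Fin d) →L[ℂ] EuclideanSpace ℂ (Fin d)) := inferInstance
  set T := Matrix.toEuclideanCLM (n := Fin d) (𝕜 := ℂ)
  have hspec : ∀ z ∈ spectrum ℂ (T (H.map (algebraMap ℝ ℂ))), 0 < z.re := by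
    intro z hz
    rw [AlgEquiv.spectrum_eq T] at hz
    exact hH z hz
  obtain ⟨η, hη, hη1⟩ := exists_norm_lt_one_of_re_pos _ hspec
  obtain ⟨r, M, hr, hr1, hM, hle⟩ := exists_norm_pow_le_of_norm_lt_one _ hη1
  refine ⟨η, r, M, hη, hr, hr1, hM, fun z => ?_⟩
  have hmap : ((1 - η • H).map (algebraMap ℝ ℂ)) = 1 - (η : ℂ) • H.map (algebraMap ℝ ℂ) := by
    ext i j
    simp [Matrix.one_apply]
    split_ifs <;> simp
  have hA : (1 - η • toCLM H) = toCLM (1 - η • H) := by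
    simp [toCLM]
  have hpow : ∀ n : ℕ, ∀ z : Vec d, complexify (((1 - η • toCLM H) ^ n) z)
      = ((1 - (η : ℂ) • T (H.map (algebraMap ℝ ℂ))) ^ n) (complexify z) := by
    intro n
    induction n with
    | zero => intro z; simp
    | succ n ih =>
      intro z
      rw [pow_succ, pow_succ, mul_apply_eq_comp, mul_apply_eq_comp, ih, hA,
        complexify_toCLM, hmap, map_sub, map_one, map_smul]
  rw [← norm_complexify, hpow, ← norm_complexify z]
  exact (ContinuousLinearMap.le_opNorm _ _).trans (by gcongr)

/-- A linear map whose spectrum lies in the open right half plane is uniformly contracting for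
a suitable norm: the maps `1 - η H` shrink it by the factor `1 - c η`. -/
lemma exists_contracting_seminorm {d : ℕ} (H : Matrix (Fin d) (Fin d) ℝ)
    (hH : ∀ z ∈ spectrum ℂ (H.map (algebraMap ℝ ℂ)), 0 < z.re) :
    ∃ (N : Seminorm ℝ (Vec d)) (C c η₁ : ℝ), 0 < C ∧ 0 < c ∧ 0 < η₁ ∧
      (∀ z, ‖z‖ ≤ N z) ∧ (∀ z, N z ≤ C * ‖z‖) ∧
      ∀ η, 0 ≤ η → η ≤ η₁ → ∀ z, N (z - η • toCLM H z) ≤ (1 - c * η) * N z := by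
  obtain ⟨η', r, M, hη', hr, hr1, hM, hle⟩ := exists_pow_contraction H hH
  set A : Vec d →L[ℝ] Vec d := 1 - η' • toCLM H
  -- Applying `A` shifts the weighted orbit sum by one index: the term `n = 0`, equal to `‖z‖`, is
  -- lost and `r^{-M} ‖A^M z‖ ≤ ‖z‖` is gained. Hence `N (A z) ≤ r N z`.
  let N : Seminorm ℝ (Vec d) := Seminorm.of
    (fun z => ∑ n ∈ Finset.range M, (r ^ n)⁻¹ * ‖(A ^ n) z‖)
    (fun y z => by
      rw [← Finset.sum_add_distrib]
      refine Finset.sum_le_sum fun n _ => ?_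
      rw [map_add, ← mul_add]
      gcongr
      exact norm_add_le _ _)
    (fun u z => by
      rw [Finset.mul_sum]
      refine Finset.sum_congr rfl fun n _ => ?_
      rw [map_smul, norm_smul]
      ring)
  have hN : ∀ z, N z = ∑ n ∈ Finset.range M, (r ^ n)⁻¹ * ‖(A ^ n) z‖ := fun z => rfl
  have hAz : ∀ z, N (A z) ≤ r * N z := by
    intro z
    have h1 : N (A z) = ∑ n ∈ Finset.range M, r * ((r ^ (n + 1))⁻¹ * ‖(A ^ (n + 1)) z‖) := by
      rw [hN]
      refine Finset.sum_congr rfl fun n _ => ?_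
      rw [pow_succ A, mul_apply_eq_comp, pow_succ]
      field_simp
    have h2 := Finset.sum_range_succ' (fun n => (r ^ n)⁻¹ * ‖(A ^ n) z‖) M
    rw [Finset.sum_range_succ] at h2
    rw [h1, ← Finset.mul_sum, hN]
    have h3 : (r ^ M)⁻¹ * ‖(A ^ M) z‖ ≤ ‖z‖ := by
      rw [inv_mul_le_iff₀ (by positivity)]
      exact hle z
    simp only [pow_zero, inv_one, one_mul, one_apply_eq_self] at h2
    refine mul_le_mul_of_nonneg_left ?_ hr.le
    linarith
  refine ⟨N, ∑ n ∈ Finset.range M, (r ^ n)⁻¹ * ‖A ^ n‖ + 1, (1 - r) / η', η', ?_, ?_, hη', ?_,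
    ?_, ?_⟩
  · positivity
  · exact div_pos (by linarith) hη'
  · intro z
    rw [hN]
    have := Finset.single_le_sum (f := fun n => (r ^ n)⁻¹ * ‖(A ^ n) z‖)
      (fun i _ => by positivity) (Finset.mem_range.2 hM)
    simpa using this
  · intro z
    rw [hN, add_mul, Finset.sum_mul]
    have : ∑ n ∈ Finset.range M, (r ^ n)⁻¹ * ‖(A ^ n) z‖
        ≤ ∑ n ∈ Finset.range M, (r ^ n)⁻¹ * ‖A ^ n‖ * ‖z‖ := by
      refine Finset.sum_le_sum fun n _ => ?_
      rw [mul_assoc]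
      gcongr
      exact ContinuousLinearMap.le_opNorm _ _
    linarith [norm_nonneg z]
  · intro η h0 h1 z
    have hq0 : 0 ≤ η / η' := by positivity
    have hq1 : 0 ≤ 1 - η / η' := by
      rw [sub_nonneg, div_le_one hη']
      exact h1
    -- For steps below `η'` the map is a convex combination of the identity and `A`, so one step
    -- size controls all smaller ones.
    have hdec : z - η • toCLM H z = (1 - η / η') • z + (η / η') • A z := by
      simp only [A, sub_apply, one_apply_eq_self,
        smul_apply, smul_sub, sub_smul, smul_smul]
      rw [div_mul_cancel₀ _ hη'.ne', one_smul]
      abel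
    rw [hdec]
    calc N ((1 - η / η') • z + (η / η') • A z)
        ≤ N ((1 - η / η') • z) + N ((η / η') • A z) := map_add_le_add _ _ _
      _ = (1 - η / η') * N z + (η / η') * N (A z) := by
          rw [map_smul_eq_mul, map_smul_eq_mul, Real.norm_of_nonneg hq0, Real.norm_of_nonneg hq1]
      _ ≤ (1 - η / η') * N z + (η / η') * (r * N z) := by gcongr; exact hAz z
      _ = (1 - (1 - r) / η' * η) * N z := by ring

lemma toCLM_inv_apply {d : ℕ} (H : Matrix (Fin d) (Fin d) ℝ)
    (hH : ∀ z ∈ spectrum ℂ (H.map (algebraMap ℝ ℂ)), 0 < z.re) (z : Vec d) :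
    toCLM H⁻¹ (toCLM H z) = z := by
  have h0 : (0 : ℂ) ∉ spectrum ℂ (H.map (algebraMap ℝ ℂ)) := fun h => by
    simpa using hH 0 h
  rw [spectrum.zero_notMem_iff, Matrix.isUnit_iff_isUnit_det] at h0
  have hdet : IsUnit H.det := by
    have : (H.map (algebraMap ℝ ℂ)).det = algebraMap ℝ ℂ H.det :=
      (RingHom.map_det (algebraMap ℝ ℂ) H).symm
    rw [this] at h0
    simpa [isUnit_iff_ne_zero] using h0
  rw [← mul_apply_eq_comp, ← map_mul, Matrix.nonsing_inv_mul _ hdet, map_one]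
  rfl

end ContractingSeminorm

/-! ### A one-dimensional expansion of the power `2p`. -/

section ScalarInequality

/-- For `|qu| ≤ 1`, compare with `exp (qu)` and its second-order expansion. Otherwise `1 ≤ q|u|`, so
the left side is at most `((1 + q)|u|)^q` and the linear term is dominated by `q²u²`. -/
lemma abs_one_add_rpow_le {q : ℝ} (hq : 1 ≤ q) (u : ℝ) :
    |1 + u| ^ q ≤ 1 + q * u + (q ^ 2 + (1 + q) ^ q) * (u ^ 2 + |u| ^ q) := by
  have hC : 0 ≤ (1 + q) ^ q := by positivity
  have hu2 : 0 ≤ u ^ 2 := sq_nonneg u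
  have huq : 0 ≤ |u| ^ q := by positivity
  rcases le_total (|q * u|) 1 with h | h
  · have hu : |u| ≤ 1 := by
      rw [abs_mul, abs_of_pos (by linarith)] at h
      nlinarith [abs_nonneg u]
    have h1 : 0 ≤ 1 + u := by linarith [neg_abs_le u]
    have h2 : |1 + u| ^ q ≤ Real.exp (q * u) := by
      rw [abs_of_nonneg h1, mul_comm, Real.exp_mul]
      exact Real.rpow_le_rpow h1 (by linarith [Real.add_one_le_exp u]) (by linarith)
    have h3 := (abs_le.1 (Real.abs_exp_sub_one_sub_id_le h)).2
    have h4 : 0 ≤ q ^ 2 * |u| ^ q := by positivity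
    have h5 : 0 ≤ (1 + q) ^ q * u ^ 2 := by positivity
    have h6 : 0 ≤ (1 + q) ^ q * |u| ^ q := by positivity
    nlinarith
  · rw [abs_mul, abs_of_pos (by linarith)] at h
    have h2 : |1 + u| ^ q ≤ (1 + q) ^ q * |u| ^ q := by
      rw [← Real.mul_rpow (by linarith) (abs_nonneg u)]
      refine Real.rpow_le_rpow (abs_nonneg _) ?_ (by linarith)
      calc |1 + u| ≤ |1| + |u| := abs_add_le _ _
        _ ≤ (1 + q) * |u| := by rw [abs_one]; linarith
    have h3 : -(q * u) ≤ q ^ 2 * u ^ 2 := by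
      have : -(q * u) ≤ q * |u| := by nlinarith [neg_abs_le u]
      rw [← sq_abs u]
      nlinarith
    have h4 : 0 ≤ q ^ 2 * |u| ^ q := by positivity
    have h5 : 0 ≤ (1 + q) ^ q * u ^ 2 := by positivity
    nlinarith

/-- One step of the moment recursion. The linear term will vanish by orthogonality, and the
arbitrarily small factor `κη` is paid by the contraction. The power `η^{p+1}` is what produces
moments of order `η^p`. -/
lemma exists_abs_add_mul_rpow_le {p κ : ℝ} (hp : 1 ≤ p) (hκ : 0 < κ) :
    ∃ C : ℝ, 0 ≤ C ∧ ∀ x y η : ℝ, 0 ≤ η → η ≤ 1 →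
      |x + η * y| ^ (2 * p) ≤ (1 + κ * η) * |x| ^ (2 * p)
        + 2 * p * η * (|x| ^ (2 * p - 2) * x * y) + C * η ^ (p + 1) * |y| ^ (2 * p) := by
  set C₁ : ℝ := (2 * p) ^ 2 + (1 + 2 * p) ^ (2 * p)
  have hC₁ : 0 < C₁ := by positivity
  set C : ℝ := C₁ * (κ / C₁) ^ (1 - p) + C₁ + 1
  have hC : 0 ≤ C := by positivity
  refine ⟨C, hC, fun x y η h0 h1 => ?_⟩
  have hsq : ∀ z : ℝ, |z| ^ (2 * p) = (z ^ 2) ^ p := fun z => by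
    rw [Real.rpow_mul (abs_nonneg z), Real.rpow_two, sq_abs]
  rcases eq_or_ne x 0 with rfl | hx
  · have h2 : η ^ (2 * p) ≤ η ^ (p + 1) := by
      rcases h0.eq_or_lt with rfl | h0
      · rw [Real.zero_rpow (by linarith), Real.zero_rpow (by linarith)]
      · exact Real.rpow_le_rpow_of_exponent_ge h0 h1 (by linarith)
    have h3 : |0 + η * y| ^ (2 * p) = η ^ (2 * p) * |y| ^ (2 * p) := by
      rw [zero_add, abs_mul, abs_of_nonneg h0, Real.mul_rpow h0 (abs_nonneg y)]
    have h4 : 1 ≤ C := by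
      have : 0 ≤ C₁ * (κ / C₁) ^ (1 - p) := by positivity
      simp only [C]
      linarith
    rw [h3, abs_zero, Real.zero_rpow (by linarith)]
    have h5 : 0 ≤ η ^ (p + 1) * |y| ^ (2 * p) := by positivity
    have h6 : η ^ (2 * p) * |y| ^ (2 * p) ≤ η ^ (p + 1) * |y| ^ (2 * p) := by gcongr
    nlinarith
  have hx2 : 0 < x ^ 2 := by positivity
  -- The variables are arranged so that `u² = ηr`; after division by `|x|^{2p}`, the noise term
  -- `η^{p+1}|y|^{2p}` becomes `η r^p`.
  set u := η * y / x
  set r := η * y ^ 2 / x ^ 2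
  have hr : 0 ≤ r := by positivity
  have hur : u ^ 2 = η * r := by
    simp only [u, r]
    field_simp
  have huq : |u| ^ (2 * p) ≤ η * r ^ p := by
    rw [hsq, hur, Real.mul_rpow h0 hr]
    gcongr
    rcases h0.eq_or_lt with h0 | h0
    · rw [← h0, Real.zero_rpow (by linarith)]
    · calc η ^ p ≤ η ^ (1 : ℝ) := Real.rpow_le_rpow_of_exponent_ge h0 h1 hp
        _ = η := Real.rpow_one η
  -- A Young-type inequality obtained by splitting at `r = κ / C₁`: the second-order term is either
  -- absorbed in `κ` or dominated by `r^p`.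
  have hrp : C₁ * r ≤ κ + C₁ * (κ / C₁) ^ (1 - p) * r ^ p := by
    rcases le_total r (κ / C₁) with h | h
    · have : C₁ * r ≤ κ := by
        rw [le_div_iff₀ hC₁] at h
        linarith
      have h' : 0 ≤ C₁ * (κ / C₁) ^ (1 - p) * r ^ p := by positivity
      linarith
    · have hr0 : 0 < r := lt_of_lt_of_le (by positivity) h
      have : r = r ^ (1 - p) * r ^ p := by
        rw [← Real.rpow_add hr0]
        simp
      have h2 : r ^ (1 - p) ≤ (κ / C₁) ^ (1 - p) :=
        Real.rpow_le_rpow_of_nonpos (by positivity) h (by linarith)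
      have h3 : r ≤ (κ / C₁) ^ (1 - p) * r ^ p := by
        nth_rewrite 1 [this]
        gcongr
      nlinarith
  have hmain : |1 + u| ^ (2 * p) ≤ 1 + κ * η + 2 * p * u + C * (η * r ^ p) := by
    have h2 := abs_one_add_rpow_le (q := 2 * p) (by linarith) u
    have h3 : C₁ * (u ^ 2 + |u| ^ (2 * p)) ≤ κ * η + C * (η * r ^ p) := by
      rw [hur]
      have h4 := mul_le_mul_of_nonneg_left huq hC₁.le
      have h5 := mul_le_mul_of_nonneg_left hrp h0
      have h6 : 0 ≤ η * r ^ p := by positivity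
      simp only [C]
      nlinarith
    linarith
  have hx1 : x + η * y = x * (1 + u) := by
    simp only [u]
    field_simp
  have hX : 0 ≤ |x| ^ (2 * p) := by positivity
  have e1 : |x| ^ (2 * p) * u = η * (|x| ^ (2 * p - 2) * x * y) := by
    have : |x| ^ (2 * p) = |x| ^ (2 * p - 2) * x ^ 2 := by
      rw [← sq_abs, ← Real.rpow_two, ← Real.rpow_add (abs_pos.2 hx)]
      simp
    rw [this]
    simp only [u]
    field_simp
  have e2 : |x| ^ (2 * p) * (η * r ^ p) = η ^ (p + 1) * |y| ^ (2 * p) := by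
    have : r ^ p * (x ^ 2) ^ p = η ^ p * (y ^ 2) ^ p := by
      rw [← Real.mul_rpow hr hx2.le, ← Real.mul_rpow h0 (sq_nonneg y)]
      congr 1
      simp only [r]
      field_simp
    rw [hsq, hsq, Real.rpow_add_one' h0 (by linarith)]
    linear_combination η * this
  rw [hx1, abs_mul, Real.mul_rpow (abs_nonneg x) (abs_nonneg _)]
  calc |x| ^ (2 * p) * |1 + u| ^ (2 * p)
      ≤ |x| ^ (2 * p) * (1 + κ * η + 2 * p * u + C * (η * r ^ p)) := by gcongr
    _ = (1 + κ * η) * |x| ^ (2 * p) + 2 * p * (|x| ^ (2 * p) * u)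
        + C * (|x| ^ (2 * p) * (η * r ^ p)) := by ring
    _ = _ := by rw [e1, e2]; ring

end ScalarInequality

/-! ### Polynomial step sizes and the recursions they drive. -/

section StepSizes

variable {η₀ a : ℝ}

lemma stepSize_pos (hη₀ : 0 < η₀) (t : ℕ) : 0 < stepSize η₀ a t := by
  unfold stepSize
  split_ifs with h
  · exact hη₀
  · have : (0 : ℝ) < t := by positivity
    positivity

lemma stepSize_of_ne_zero {t : ℕ} (ht : t ≠ 0) : stepSize η₀ a t = η₀ * (t : ℝ) ^ (-a) :=
  if_neg ht

lemma tendsto_natCast_rpow_neg (ha : 0 < a) :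
    Tendsto (fun t : ℕ => (t : ℝ) ^ (-a)) atTop (𝓝 0) :=
  (tendsto_rpow_neg_atTop ha).comp tendsto_natCast_atTop_atTop

lemma eventually_stepSize_le (ha : 0 < a) {c : ℝ} (hc : 0 < c) :
    ∀ᶠ t : ℕ in atTop, stepSize η₀ a t ≤ c := by
  have h := (tendsto_natCast_rpow_neg ha).const_mul η₀
  rw [mul_zero] at h
  filter_upwards [h.eventually_le_const hc, eventually_ge_atTop 1] with t h1 h2
  rwa [stepSize_of_ne_zero (by omega)]

/-- Bernoulli's inequality for `(1 - 1/(t+1))^β` when `β ≤ 1`; for larger `β` the power is at most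
its base. -/
lemma div_add_one_rpow_le {β : ℝ} (hβ : 0 < β) (t : ℕ) :
    min β 1 * ((t : ℝ) + 1) ^ (β - 1) ≤ ((t : ℝ) + 1) ^ β - (t : ℝ) ^ β := by
  have ht : (0 : ℝ) < (t : ℝ) + 1 := by positivity
  have key : ((t : ℝ) / (t + 1)) ^ β ≤ 1 - min β 1 / (t + 1) := by
    have h1 : (t : ℝ) / (t + 1) = 1 + -(1 / ((t : ℝ) + 1)) := by
      field_simp
      ring
    have h2 : 1 / ((t : ℝ) + 1) ≤ 1 := by
      rw [div_le_one ht]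
      linarith [(Nat.cast_nonneg t : (0 : ℝ) ≤ t)]
    rcases le_total β 1 with h | h
    · rw [min_eq_left h, h1]
      have := rpow_one_add_le_one_add_mul_self (s := -(1 / ((t : ℝ) + 1))) (by linarith)
        hβ.le h
      calc _ ≤ _ := this
        _ = _ := by ring
    · rw [min_eq_right h]
      calc ((t : ℝ) / (t + 1)) ^ β ≤ ((t : ℝ) / (t + 1)) ^ (1 : ℝ) := by
            rcases Nat.eq_zero_or_pos t with rfl | h0
            · simp [Real.zero_rpow hβ.ne']
            · refine Real.rpow_le_rpow_of_exponent_ge (by positivity) ?_ h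
              rw [div_le_one ht]
              linarith
        _ = 1 - 1 / (t + 1) := by
            rw [Real.rpow_one, h1]
            ring
  rw [Real.div_rpow (by positivity) ht.le, div_le_iff₀ (by positivity)] at key
  rw [Real.rpow_sub_one ht.ne']
  calc min β 1 * (((t : ℝ) + 1) ^ β / (t + 1)) = min β 1 / (t + 1) * ((t : ℝ) + 1) ^ β := by ring
    _ ≤ _ := by linarith

lemma add_one_rpow_sub_le (ha : 0 < a) (ha1 : a ≤ 1) (t : ℕ) :
    ((t : ℝ) + 1) ^ a - (t : ℝ) ^ a ≤ ((t : ℝ) + 1) ^ (a - 1) := by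
  have ht : (0 : ℝ) < (t : ℝ) + 1 := by positivity
  have key : (t : ℝ) / (t + 1) ≤ ((t : ℝ) / (t + 1)) ^ a := by
    rcases Nat.eq_zero_or_pos t with rfl | h0
    · simp [Real.zero_rpow ha.ne']
    · calc (t : ℝ) / (t + 1) = ((t : ℝ) / (t + 1)) ^ (1 : ℝ) := (Real.rpow_one _).symm
        _ ≤ _ := by
            refine Real.rpow_le_rpow_of_exponent_ge (by positivity) ?_ ha1
            rw [div_le_one ht]
            linarith
  rw [Real.div_rpow (by positivity) ht.le, le_div_iff₀ (by positivity)] at key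
  rw [Real.rpow_sub_one ht.ne']
  have : (t : ℝ) / (t + 1) * ((t : ℝ) + 1) ^ a
      = ((t : ℝ) + 1) ^ a - ((t : ℝ) + 1) ^ a / (t + 1) := by
    field_simp
    ring
  linarith

/-- The relative decrease of `t^{-m}` in one step is about `m/t`, which is negligible against `κ
t^{-a}` since `a < 1`. -/
lemma eventually_one_sub_mul_rpow_neg_le (ha1 : a < 1) {κ : ℝ} (hκ : 0 < κ) (m : ℝ) :
    ∀ᶠ t : ℕ in atTop,
      (1 - κ * (t : ℝ) ^ (-a)) * (t : ℝ) ^ (-m) ≤ ((t : ℝ) + 1) ^ (-m) := by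
  -- Bernoulli's inequality needs an exponent at least 1; raising `m` only lowers the power of the
  -- ratio `t/(t+1)`.
  set M := max m 1
  have hM : 1 ≤ M := le_max_right _ _
  have hlim := (tendsto_natCast_rpow_neg (a := 1 - a) (by linarith)).const_mul (M / κ)
  rw [mul_zero] at hlim
  filter_upwards [hlim.eventually_le_const one_pos, eventually_ge_atTop 1] with t h1 h2
  have ht : (0 : ℝ) < t := by positivity
  have ht1 : (0 : ℝ) < (t : ℝ) + 1 := by positivity
  have h3 : 1 - κ * (t : ℝ) ^ (-a) ≤ ((t : ℝ) / (t + 1)) ^ m := by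
    have hle1 : (t : ℝ) / (t + 1) ≤ 1 := by
      rw [div_le_one ht1]
      linarith
    have h4 : 1 / ((t : ℝ) + 1) ≤ 1 := by
      rw [div_le_one ht1]
      linarith
    have h5 := one_add_mul_self_le_rpow_one_add (s := -(1 / ((t : ℝ) + 1))) (by linarith) hM
    have h6 : (t : ℝ) / (t + 1) = 1 + -(1 / ((t : ℝ) + 1)) := by
      field_simp
      ring
    rw [← h6] at h5
    have h7 : ((t : ℝ) / (t + 1)) ^ M ≤ ((t : ℝ) / (t + 1)) ^ m :=
      Real.rpow_le_rpow_of_exponent_ge (by positivity) hle1 (le_max_left _ _)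
    have h8 : M * (1 / ((t : ℝ) + 1)) ≤ κ * (t : ℝ) ^ (-a) := by
      have h9 : M * (t : ℝ)⁻¹ ≤ κ * (t : ℝ) ^ (-a) := by
        have h10 : (t : ℝ)⁻¹ = (t : ℝ) ^ (-(1 - a)) * (t : ℝ) ^ (-a) := by
          rw [← Real.rpow_add ht, ← Real.rpow_neg_one]
          congr 1
          ring
        have h11 : M * (t : ℝ) ^ (-(1 - a)) ≤ κ := by
          have := mul_le_mul_of_nonneg_left h1 hκ.le
          calc M * (t : ℝ) ^ (-(1 - a)) = κ * (M / κ * (t : ℝ) ^ (-(1 - a))) := by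
                field_simp
            _ ≤ κ * 1 := this
            _ = κ := mul_one κ
        rw [h10, ← mul_assoc]
        gcongr
      refine le_trans ?_ h9
      rw [one_div]
      gcongr
      linarith
    linarith
  rw [Real.rpow_neg ht.le m, Real.rpow_neg ht1.le m, ← div_eq_mul_inv,
    div_le_iff₀ (by positivity), inv_mul_eq_div, ← Real.div_rpow ht.le ht1.le]
  exact h3

/-- The induction step for `B t^{-m}`: half of the contraction pays for the decay of `t^{-m}`, the
other half absorbs the forcing. The threshold for `t` does not depend on `B` or `C`, so `B` may be
chosen after the starting time. -/
lemma eventually_recursion_le (ha1 : a < 1) {κ : ℝ} (hκ : 0 < κ) (m : ℝ) :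
    ∀ᶠ t : ℕ in atTop, ∀ B C : ℝ, 0 ≤ B → C ≤ κ / 2 * B →
      (1 - κ * (t : ℝ) ^ (-a)) * (B * (t : ℝ) ^ (-m)) + C * ((t : ℝ) ^ (-a) * (t : ℝ) ^ (-m))
        ≤ B * ((t : ℝ) + 1) ^ (-m) := by
  filter_upwards [eventually_one_sub_mul_rpow_neg_le (a := a) ha1 (half_pos hκ) m] with t h B C hB hC
  have h1 : 0 ≤ (t : ℝ) ^ (-a) * (t : ℝ) ^ (-m) := by positivity
  nlinarith [mul_le_mul_of_nonneg_left h hB, mul_le_mul_of_nonneg_right hC h1]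

/-- A sequence which is contracted by the factors `1 - κ t^{-a}`, `a < 1`, decays faster than any
power. -/
lemma exists_forall_le_of_contraction (ha : 0 < a) (ha1 : a < 1) {κ : ℝ} (hκ : 0 < κ) (m : ℝ)
    {v : ℕ → ℝ} (hv0 : ∀ t, 0 ≤ v t)
    (hv : ∀ᶠ t : ℕ in atTop, v (t + 1) ≤ (1 - κ * (t : ℝ) ^ (-a)) * v t) :
    ∃ B : ℝ, ∀ᶠ t : ℕ in atTop, v t ≤ B * (t : ℝ) ^ (-m) := by
  have h1 := (tendsto_natCast_rpow_neg ha).const_mul κ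
  rw [mul_zero] at h1
  obtain ⟨T, hT⟩ := eventually_atTop.1 (((hv.and (eventually_recursion_le (a := a) ha1 hκ m)).and
    (h1.eventually_le_const one_pos)).and (eventually_ge_atTop 1))
  have hTpos : (0 : ℝ) < T := by
    have := (hT T le_rfl).2
    positivity
  refine ⟨v T / (T : ℝ) ^ (-m), eventually_atTop.2 ⟨T, fun t ht => ?_⟩⟩
  induction t, ht using Nat.le_induction with
  | base => rw [div_mul_cancel₀ _ (by positivity)]
  | succ t ht ih =>
    obtain ⟨⟨⟨h2, h3⟩, h4⟩, -⟩ := hT t ht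
    have hB : 0 ≤ v T / (T : ℝ) ^ (-m) := div_nonneg (hv0 T) (by positivity)
    have h5 := h3 _ 0 hB (by positivity)
    rw [zero_mul, add_zero] at h5
    push_cast
    exact h2.trans ((mul_le_mul_of_nonneg_left ih (by linarith)).trans h5)

end StepSizes

/-! ### Summation by parts and Kronecker's lemma. -/

section Summation

variable {E : Type*} [NormedAddCommGroup E] [NormedSpace ℝ E]

lemma sum_range_succ_smul_sub (w : ℕ → ℝ) (f : ℕ → E) (T : ℕ) :
    ∑ t ∈ Finset.range (T + 1), w t • (f t - f (t + 1))
      = w 0 • f 0 - w T • f (T + 1)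
        + ∑ t ∈ Finset.range T, (w (t + 1) - w t) • f (t + 1) := by
  induction T with
  | zero => simp [smul_sub]
  | succ T ih =>
    rw [Finset.sum_range_succ, ih, Finset.sum_range_succ _ T, sub_smul, smul_sub]
    abel

/-- After Abel summation the increments of `w` are compared term by term with those of `G`, which
telescope. The divergence of `G` lets the little-o pass to sums and absorbs the constant `w 0 • f
0`. -/
lemma isLittleO_sum_smul_sub {w G : ℕ → ℝ} {f : ℕ → E} (hG : Monotone G)
    (hGtop : Tendsto G atTop atTop)
    (hinc : (fun t => (w (t + 1) - w t) • f (t + 1)) =o[atTop] fun t => G (t + 1) - G t)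
    (hend : (fun t => w t • f (t + 1)) =o[atTop] fun t => G (t + 1)) :
    (fun T => ∑ t ∈ Finset.range T, w t • (f t - f (t + 1))) =o[atTop] G := by
  rw [← map_add_atTop_eq_nat 1, isLittleO_map]
  have hnorm : Tendsto (norm ∘ G) atTop atTop := tendsto_norm_atTop_atTop.comp hGtop
  have hsum : (fun T => ∑ t ∈ Finset.range T, (w (t + 1) - w t) • f (t + 1)) =o[atTop] G := by
    have h1 := hinc.sum_range (fun t => sub_nonneg.2 (hG (Nat.le_succ t))) (by
      simp only [Finset.sum_range_sub]
      exact tendsto_atTop_add_const_right _ _ hGtop)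
    simp only [Finset.sum_range_sub] at h1
    exact h1.trans_isBigO ((isBigO_refl G atTop).sub (isLittleO_const_left.2 (Or.inr hnorm)).isBigO)
  have hshift : G =O[atTop] fun T => G (T + 1) := by
    refine IsBigO.of_bound 1 ?_
    filter_upwards [hGtop.eventually_ge_atTop 0] with t ht
    rw [one_mul, Real.norm_of_nonneg ht, Real.norm_of_nonneg (ht.trans (hG (Nat.le_succ t)))]
    exact hG (Nat.le_succ t)
  have h := ((((isLittleO_const_left (c := w 0 • f 0)).2 (Or.inr hnorm)).trans_isBigO hshift).sub hend).add (hsum.trans_isBigO hshift)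
  refine h.congr_left fun T => ?_
  exact (sum_range_succ_smul_sub w f T).symm

/-- Kronecker's lemma. -/
lemma isLittleO_sum_mul_of_tendsto {w y : ℕ → ℝ} {s : ℝ} (hw : Monotone w)
    (hwtop : Tendsto w atTop atTop)
    (hy : Tendsto (fun n => ∑ j ∈ Finset.range n, y j) atTop (𝓝 s)) :
    (fun n => ∑ j ∈ Finset.range n, w j * y j) =o[atTop] w := by
  -- Tails of the series: `y j = f j - f (j + 1)` with `f` tending to zero, so Abel summation
  -- applies with `G = w`.
  set f : ℕ → ℝ := fun n => s - ∑ j ∈ Finset.range n, y j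
  have hf : Tendsto (fun n => f (n + 1)) atTop (𝓝 0) := by
    have := (tendsto_const_nhds (x := s)).sub hy
    rw [sub_self] at this
    exact this.comp (tendsto_add_atTop_nat 1)
  have hf1 : (fun n => f (n + 1)) =o[atTop] fun _ => (1 : ℝ) := (isLittleO_one_iff ℝ).2 hf
  have h := isLittleO_sum_smul_sub (w := w) (G := w) (f := f) hw hwtop ?_ ?_
  · refine h.congr_left fun n => Finset.sum_congr rfl fun j _ => ?_
    simp only [f, Finset.sum_range_succ, smul_eq_mul]
    ring
  · simpa using (isBigO_refl (fun t => w (t + 1) - w t) atTop).mul_isLittleO hf1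
  · have h1 : (fun n => w n) =O[atTop] fun n => w (n + 1) := by
      refine IsBigO.of_bound 1 ?_
      filter_upwards [hwtop.eventually_ge_atTop 0] with t ht
      rw [one_mul, Real.norm_of_nonneg ht, Real.norm_of_nonneg (ht.trans (hw (Nat.le_succ t)))]
      exact hw (Nat.le_succ t)
    simpa using h1.mul_isLittleO hf1

end Summation

/-! ### Comparison sequences of powers and logarithms. -/

section PowLog

/-- The comparison sequence `t^β (log t)^m`. -/
def powLog (β m : ℝ) (t : ℕ) : ℝ := (t : ℝ) ^ β * Real.log t ^ m

lemma powLog_nonneg (β m : ℝ) (t : ℕ) : 0 ≤ powLog β m t :=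
  mul_nonneg (by positivity) (Real.rpow_nonneg (Real.log_natCast_nonneg t) m)

lemma eventually_one_le_log : ∀ᶠ t : ℕ in atTop, 1 ≤ Real.log t :=
  (Real.tendsto_log_atTop.comp tendsto_natCast_atTop_atTop).eventually_ge_atTop 1

lemma log_natCast_mono : Monotone fun t : ℕ => Real.log t := by
  intro s t hst
  rcases Nat.eq_zero_or_pos s with rfl | hs
  · simpa using Real.log_natCast_nonneg t
  · exact Real.log_le_log (by positivity) (by exact_mod_cast hst)

lemma powLog_mono {β m : ℝ} (hβ : 0 ≤ β) (hm : 0 ≤ m) : Monotone (powLog β m) := by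
  intro s t hst
  have h1 : (s : ℝ) ≤ t := by exact_mod_cast hst
  have h2 := log_natCast_mono hst
  have h3 := Real.log_natCast_nonneg s
  unfold powLog
  exact mul_le_mul (Real.rpow_le_rpow (by positivity) h1 hβ) (Real.rpow_le_rpow h3 h2 hm)
    (Real.rpow_nonneg h3 m) (by positivity)

lemma tendsto_powLog_atTop {β m : ℝ} (hβ : 0 < β) (hm : 0 ≤ m) :
    Tendsto (powLog β m) atTop atTop := by
  refine tendsto_atTop_mono' _ ?_ ((tendsto_rpow_atTop hβ).comp tendsto_natCast_atTop_atTop)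
  filter_upwards [eventually_one_le_log] with t ht
  have : 1 ≤ Real.log t ^ m := Real.one_le_rpow ht hm
  exact le_mul_of_one_le_right (Real.rpow_nonneg (Nat.cast_nonneg t) β) this

lemma powLog_isBigO {β m m' : ℝ} (h : m ≤ m') : powLog β m =O[atTop] powLog β m' := by
  refine IsBigO.of_bound 1 ?_
  filter_upwards [eventually_one_le_log] with t ht
  rw [one_mul, Real.norm_of_nonneg (powLog_nonneg _ _ _), Real.norm_of_nonneg (powLog_nonneg _ _ _)]
  unfold powLog
  gcongr

lemma powLog_isLittleO {β m m' : ℝ} (h : m < m') : powLog β m =o[atTop] powLog β m' := by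
  have h1 : (fun t : ℕ => Real.log t ^ (m - m')) =o[atTop] fun _ => (1 : ℝ) := by
    rw [isLittleO_one_iff]
    have := (tendsto_rpow_neg_atTop (y := m' - m) (by linarith)).comp
      (Real.tendsto_log_atTop.comp tendsto_natCast_atTop_atTop)
    rw [neg_sub] at this
    exact this
  have h2 := (isBigO_refl (powLog β m') atTop).mul_isLittleO h1
  refine h2.congr' ?_ (by simp)
  filter_upwards [eventually_one_le_log] with t ht
  rw [powLog, powLog, mul_assoc, ← Real.rpow_add (by linarith)]
  congr 2
  ring

lemma powLog_isLittleO_of_lt {β β' : ℝ} (h : β < β') (m m' : ℝ) :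
    powLog β m =o[atTop] powLog β' m' := by
  have h1 : (fun t : ℕ => Real.log t ^ (m - m')) =o[atTop] fun t : ℕ => (t : ℝ) ^ (β' - β) :=
    (isLittleO_log_rpow_rpow_atTop (m - m') (sub_pos.2 h)).comp_tendsto tendsto_natCast_atTop_atTop
  have h2 := (isBigO_refl (powLog β m') atTop).mul_isLittleO h1
  refine h2.congr' ?_ ?_
  · filter_upwards [eventually_one_le_log] with t ht
    rw [powLog, powLog, mul_assoc, ← Real.rpow_add (by linarith)]
    congr 2
    ring
  · filter_upwards [eventually_ge_atTop 1] with t ht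
    have : (0 : ℝ) < t := by positivity
    rw [powLog, powLog, mul_right_comm, ← Real.rpow_add this]
    congr 2
    ring

lemma inv_mul_powLog (β m : ℝ) {t : ℕ} (ht : t ≠ 0) :
    (t : ℝ)⁻¹ * powLog β m t = powLog (β - 1) m t := by
  have : (t : ℝ) ≠ 0 := by positivity
  rw [powLog, powLog, Real.rpow_sub_one this]
  ring

/-- Summation by parts along the inverse step sizes. -/
lemma isLittleO_sum_inv_stepSize {E : Type*} [NormedAddCommGroup E] [NormedSpace ℝ E]
    {η₀ a θ m : ℝ} (hη₀ : 0 < η₀) (ha : 0 < a) (ha1 : a < 1) (hθ : 0 ≤ θ) (hm : 0 ≤ m)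
    {f : ℕ → E} (hf : f =o[atTop] powLog (θ - a / 2) m) :
    (fun T => ∑ t ∈ Finset.range T, (stepSize η₀ a t)⁻¹ • (f t - f (t + 1)))
      =o[atTop] powLog (θ + a / 2) m := by
  have hβ : 0 < θ + a / 2 := by linarith
  have hw1 : ∀ t : ℕ, (stepSize η₀ a (t + 1))⁻¹ = η₀⁻¹ * ((t : ℝ) + 1) ^ a := by
    intro t
    rw [stepSize_of_ne_zero (by omega), mul_inv, Real.rpow_neg (by positivity), inv_inv]
    push_cast
    rfl
  -- The lower and upper bounds on the inverse step include the exceptional first step `η₀`, where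
  -- `0^a = 0`. They give increments at most `η₀⁻¹ (t+1)^{a-1}` without treating `t = 0` apart.
  have hw : ∀ t : ℕ, η₀⁻¹ * (t : ℝ) ^ a ≤ (stepSize η₀ a t)⁻¹ := by
    intro t
    rcases t with _ | t
    · simp [stepSize, Real.zero_rpow ha.ne', hη₀.le]
    · rw [hw1]
      push_cast
      exact le_rfl
  have hw' : ∀ t : ℕ, (stepSize η₀ a t)⁻¹ ≤ η₀⁻¹ * ((t : ℝ) + 1) ^ a := by
    intro t
    rcases t with _ | t
    · simp [stepSize]
    · rw [hw1]
      have := Real.rpow_le_rpow (z := a) (by positivity)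
        (by push_cast; linarith : ((t : ℝ) + 1) ≤ ((t + 1 : ℕ) : ℝ) + 1) ha.le
      gcongr
  have hf1 : (fun t => f (t + 1)) =o[atTop] fun t => powLog (θ - a / 2) m (t + 1) :=
    hf.comp_tendsto (tendsto_add_atTop_nat 1)
  refine isLittleO_sum_smul_sub (powLog_mono hβ.le hm) (tendsto_powLog_atTop hβ hm) ?_ ?_
  · have h1 : (fun t => (stepSize η₀ a (t + 1))⁻¹ - (stepSize η₀ a t)⁻¹)
        =O[atTop] fun t : ℕ => ((t : ℝ) + 1) ^ (a - 1) := by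
      refine IsBigO.of_bound η₀⁻¹ (Eventually.of_forall fun t => ?_)
      have h2 : 0 ≤ (stepSize η₀ a (t + 1))⁻¹ - (stepSize η₀ a t)⁻¹ := by
        rw [hw1]
        linarith [hw' t]
      rw [Real.norm_of_nonneg h2, Real.norm_of_nonneg (by positivity), hw1]
      have h3 := mul_le_mul_of_nonneg_left (add_one_rpow_sub_le ha ha1.le t) (inv_pos.2 hη₀).le
      linarith [hw t]
    refine (h1.smul_isLittleO hf1).trans_isBigO ?_
    refine IsBigO.of_bound (min (θ + a / 2) 1)⁻¹ (Eventually.of_forall fun t => ?_)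
    have hmin : 0 < min (θ + a / 2) 1 := lt_min hβ one_pos
    have ht : (0 : ℝ) < (t : ℝ) + 1 := by positivity
    have hlog := Real.rpow_nonneg (Real.log_natCast_nonneg (t + 1)) m
    have hlog' : Real.log t ^ m ≤ Real.log (t + 1 : ℕ) ^ m :=
      Real.rpow_le_rpow (Real.log_natCast_nonneg t) (log_natCast_mono (Nat.le_succ t)) hm
    rw [Real.norm_of_nonneg (sub_nonneg.2 (powLog_mono hβ.le hm (Nat.le_succ t))), smul_eq_mul,
      Real.norm_of_nonneg (mul_nonneg (by positivity) (powLog_nonneg _ _ _)), inv_mul_eq_div,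
      le_div_iff₀ hmin]
    have e1 : ((t : ℝ) + 1) ^ (a - 1) * powLog (θ - a / 2) m (t + 1)
        = ((t : ℝ) + 1) ^ (θ + a / 2 - 1) * Real.log (t + 1 : ℕ) ^ m := by
      unfold powLog
      push_cast
      rw [← mul_assoc, ← Real.rpow_add ht]
      congr 2
      ring
    rw [e1]
    -- The increment of the power alone suffices, since the logarithmic factor is nondecreasing.
    have h4 := mul_le_mul_of_nonneg_right (div_add_one_rpow_le hβ t) hlog
    have h5 : (t : ℝ) ^ (θ + a / 2) * Real.log t ^ m
        ≤ (t : ℝ) ^ (θ + a / 2) * Real.log (t + 1 : ℕ) ^ m := by gcongr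
    unfold powLog
    push_cast at h4 h5 ⊢
    nlinarith
  · have h1 : (fun t => (stepSize η₀ a t)⁻¹) =O[atTop] fun t : ℕ => ((t : ℝ) + 1) ^ a := by
      refine IsBigO.of_bound η₀⁻¹ (Eventually.of_forall fun t => ?_)
      rw [Real.norm_of_nonneg (inv_pos.2 (stepSize_pos hη₀ t)).le,
        Real.norm_of_nonneg (by positivity)]
      exact hw' t
    refine (h1.smul_isLittleO hf1).congr_right fun t => ?_
    have ht : (0 : ℝ) < (t : ℝ) + 1 := by positivity
    unfold powLog
    push_cast
    rw [smul_eq_mul, ← mul_assoc, ← Real.rpow_add ht]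
    congr 2
    ring

end PowLog

/-! ### Balancing the terms of the error rate. -/

section Rates

lemma linearRate_eq (s a ε : ℝ) : linearRate s a ε = fun t => powLog (-1) ε t
    + powLog (s / 2 - (2 - a) / 2) (s / 2 + ε) t + powLog (-((1 + a) / 2)) (1 / 2 + ε) t := rfl

lemma powLog_isBigO_linearRate_moment (s a ε : ℝ) :
    powLog (s / 2 - (2 - a) / 2) (s / 2 + ε) =O[atTop] linearRate s a ε := by
  rw [linearRate_eq]
  refine IsBigO.of_bound 1 (Eventually.of_forall fun t => ?_)
  have h1 := powLog_nonneg (-1) ε t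
  have h2 := powLog_nonneg (s / 2 - (2 - a) / 2) (s / 2 + ε) t
  have h3 := powLog_nonneg (-((1 + a) / 2)) (1 / 2 + ε) t
  rw [one_mul, Real.norm_of_nonneg h2, Real.norm_of_nonneg (by positivity)]
  linarith

lemma powLog_isBigO_linearRate_martingale (s a ε : ℝ) :
    powLog (-((1 + a) / 2)) (1 / 2 + ε) =O[atTop] linearRate s a ε := by
  rw [linearRate_eq]
  refine IsBigO.of_bound 1 (Eventually.of_forall fun t => ?_)
  have h1 := powLog_nonneg (-1) ε t
  have h2 := powLog_nonneg (s / 2 - (2 - a) / 2) (s / 2 + ε) t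
  have h3 := powLog_nonneg (-((1 + a) / 2)) (1 / 2 + ε) t
  rw [one_mul, Real.norm_of_nonneg h3, Real.norm_of_nonneg (by positivity)]
  linarith

/-- At `a = (1 - s)/2` the second and third exponents both equal `-(3 - s)/4`, and `t⁻¹` is smaller
because `s > -1`. -/
lemma linearRate_isBigO_powLog {s ε : ℝ} (hs0 : 0 ≤ s) (hs1 : s < 1) :
    linearRate s ((1 - s) / 2) ε =O[atTop] powLog (-((3 - s) / 4)) (1 / 2 + ε) := by
  rw [linearRate_eq]
  refine ((powLog_isLittleO_of_lt (by linarith) _ _).isBigO.add ?_).add ?_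
  · have : s / 2 - (2 - (1 - s) / 2) / 2 = -((3 - s) / 4) := by ring
    rw [this]
    exact powLog_isBigO (by linarith)
  · have : -((1 + (1 - s) / 2) / 2) = -((3 - s) / 4) := by ring
    rw [this]
    exact isBigO_refl _ _

/-- Below the balance point the martingale term has the strictly larger exponent, above it the
moment term does; a strict gap in the power outweighs any logarithm. -/
lemma powLog_isLittleO_linearRate {s b : ℝ} (hb : b ≠ (1 - s) / 2) (ε k : ℝ) :
    powLog (-((3 - s) / 4)) k =o[atTop] linearRate s b ε := by
  rcases lt_or_gt_of_ne hb with h | h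
  · exact (powLog_isLittleO_of_lt (by linarith) _ _).trans_isBigO
      (powLog_isBigO_linearRate_martingale s b ε)
  · exact (powLog_isLittleO_of_lt (by linarith) _ _).trans_isBigO
      (powLog_isBigO_linearRate_moment s b ε)

end Rates

/-! ### Polynomial moments of the stable linear recursion. -/

section Moments

variable {d : ℕ} {Ω : Type*} [mΩ : MeasurableSpace Ω]

/-- `e t` is orthogonal to the past `ℱ t`, that is, `e` is a martingale difference sequence
(with `e t` revealed at time `t + 1`). -/
def OrthogonalToPast (P : Measure Ω) (ℱ : Filtration ℕ mΩ) (e : ℕ → Ω → Vec d) : Prop :=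
  ∀ t : ℕ, ∀ φ : Ω → ℝ, Measurable[ℱ t] φ → ∀ ℓ : Vec d →L[ℝ] ℝ,
    Integrable (fun ω => φ ω * ℓ (e t ω)) P → ∫ ω, φ ω * ℓ (e t ω) ∂P = 0

lemma memLp_of_lintegral_rpow_le {P : Measure Ω} {p : ℝ} (hp : 0 < p) {f : Ω → Vec d}
    (hf : Measurable f) {C : ℝ≥0} (h : ∫⁻ ω, ‖f ω‖ₑ ^ p ∂P ≤ C) : MemLp f (ENNReal.ofReal p) P := by
  refine ⟨hf.aestronglyMeasurable, ?_⟩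
  rw [eLpNorm_lt_top_iff_lintegral_rpow_enorm_lt_top (by simpa using hp) ENNReal.ofReal_ne_top,
    ENNReal.toReal_ofReal hp.le]
  exact lt_of_le_of_lt h ENNReal.coe_lt_top

lemma integrable_norm_rpow_of_memLp {P : Measure Ω} [IsFiniteMeasure P] {E : Type*}
    [NormedAddCommGroup E] {p : ℝ} (hp : 0 ≤ p) {f : Ω → E} (hf : MemLp f (ENNReal.ofReal p) P) :
    Integrable (fun ω => ‖f ω‖ ^ p) P := by
  have := hf.integrable_norm_rpow'
  rwa [ENNReal.toReal_ofReal hp] at this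

lemma integral_norm_rpow_le {P : Measure Ω} {p : ℝ} (hp : 0 ≤ p) {f : Ω → Vec d}
    (hf : Measurable f) {C : ℝ≥0} (h : ∫⁻ ω, ‖f ω‖ₑ ^ p ∂P ≤ C) :
    ∫ ω, ‖f ω‖ ^ p ∂P ≤ C := by
  rw [integral_eq_lintegral_of_nonneg_ae (Eventually.of_forall fun ω => by positivity)
    (hf.norm.pow_const p).aestronglyMeasurable]
  refine ENNReal.toReal_le_of_le_ofReal C.2 ?_
  rw [ENNReal.ofReal_coe_nnreal]
  refine le_trans (le_of_eq (lintegral_congr fun ω => ?_)) h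
  rw [← ENNReal.ofReal_rpow_of_nonneg (norm_nonneg _) hp, ofReal_norm]

/-- The recursion `Z_{t+1} = (1 - η_t H) Z_t + η_t e_t`. -/
def IsLinearRecursion (H : Matrix (Fin d) (Fin d) ℝ) (η : ℕ → ℝ) (Z e : ℕ → Ω → Vec d) : Prop :=
  ∀ t ω, Z (t + 1) ω = (Z t ω - η t • toCLM H (Z t ω)) + η t • e t ω

lemma IsLinearRecursion.memLp {H : Matrix (Fin d) (Fin d) ℝ} {η : ℕ → ℝ} {Z e : ℕ → Ω → Vec d}
    (h : IsLinearRecursion H η Z e) {P : Measure Ω} {q : ℝ≥0∞} (h0 : MemLp (Z 0) q P)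
    (he : ∀ t, MemLp (e t) q P) (t : ℕ) : MemLp (Z t) q P := by
  induction t with
  | zero => exact h0
  | succ t ih =>
    have : Z (t + 1) = fun ω => (Z t ω - η t • toCLM H (Z t ω)) + η t • e t ω := funext (h t)
    rw [this]
    exact (ih.sub (((toCLM H).comp_memLp' ih).const_smul (η t))).add ((he t).const_smul (η t))

/-- Provides integrability of the cross term in the moment expansion; the larger of `|x|` and `|y|`
dominates the product. -/
lemma abs_rpow_mul_self_mul_le {p : ℝ} (hp : 1 ≤ p) (x y : ℝ) :
    |(|x| ^ (2 * p - 2) * x) * y| ≤ |x| ^ (2 * p) + |y| ^ (2 * p) := by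
  have key : ∀ u v : ℝ, |u| ^ (2 * p - 2) * |u| * |v| ≤ |u| ^ (2 * p) + |v| ^ (2 * p) := by
    intro u v
    have h1 : ∀ w : ℝ, |w| ^ (2 * p) = |w| ^ (2 * p - 2) * |w| * |w| := by
      intro w
      rcases eq_or_ne w 0 with rfl | hw
      · simp [Real.zero_rpow (by linarith : (2 * p) ≠ 0)]
      · rw [mul_assoc, ← sq, ← Real.rpow_two, ← Real.rpow_add (abs_pos.2 hw)]
        simp
    rcases le_total |v| |u| with h | h
    · have : |u| ^ (2 * p - 2) * |u| * |v| ≤ |u| ^ (2 * p) := by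
        rw [h1 u]
        gcongr
      have h2 : 0 ≤ |v| ^ (2 * p) := by positivity
      linarith
    · have : |u| ^ (2 * p - 2) * |u| * |v| ≤ |v| ^ (2 * p) := by
        rw [h1 v]
        gcongr
        linarith
      have h2 : 0 ≤ |u| ^ (2 * p) := by positivity
      linarith
  rw [abs_mul, abs_mul, abs_of_nonneg (by positivity : 0 ≤ |x| ^ (2 * p - 2))]
  exact key x y

/-- Moments of linear functionals of a stable linear recursion driven by martingale differences. -/
lemma exists_integral_abs_rpow_le {P : Measure Ω} [IsProbabilityMeasure P] {ℱ : Filtration ℕ mΩ}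
    {H : Matrix (Fin d) (Fin d) ℝ} {N : Seminorm ℝ (Vec d)} {CN c η₁ : ℝ} (hCN : 0 < CN)
    (hc : 0 < c) (hη₁ : 0 < η₁) (hNle : ∀ z, N z ≤ CN * ‖z‖)
    (hcontr : ∀ η, 0 ≤ η → η ≤ η₁ → ∀ z, N (z - η • toCLM H z) ≤ (1 - c * η) * N z)
    {η₀ a p : ℝ} (hη₀ : 0 < η₀) (ha : 0 < a) (ha1 : a < 1) (hp : 1 ≤ p)
    {Z e : ℕ → Ω → Vec d} (hrec : IsLinearRecursion H (stepSize η₀ a) Z e)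
    (hZ : ∀ t, Measurable[ℱ t] (Z t)) (he : ∀ t, Measurable (e t))
    (hZ0 : MemLp (Z 0) (ENNReal.ofReal (2 * p)) P) {Ce : ℝ≥0}
    (hmom : ∀ t, ∫⁻ ω, ‖e t ω‖ₑ ^ (2 * p) ∂P ≤ Ce) (horth : OrthogonalToPast P ℱ e) :
    ∃ B : ℝ, 0 ≤ B ∧ ∀ᶠ t : ℕ in atTop, ∀ (ℓ : Vec d →L[ℝ] ℝ) (L : ℝ), 0 ≤ L →
      (∀ z, |ℓ z| ≤ L * N z) →
        ∫ ω, |ℓ (Z t ω)| ^ (2 * p) ∂P ≤ L ^ (2 * p) * (B * (t : ℝ) ^ (-(a * p))) := by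
  have hp2 : 0 < 2 * p := by linarith
  have heLp : ∀ t, MemLp (e t) (ENNReal.ofReal (2 * p)) P := fun t =>
    memLp_of_lintegral_rpow_le hp2 (he t) (hmom t)
  have hZLp : ∀ t, MemLp (Z t) (ENNReal.ofReal (2 * p)) P := hrec.memLp hZ0 heLp
  have hint : ∀ {f : Ω → Vec d}, MemLp f (ENNReal.ofReal (2 * p)) P → ∀ ℓ : Vec d →L[ℝ] ℝ,
      Integrable (fun ω => |ℓ (f ω)| ^ (2 * p)) P := fun hf ℓ =>
    integrable_norm_rpow_of_memLp hp2.le (ℓ.comp_memLp' hf)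
  have hbound : ∀ {f : Ω → Vec d}, MemLp f (ENNReal.ofReal (2 * p)) P →
      ∀ (ℓ : Vec d →L[ℝ] ℝ) (L : ℝ), 0 ≤ L → (∀ z, |ℓ z| ≤ L * N z) →
      ∫ ω, |ℓ (f ω)| ^ (2 * p) ∂P ≤ L ^ (2 * p) * (CN ^ (2 * p) * ∫ ω, ‖f ω‖ ^ (2 * p) ∂P) := by
    intro f hf ℓ L hL hℓ
    rw [← integral_const_mul, ← integral_const_mul]
    refine integral_mono (hint hf ℓ)
      (((integrable_norm_rpow_of_memLp hp2.le hf).const_mul _).const_mul _) fun ω => ?_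
    simp only
    rw [← Real.mul_rpow hCN.le (norm_nonneg _), ← Real.mul_rpow hL (by positivity)]
    refine Real.rpow_le_rpow (abs_nonneg _) ((hℓ _).trans ?_) hp2.le
    exact mul_le_mul_of_nonneg_left (hNle _) hL
  obtain ⟨C, hC, hscalar⟩ := exists_abs_add_mul_rpow_le hp hc
  set K : ℝ := C * (CN ^ (2 * p) * Ce) * η₀ ^ (p + 1)
  have hK : 0 ≤ K := by positivity
  have hκ : 0 < c * η₀ := by positivity
  obtain ⟨T, hT⟩ := eventually_atTop.1 ((((eventually_recursion_le (a := a) ha1 hκ (a * p)).and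
    (eventually_stepSize_le (η₀ := η₀) ha hη₁)).and (eventually_stepSize_le (η₀ := η₀) ha one_pos)).and
    ((eventually_stepSize_le (η₀ := η₀) ha (inv_pos.2 hc)).and (eventually_ge_atTop 1)))
  have hTpos : (0 : ℝ) < T := by
    have := (hT T le_rfl).2.2
    positivity
  set UT : ℝ := CN ^ (2 * p) * ∫ ω, ‖Z T ω‖ ^ (2 * p) ∂P
  have hUT : 0 ≤ UT := mul_nonneg (by positivity) (integral_nonneg fun ω => by positivity)
  -- The first summand starts the induction at time `T`; the second ensures that the noise constant
  -- `K` is at most `(c η₀ / 2) B`.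
  set B : ℝ := UT / (T : ℝ) ^ (-(a * p)) + 2 * K / (c * η₀)
  have hB : 0 ≤ B := by positivity
  refine ⟨B, hB, eventually_atTop.2 ⟨T, fun t ht => ?_⟩⟩
  induction t, ht using Nat.le_induction with
  | base =>
    intro ℓ L hL hℓ
    refine (hbound (hZLp T) ℓ L hL hℓ).trans (mul_le_mul_of_nonneg_left ?_ (by positivity))
    have h1 : UT / (T : ℝ) ^ (-(a * p)) * (T : ℝ) ^ (-(a * p)) = UT :=
      div_mul_cancel₀ _ (by positivity)
    have h2 : 0 ≤ 2 * K / (c * η₀) * (T : ℝ) ^ (-(a * p)) := by positivity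
    simp only [B, add_mul, h1]
    linarith
  | succ t ht ih =>
    intro ℓ L hL hℓ
    obtain ⟨⟨⟨hrecu, hηη₁⟩, hη1⟩, hηc, ht1⟩ := hT t ht
    set η := stepSize η₀ a t
    have hηpos : 0 < η := stepSize_pos hη₀ t
    have hηeq : η = η₀ * (t : ℝ) ^ (-a) := stepSize_of_ne_zero (by omega)
    have hcη : 0 ≤ 1 - c * η := by
      have := mul_le_mul_of_nonneg_left hηc hc.le
      rw [mul_inv_cancel₀ hc.ne'] at this
      linarith
    -- The induction runs over all functionals with their size `L` relative to `N`. One step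
    -- replaces `ℓ` by its pullback, of size `L(1 - cη)`, so scalar inequalities are enough.
    set ℓ' : Vec d →L[ℝ] ℝ := ℓ.comp (1 - η • toCLM H)
    have hℓ'eq : ∀ z, ℓ' z = ℓ (z - η • toCLM H z) := fun z => by
      simp [ℓ']
    have hℓ' : ∀ z, |ℓ' z| ≤ (L * (1 - c * η)) * N z := fun z => by
      rw [hℓ'eq, mul_assoc]
      exact (hℓ _).trans (mul_le_mul_of_nonneg_left (hcontr η hηpos.le hηη₁ z) hL)
    have hIH := ih ℓ' (L * (1 - c * η)) (by positivity) hℓ'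
    have hmZ : Measurable[ℱ t] fun ω => ℓ' (Z t ω) := ℓ'.continuous.measurable.comp (hZ t)
    have hmZ' : Measurable fun ω => ℓ' (Z t ω) := hmZ.mono (ℱ.le t) le_rfl
    have hme : Measurable fun ω => ℓ (e t ω) := ℓ.continuous.measurable.comp (he t)
    have hIx := hint (hZLp t) ℓ'
    have hIy := hint (heLp t) ℓ
    have hcross : Integrable
        (fun ω => (|ℓ' (Z t ω)| ^ (2 * p - 2) * ℓ' (Z t ω)) * ℓ (e t ω)) P := by
      refine (hIx.add hIy).mono' (((hmZ'.abs.pow_const _).mul hmZ').mul hme).aestronglyMeasurable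
        (Eventually.of_forall fun ω => ?_)
      exact abs_rpow_mul_self_mul_le hp _ _
    have hfun : Measurable fun x : ℝ => |x| ^ (2 * p - 2) * x :=
      (measurable_id.abs.pow_const _).mul measurable_id
    have hzero := horth t (fun ω => |ℓ' (Z t ω)| ^ (2 * p - 2) * ℓ' (Z t ω))
      (hfun.comp hmZ) ℓ hcross
    have hadd : Integrable (fun ω => (1 + c * η) * |ℓ' (Z t ω)| ^ (2 * p)
        + 2 * p * η * ((|ℓ' (Z t ω)| ^ (2 * p - 2) * ℓ' (Z t ω)) * ℓ (e t ω))) P :=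
      (hIx.const_mul _).add (hcross.const_mul _)
    have hstep : ∫ ω, |ℓ (Z (t + 1) ω)| ^ (2 * p) ∂P
        ≤ (1 + c * η) * ∫ ω, |ℓ' (Z t ω)| ^ (2 * p) ∂P
          + C * η ^ (p + 1) * ∫ ω, |ℓ (e t ω)| ^ (2 * p) ∂P := by
      calc ∫ ω, |ℓ (Z (t + 1) ω)| ^ (2 * p) ∂P
          ≤ ∫ ω, ((1 + c * η) * |ℓ' (Z t ω)| ^ (2 * p)
            + 2 * p * η * ((|ℓ' (Z t ω)| ^ (2 * p - 2) * ℓ' (Z t ω)) * ℓ (e t ω))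
            + C * η ^ (p + 1) * |ℓ (e t ω)| ^ (2 * p)) ∂P := by
            refine integral_mono (hint (hZLp (t + 1)) ℓ)
              (hadd.add (hIy.const_mul _)) fun ω => ?_
            simp only
            rw [hrec t ω, map_add, map_smul, smul_eq_mul, ← hℓ'eq]
            exact hscalar _ _ _ hηpos.le hη1
        _ = _ := by
            rw [integral_add hadd (hIy.const_mul _),
              integral_add (hIx.const_mul _) (hcross.const_mul _), integral_const_mul,
              integral_const_mul, integral_const_mul, hzero]
            ring
    have hnoise : ∫ ω, |ℓ (e t ω)| ^ (2 * p) ∂P ≤ L ^ (2 * p) * (CN ^ (2 * p) * Ce) := by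
      refine (hbound (heLp t) ℓ L hL hℓ).trans ?_
      gcongr
      exact integral_norm_rpow_le hp2.le (he t) (hmom t)
    -- Two contraction factors suffice: one cancels `1 + cη` from the scalar inequality and the
    -- other remains.
    have hpow : (L * (1 - c * η)) ^ (2 * p) ≤ L ^ (2 * p) * (1 - c * η) ^ 2 := by
      rw [Real.mul_rpow hL hcη]
      gcongr
      rw [← Real.rpow_two]
      rcases hcη.eq_or_lt with h0 | h0
      · rw [← h0, Real.zero_rpow (by linarith), Real.zero_rpow (by norm_num)]
      · exact Real.rpow_le_rpow_of_exponent_ge h0 (by nlinarith) (by linarith)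
    have hηp : η ^ (p + 1) = η₀ ^ (p + 1) * ((t : ℝ) ^ (-a) * (t : ℝ) ^ (-(a * p))) := by
      have htpos : (0 : ℝ) < t := by positivity
      rw [hηeq, Real.mul_rpow hη₀.le (by positivity), ← Real.rpow_mul htpos.le,
        ← Real.rpow_add htpos]
      congr 2
      ring
    have hKB : K ≤ c * η₀ / 2 * B := by
      have h1 : c * η₀ / 2 * (2 * K / (c * η₀)) = K := by field_simp
      have h2 : 0 ≤ c * η₀ / 2 * (UT / (T : ℝ) ^ (-(a * p))) := by positivity
      simp only [B, mul_add, h1]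
      linarith
    have hfin := hrecu B K hB hKB
    rw [mul_assoc c, ← hηeq] at hfin
    set X := B * (t : ℝ) ^ (-(a * p))
    have hX : 0 ≤ X := by positivity
    have hLp : 0 ≤ L ^ (2 * p) := by positivity
    have hfirst : (1 + c * η) * ∫ ω, |ℓ' (Z t ω)| ^ (2 * p) ∂P
        ≤ L ^ (2 * p) * ((1 - c * η) * X) := by
      calc (1 + c * η) * ∫ ω, |ℓ' (Z t ω)| ^ (2 * p) ∂P
          ≤ (1 + c * η) * ((L ^ (2 * p) * (1 - c * η) ^ 2) * X) := by
            have : 0 ≤ 1 + c * η := by positivity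
            refine mul_le_mul_of_nonneg_left (hIH.trans ?_) this
            gcongr
        _ = L ^ (2 * p) * (((1 - (c * η) ^ 2) * (1 - c * η)) * X) := by ring
        _ ≤ L ^ (2 * p) * ((1 - c * η) * X) := by
            gcongr
            nlinarith [sq_nonneg (c * η)]
    have hsecond : C * η ^ (p + 1) * ∫ ω, |ℓ (e t ω)| ^ (2 * p) ∂P
        ≤ L ^ (2 * p) * (K * ((t : ℝ) ^ (-a) * (t : ℝ) ^ (-(a * p)))) := by
      calc C * η ^ (p + 1) * ∫ ω, |ℓ (e t ω)| ^ (2 * p) ∂P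
          ≤ C * η ^ (p + 1) * (L ^ (2 * p) * (CN ^ (2 * p) * Ce)) := by gcongr
        _ = _ := by
            rw [hηp]
            simp only [K]
            ring
    calc ∫ ω, |ℓ (Z (t + 1) ω)| ^ (2 * p) ∂P
        ≤ L ^ (2 * p) * ((1 - c * η) * X
          + K * ((t : ℝ) ^ (-a) * (t : ℝ) ^ (-(a * p)))) := by
          rw [mul_add]
          linarith
      _ ≤ L ^ (2 * p) * (B * ((t + 1 : ℕ) : ℝ) ^ (-(a * p))) := by
          push_cast
          gcongr

end Moments

/-! ### From moments to almost sure rates. -/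

section AlmostSure

variable {d : ℕ} {Ω : Type*} [mΩ : MeasurableSpace Ω]

/-- Cauchy condensation turns the series into a multiple of `∑ k^m`. -/
lemma summable_powLog {m : ℝ} (hm : m < -1) : Summable (powLog (-1) m) := by
  rw [← summable_condensed_iff_of_eventually_nonneg
    (Eventually.of_forall fun t => powLog_nonneg _ _ t)]
  · have h1 : ∀ᶠ k : ℕ in cofinite, (2 : ℝ) ^ k * powLog (-1) m (2 ^ k)
        = Real.log 2 ^ m * (k : ℝ) ^ m := by
      refine Eventually.of_forall fun k => ?_
      unfold powLog
      push_cast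
      rw [Real.rpow_neg_one, Real.log_pow, mul_inv_cancel_left₀ (by positivity),
        Real.mul_rpow (by positivity) (Real.log_nonneg one_le_two), mul_comm]
    rw [summable_congr_cofinite h1]
    exact (Real.summable_nat_rpow.2 hm).mul_left _
  · filter_upwards [eventually_one_le_log, eventually_ge_atTop 1] with t ht ht1
    unfold powLog
    have h0 : (0 : ℝ) < t := by positivity
    have h1 : ((t + 1 : ℕ) : ℝ) ^ (-1 : ℝ) ≤ (t : ℝ) ^ (-1 : ℝ) :=
      Real.rpow_le_rpow_of_nonpos h0 (by push_cast; linarith) (by norm_num)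
    have h2 : Real.log (t + 1 : ℕ) ^ m ≤ Real.log t ^ m :=
      Real.rpow_le_rpow_of_nonpos (by linarith) (log_natCast_mono (Nat.le_succ t)) (by linarith)
    have h3 := Real.rpow_nonneg (Real.log_natCast_nonneg (t + 1)) m
    exact mul_le_mul h1 h2 h3 (by positivity)

lemma powLog_rpow (β m q : ℝ) (t : ℕ) : powLog β m t ^ q = powLog (β * q) (m * q) t := by
  have h := Real.log_natCast_nonneg t
  unfold powLog
  rw [Real.mul_rpow (by positivity) (Real.rpow_nonneg h m), ← Real.rpow_mul (by positivity),
    ← Real.rpow_mul h]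

lemma powLog_mul {β m β' m' : ℝ} {t : ℕ} (ht : 2 ≤ t) :
    powLog β m t * powLog β' m' t = powLog (β + β') (m + m') t := by
  have h0 : (0 : ℝ) < t := by positivity
  have h1 : 0 < Real.log t := Real.log_pos (by exact_mod_cast ht)
  unfold powLog
  rw [Real.rpow_add h0, Real.rpow_add h1]
  ring

lemma powLog_pos {β m : ℝ} {t : ℕ} (ht : 2 ≤ t) : 0 < powLog β m t := by
  have h0 : (0 : ℝ) < t := by positivity
  have h1 : 0 < Real.log t := Real.log_pos (by exact_mod_cast ht)
  unfold powLog
  positivity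

lemma isLittleO_of_forall_coord {v : ℕ → Vec d} {r : ℕ → ℝ}
    (h : ∀ i, (fun t => v t i) =o[atTop] r) : v =o[atTop] r := by
  have h1 : (fun t => (v t).ofLp) =o[atTop] r := isLittleO_pi.2 h
  have h2 := ((PiLp.continuousLinearEquiv 2 ℝ (fun _ : Fin d => ℝ)).symm :
    (Fin d → ℝ) →L[ℝ] Vec d).isBigO_comp (fun t => (v t).ofLp) atTop
  exact IsBigO.trans_isLittleO h2 h1

/-- The Borel–Cantelli step: the sum of the tail has finite expectation, hence converges almost
surely, and its terms vanish. -/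
lemma ae_tendsto_zero_of_lintegral_le {P : Measure Ω} {u : ℕ → Ω → ℝ≥0∞}
    (hu : ∀ t, Measurable (u t)) {s : ℕ → ℝ} (hs : Summable s)
    (hle : ∀ᶠ t in atTop, ∫⁻ ω, u t ω ∂P ≤ ENNReal.ofReal (s t)) :
    ∀ᵐ ω ∂P, Tendsto (fun t => u t ω) atTop (𝓝 0) := by
  obtain ⟨T, hT⟩ := eventually_atTop.1 hle
  have hfin : ∫⁻ ω, ∑' t, u (t + T) ω ∂P ≠ ∞ := by
    rw [lintegral_tsum fun t => (hu (t + T)).aemeasurable]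
    refine ne_top_of_le_ne_top ?_ (ENNReal.tsum_le_tsum fun t => hT (t + T) (Nat.le_add_left T t))
    exact ((summable_nat_add_iff T).2 hs).tsum_ofReal_ne_top
  filter_upwards [ae_lt_top (Measurable.tsum fun t => hu (t + T)) hfin] with ω hω
  have := ENNReal.tendsto_cofinite_zero_of_tsum_ne_top hω.ne
  rw [Nat.cofinite_eq_atTop] at this
  exact (tendsto_add_atTop_iff_nat (f := fun t => u t ω) T).1 this

lemma ae_isLittleO_of_integral_rpow_le {P : Measure Ω} {f : ℕ → Ω → ℝ} {q : ℝ} (hq : 0 < q)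
    (hf : ∀ t, Measurable (f t)) (hint : ∀ t, Integrable (fun ω => |f t ω| ^ q) P)
    {r s : ℕ → ℝ} (hr : ∀ᶠ t in atTop, 0 < r t) (hs : Summable s)
    (hle : ∀ᶠ t in atTop, ∫ ω, |f t ω| ^ q ∂P ≤ s t * r t ^ q) :
    ∀ᵐ ω ∂P, (fun t => f t ω) =o[atTop] r := by
  have h1 := ae_tendsto_zero_of_lintegral_le (P := P)
    (u := fun t ω => ENNReal.ofReal (|f t ω| ^ q * (r t ^ q)⁻¹))
    (fun t => (((hf t).abs.pow_const q).mul_const _).ennreal_ofReal) hs (by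
      filter_upwards [hr, hle] with t ht1 ht2
      have hrq : 0 < r t ^ q := by positivity
      rw [← ofReal_integral_eq_lintegral_ofReal ((hint t).mul_const _)
        (Eventually.of_forall fun ω => by positivity), integral_mul_const]
      refine ENNReal.ofReal_le_ofReal ?_
      rwa [← div_eq_mul_inv, div_le_iff₀ hrq])
  filter_upwards [h1] with ω hω
  have h2 : Tendsto (fun t => |f t ω| ^ q * (r t ^ q)⁻¹) atTop (𝓝 0) := by
    have h3 := (ENNReal.tendsto_toReal ENNReal.zero_ne_top).comp hω
    rw [ENNReal.toReal_zero] at h3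
    refine h3.congr' ?_
    filter_upwards [hr] with t ht
    exact ENNReal.toReal_ofReal (by positivity)
  have h4 : Tendsto (fun t => |f t ω| / r t) atTop (𝓝 0) := by
    have h5 := h2.rpow_const (p := q⁻¹) (Or.inr (by positivity))
    rw [Real.zero_rpow (by positivity)] at h5
    refine h5.congr' ?_
    filter_upwards [hr] with t ht
    rw [← div_eq_mul_inv, ← Real.div_rpow (abs_nonneg _) ht.le,
      ← Real.rpow_mul (by positivity), mul_inv_cancel₀ hq.ne', Real.rpow_one]
  have h6 : (fun t => |f t ω|) =o[atTop] r := by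
    refine (isLittleO_iff_tendsto' ?_).2 h4
    filter_upwards [hr] with t ht h0
    exact absurd h0 ht.ne'
  exact isLittleO_abs_left.1 h6

/-- A strong law of large numbers for square integrable martingale differences. -/
lemma ae_isLittleO_sum_of_orthogonal {P : Measure Ω} [IsProbabilityMeasure P]
    {ℱ : Filtration ℕ mΩ} {y : ℕ → Ω → ℝ} (hy : ∀ t, Measurable[ℱ (t + 1)] (y t))
    (hy2 : ∀ t, MemLp (y t) 2 P)
    (horth : ∀ t, ∀ φ : Ω → ℝ, Measurable[ℱ t] φ → Integrable (fun ω => φ ω * y t ω) P →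
      ∫ ω, φ ω * y t ω ∂P = 0)
    {w : ℕ → ℝ} (hw0 : ∀ t, 0 < w t) (hw : Monotone w) (hwtop : Tendsto w atTop atTop)
    (hsum : Summable fun t => (∫ ω, y t ω ^ 2 ∂P) / w t ^ 2) :
    ∀ᵐ ω ∂P, (fun n => ∑ j ∈ Finset.range n, y j ω) =o[atTop] w := by
  set z : ℕ → Ω → ℝ := fun t ω => y t ω / w t
  set M : ℕ → Ω → ℝ := fun n ω => ∑ j ∈ Finset.range n, z j ω
  have hz : ∀ t, Measurable[ℱ (t + 1)] (z t) := fun t => (hy t).div_const _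
  have hz2 : ∀ t, MemLp (z t) 2 P := fun t => by
    have := (hy2 t).const_mul (w t)⁻¹
    refine this.ae_eq (Eventually.of_forall fun ω => ?_)
    simp only [z]
    rw [div_eq_inv_mul]
  have hM : ∀ n, Measurable[ℱ n] (M n) := fun n =>
    Finset.measurable_fun_sum _ fun j hj =>
      (hz j).mono (ℱ.mono (Nat.succ_le_of_lt (Finset.mem_range.1 hj))) le_rfl
  have hM2 : ∀ n, MemLp (M n) 2 P := fun n => memLp_finsetSum _ fun j _ => hz2 j
  have hzorth : ∀ t, ∀ φ : Ω → ℝ, Measurable[ℱ t] φ → Integrable (fun ω => φ ω * z t ω) P →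
      ∫ ω, φ ω * z t ω ∂P = 0 := by
    intro t φ hφ hint
    have h1 : ∀ ω, φ ω * y t ω = w t * (φ ω * z t ω) := fun ω => by
      simp only [z]
      field_simp [(hw0 t).ne']
    have h2 := horth t φ hφ ((hint.const_mul (w t)).congr
      (Eventually.of_forall fun ω => (h1 ω).symm))
    simp_rw [h1, integral_const_mul] at h2
    exact (mul_eq_zero.1 h2).resolve_left (hw0 t).ne'
  -- Orthogonality to past variables, tested on indicators of `ℱ i` events, is the martingale
  -- property.
  have hcond : ∀ i, P[M (i + 1) - M i | ℱ i] =ᵐ[P] 0 := by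
    intro i
    have hdiff : M (i + 1) - M i = z i := by
      ext ω
      simp [M, Finset.sum_range_succ]
    rw [hdiff]
    refine (ae_eq_condExp_of_forall_setIntegral_eq (ℱ.le i)
      ((hz2 i).integrable one_le_two) (fun s _ _ => integrableOn_zero) (fun s hs _ => ?_)
      aestronglyMeasurable_zero).symm
    have hsm : MeasurableSet s := ℱ.le i s hs
    have h1 : ∀ ω, s.indicator (fun _ => (1 : ℝ)) ω * z i ω = s.indicator (z i) ω := fun ω => by
      by_cases hω : ω ∈ s <;> simp [hω]
    have h2 := hzorth i (s.indicator fun _ => (1 : ℝ)) (measurable_const.indicator hs) (by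
      simp_rw [h1]
      exact ((hz2 i).integrable one_le_two).indicator hsm)
    simp_rw [h1] at h2
    rw [integral_indicator hsm] at h2
    simp [h2]
  have hmart : Martingale M ℱ P := martingale_of_condExp_sub_eq_zero_nat
    (fun n => (hM n).stronglyMeasurable) (fun n => (hM2 n).integrable one_le_two) hcond
  have hvar : ∀ n, ∫ ω, M n ω ^ 2 ∂P
      = ∑ t ∈ Finset.range n, (∫ ω, y t ω ^ 2 ∂P) / w t ^ 2 := by
    intro n
    induction n with
    | zero => simp [M]
    | succ n ih =>
      have hcross : Integrable (fun ω => M n ω * z n ω) P := (hM2 n).integrable_mul (hz2 n)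
      have hadd : Integrable (fun ω => M n ω ^ 2 + 2 * (M n ω * z n ω)) P :=
        (hM2 n).integrable_sq.add (hcross.const_mul 2)
      have h1 : ∀ ω, M (n + 1) ω ^ 2 = M n ω ^ 2 + 2 * (M n ω * z n ω) + z n ω ^ 2 := fun ω => by
        simp only [M, Finset.sum_range_succ]
        ring
      have h2 : ∫ ω, z n ω ^ 2 ∂P = (∫ ω, y n ω ^ 2 ∂P) / w n ^ 2 := by
        simp only [z, div_pow]
        rw [integral_div]
      simp_rw [h1]
      rw [integral_add hadd (hz2 n).integrable_sq,
        integral_add (hM2 n).integrable_sq (hcross.const_mul 2), integral_const_mul,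
        hzorth n (M n) (hM n) hcross, ih, Finset.sum_range_succ, h2]
      ring
  set S := ∑' t, (∫ ω, y t ω ^ 2 ∂P) / w t ^ 2
  -- `|M| ≤ 1 + M²` and orthogonal increments bound the first moments, so the normalised martingale
  -- converges almost surely; Kronecker's lemma then restores the weights.
  have hbdd : ∀ n, eLpNorm (M n) 1 P ≤ (1 + S).toNNReal := by
    intro n
    have hint := (hM2 n).integrable one_le_two
    rw [eLpNorm_one_eq_lintegral_enorm, ← ofReal_integral_norm_eq_lintegral_enorm hint]
    refine ENNReal.ofReal_le_ofReal ?_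
    calc ∫ ω, ‖M n ω‖ ∂P ≤ ∫ ω, (1 + M n ω ^ 2) ∂P := by
          refine integral_mono hint.norm ((integrable_const 1).add (hM2 n).integrable_sq)
            fun ω => ?_
          simp only [Real.norm_eq_abs]
          nlinarith [sq_abs (M n ω), sq_nonneg (|M n ω| - 1)]
      _ = 1 + ∑ t ∈ Finset.range n, (∫ ω, y t ω ^ 2 ∂P) / w t ^ 2 := by
          rw [integral_add (integrable_const 1) (hM2 n).integrable_sq, hvar]
          simp
      _ ≤ 1 + S := by
          gcongr
          exact hsum.sum_le_tsum _ fun t _ =>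
            div_nonneg (integral_nonneg fun ω => sq_nonneg _) (sq_nonneg _)
  filter_upwards [hmart.submartingale.exists_ae_tendsto_of_bdd hbdd] with ω ⟨s, hs⟩
  refine (isLittleO_sum_mul_of_tendsto hw hwtop hs).congr_left fun n => ?_
  refine Finset.sum_congr rfl fun j _ => ?_
  simp only [z]
  field_simp [(hw0 j).ne']

end AlmostSure

/-! ### Exponential moments under truncated noise. -/

section ExponentialMoments

lemma IsLinearRecursion.exists_norm_le {d : ℕ} {Ω : Type*} {H : Matrix (Fin d) (Fin d) ℝ} {η : ℕ → ℝ}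
    {Z e : ℕ → Ω → Vec d} (h : IsLinearRecursion H η Z e) (h0 : ∀ ω, Z 0 ω = 0)
    {b : ℕ → ℝ} (he : ∀ t ω, ‖e t ω‖ ≤ b t) (t : ℕ) : ∃ R : ℝ, 0 ≤ R ∧ ∀ ω, ‖Z t ω‖ ≤ R := by
  induction t with
  | zero => exact ⟨0, le_rfl, fun ω => by simp [h0]⟩
  | succ t ih =>
    obtain ⟨R, hR, hle⟩ := ih
    refine ⟨R + |η t| * (‖toCLM H‖ * R) + |η t| * |b t|, by positivity, fun ω => ?_⟩
    rw [h t ω]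
    refine (norm_add_le _ _).trans (add_le_add ((norm_sub_le _ _).trans ?_) ?_)
    · rw [norm_smul, Real.norm_eq_abs]
      gcongr
      · exact hle ω
      · exact ((toCLM H).le_opNorm _).trans (by gcongr; exact hle ω)
    · rw [norm_smul, Real.norm_eq_abs]
      gcongr
      exact (he t ω).trans (le_abs_self _)

variable {d : ℕ} {Ω : Type*} [mΩ : MeasurableSpace Ω]

set_option maxHeartbeats 800000 in
/-- Exponential moments of linear functionals of a stable linear recursion whose noise is bounded
by `t^{a/4}`, has bounded conditional variance and conditional mean at most `1/t`. -/
lemma exists_integral_exp_le {P : Measure Ω} [IsProbabilityMeasure P] {ℱ : Filtration ℕ mΩ}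
    {H : Matrix (Fin d) (Fin d) ℝ} {N : Seminorm ℝ (Vec d)} {CN c η₁ : ℝ} (hCN : 0 < CN)
    (hc : 0 < c) (hη₁ : 0 < η₁) (hNle : ∀ z, N z ≤ CN * ‖z‖)
    (hcontr : ∀ η, 0 ≤ η → η ≤ η₁ → ∀ z, N (z - η • toCLM H z) ≤ (1 - c * η) * N z)
    {η₀ a : ℝ} (hη₀ : 0 < η₀) (ha : 0 < a) (ha1 : a < 1)
    {Z e : ℕ → Ω → Vec d} (hrec : IsLinearRecursion H (stepSize η₀ a) Z e)
    (hZ0 : ∀ ω, Z 0 ω = 0) (hZ : ∀ t, Measurable[ℱ t] (Z t)) (he : ∀ t, Measurable (e t))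
    (hebd : ∀ (t : ℕ) ω, ‖e t ω‖ ≤ (t : ℝ) ^ (a / 4)) {K : ℝ} (hK : 0 ≤ K)
    (hbias : ∀ᶠ t : ℕ in atTop, ∀ φ : Ω → ℝ, Measurable[ℱ t] φ → (∀ ω, 0 ≤ φ ω) →
      (∃ R, ∀ ω, φ ω ≤ R) → ∀ (ℓ : Vec d →L[ℝ] ℝ) (Λ : ℝ), 0 ≤ Λ → (∀ z, |ℓ z| ≤ Λ * ‖z‖) →
        ∫ ω, φ ω * ℓ (e t ω) ∂P ≤ Λ * (t : ℝ)⁻¹ * ∫ ω, φ ω ∂P)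
    (hvar : ∀ᶠ t : ℕ in atTop, ∀ φ : Ω → ℝ, Measurable[ℱ t] φ → (∀ ω, 0 ≤ φ ω) →
      (∃ R, ∀ ω, φ ω ≤ R) → ∀ (ℓ : Vec d →L[ℝ] ℝ) (Λ : ℝ), 0 ≤ Λ → (∀ z, |ℓ z| ≤ Λ * ‖z‖) →
        ∫ ω, φ ω * ℓ (e t ω) ^ 2 ∂P ≤ Λ ^ 2 * K * ∫ ω, φ ω ∂P) :
    ∃ κ B : ℝ, 0 < κ ∧ ∀ᶠ t : ℕ in atTop, ∀ ℓ : Vec d →L[ℝ] ℝ, (∀ z, |ℓ z| ≤ N z) →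
      ∫ ω, Real.exp (κ * (t : ℝ) ^ (a / 2) * ℓ (Z t ω)) ∂P ≤ B := by
  have hZbd := hrec.exists_norm_le hZ0 hebd
  have hZm : ∀ t, Measurable (Z t) := fun t => (hZ t).mono (ℱ.le t) le_rfl
  have hexpbd : ∀ t (ℓ : Vec d →L[ℝ] ℝ), ∃ R, ∀ ω, Real.exp (ℓ (Z t ω)) ≤ R := by
    intro t ℓ
    obtain ⟨R, -, hR⟩ := hZbd t
    refine ⟨Real.exp (‖ℓ‖ * R), fun ω => Real.exp_le_exp.2 ?_⟩
    exact (le_abs_self _).trans ((ℓ.le_opNorm _).trans (by gcongr; exact hR ω))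
  have hexpm : ∀ t (ℓ : Vec d →L[ℝ] ℝ), Measurable fun ω => Real.exp (ℓ (Z t ω)) := fun t ℓ =>
    Real.measurable_exp.comp (ℓ.continuous.measurable.comp (hZm t))
  have hexpint : ∀ t (ℓ : Vec d →L[ℝ] ℝ), Integrable (fun ω => Real.exp (ℓ (Z t ω))) P := by
    intro t ℓ
    obtain ⟨R, hR⟩ := hexpbd t ℓ
    refine Integrable.of_bound (hexpm t ℓ).aestronglyMeasurable R (Eventually.of_forall fun ω => ?_)
    rw [Real.norm_of_nonneg (Real.exp_pos _).le]
    exact hR ω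
  -- Chosen so that `η_t L CN ≤ t^{-a/2}` whenever `L ≤ κ (t+1)^{a/2}`; the 2 covers `(t+1)^{a/2} ≤
  -- 2 t^{a/2}`.
  set κ : ℝ := (2 * η₀ * CN)⁻¹
  have hκ : 0 < κ := by positivity
  set C : ℝ := η₀ ^ 2 * CN ^ 2 * (K + 1)
  have hC : 0 ≤ C := by positivity
  set B : ℝ := 2 * C / (c * η₀)
  have hB : 0 ≤ B := by positivity
  have hCB : C ≤ c * η₀ / 2 * B := le_of_eq (by simp only [B]; field_simp)
  have hcη₀ : 0 < c * η₀ := by positivity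
  obtain ⟨T, hT⟩ := eventually_atTop.1 ((((eventually_recursion_le (a := a) ha1 hcη₀ a).and
    (eventually_stepSize_le (η₀ := η₀) ha hη₁)).and
    (eventually_one_sub_mul_rpow_neg_le (a := a) ha1 hcη₀ (a / 2))).and
    ((eventually_stepSize_le (η₀ := η₀) ha (inv_pos.2 hc)).and
    ((eventually_ge_atTop 1).and (hbias.and hvar))))
  obtain ⟨R, hR0, hR⟩ := hZbd T
  set K₀ : ℝ := κ * (T : ℝ) ^ (a / 2) * (CN * R)
  -- A sub-Gaussian bound with variance proxy `B t^{-a}`, on the range of `L` where the exponential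
  -- may be expanded. `K₀` bounds the exponent at the starting time, and the summable `s⁻²` collect
  -- the bias.
  have key : ∀ t, T ≤ t → ∀ (ℓ : Vec d →L[ℝ] ℝ) (L : ℝ), 0 ≤ L → L ≤ κ * (t : ℝ) ^ (a / 2) →
      (∀ z, |ℓ z| ≤ L * N z) → ∫ ω, Real.exp (ℓ (Z t ω)) ∂P
        ≤ Real.exp (K₀ + ∑ s ∈ Finset.range t, ((s : ℝ) ^ 2)⁻¹ + L ^ 2 * (B * (t : ℝ) ^ (-a))) := by
    intro t ht
    induction t, ht using Nat.le_induction with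
    | base =>
      intro ℓ L hL hLκ hℓ
      calc ∫ ω, Real.exp (ℓ (Z T ω)) ∂P ≤ ∫ _, Real.exp K₀ ∂P := by
            refine integral_mono (hexpint T ℓ) (integrable_const _) fun ω => ?_
            refine Real.exp_le_exp.2 ((le_abs_self _).trans ((hℓ _).trans ?_))
            have h1 : N (Z T ω) ≤ CN * R := (hNle _).trans (by gcongr; exact hR ω)
            exact mul_le_mul hLκ h1 (apply_nonneg N _) (by positivity)
        _ = Real.exp K₀ := by simp
        _ ≤ _ := by
            refine Real.exp_le_exp.2 ?_
            have h1 : 0 ≤ ∑ s ∈ Finset.range T, ((s : ℝ) ^ 2)⁻¹ :=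
              Finset.sum_nonneg fun s _ => by positivity
            have h2 : 0 ≤ L ^ 2 * (B * (T : ℝ) ^ (-a)) := by positivity
            linarith
    | succ t ht ih =>
      intro ℓ L hL hLκ hℓ
      obtain ⟨⟨⟨hrecu, hηη₁⟩, hratio⟩, hηc, ht1, hbt, hvt⟩ := hT t ht
      have htpos : (0 : ℝ) < t := by positivity
      have ht1' : (1 : ℝ) ≤ t := by exact_mod_cast ht1
      set η := stepSize η₀ a t
      have hηpos : 0 < η := stepSize_pos hη₀ t
      have hηeq : η = η₀ * (t : ℝ) ^ (-a) := stepSize_of_ne_zero (by omega)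
      have hcη : 0 ≤ 1 - c * η := by
        have := mul_le_mul_of_nonneg_left hηc hc.le
        rw [mul_inv_cancel₀ hc.ne'] at this
        linarith
      rw [mul_assoc c, ← hηeq] at hratio
      set ℓ' : Vec d →L[ℝ] ℝ := ℓ.comp (1 - η • toCLM H)
      have hℓ'eq : ∀ z, ℓ' z = ℓ (z - η • toCLM H z) := fun z => by
        simp [ℓ']
      have hℓ' : ∀ z, |ℓ' z| ≤ (L * (1 - c * η)) * N z := fun z => by
        rw [hℓ'eq, mul_assoc]
        exact (hℓ _).trans (mul_le_mul_of_nonneg_left (hcontr η hηpos.le hηη₁ z) hL)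
      -- The admissible range is stable under pullback: the contraction outweighs the growth of
      -- `t^{a/2}` in one step.
      have hL' : L * (1 - c * η) ≤ κ * (t : ℝ) ^ (a / 2) := by
        have h1 : (1 - c * η) * ((t : ℝ) + 1) ^ (a / 2) ≤ (t : ℝ) ^ (a / 2) := by
          rw [Real.rpow_neg htpos.le, Real.rpow_neg (by positivity), ← div_eq_mul_inv,
            div_le_iff₀ (by positivity), inv_mul_eq_div, le_div_iff₀ (by positivity)] at hratio
          exact hratio
        push_cast at hLκ
        calc L * (1 - c * η) ≤ (κ * ((t : ℝ) + 1) ^ (a / 2)) * (1 - c * η) := by gcongr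
          _ = κ * ((1 - c * η) * ((t : ℝ) + 1) ^ (a / 2)) := by ring
          _ ≤ κ * (t : ℝ) ^ (a / 2) := by gcongr
      have hIH := ih ℓ' (L * (1 - c * η)) (by positivity) hL' hℓ'
      set Λ := L * CN
      have hΛ0 : 0 ≤ Λ := by positivity
      have hΛ : ∀ z, |ℓ z| ≤ Λ * ‖z‖ := fun z => by
        refine (hℓ z).trans ?_
        rw [mul_assoc]
        exact mul_le_mul_of_nonneg_left (hNle z) hL
      have hηΛ : η * Λ ≤ (t : ℝ) ^ (-(a / 2)) := by
        have h1 : ((t + 1 : ℕ) : ℝ) ^ (a / 2) ≤ 2 * (t : ℝ) ^ (a / 2) := by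
          calc ((t + 1 : ℕ) : ℝ) ^ (a / 2) ≤ (2 * (t : ℝ)) ^ (a / 2) := by
                refine Real.rpow_le_rpow (by positivity) ?_ (by positivity)
                push_cast
                linarith
            _ = 2 ^ (a / 2) * (t : ℝ) ^ (a / 2) := Real.mul_rpow (by norm_num) htpos.le
            _ ≤ 2 * (t : ℝ) ^ (a / 2) := by
                gcongr
                calc (2 : ℝ) ^ (a / 2) ≤ 2 ^ (1 : ℝ) :=
                      Real.rpow_le_rpow_of_exponent_le (by norm_num) (by linarith)
                  _ = 2 := Real.rpow_one 2
        have h2 : (t : ℝ) ^ (-(a / 2)) = (t : ℝ) ^ (-a) * (t : ℝ) ^ (a / 2) := by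
          rw [← Real.rpow_add htpos]
          congr 1
          ring
        rw [h2, hηeq]
        calc η₀ * (t : ℝ) ^ (-a) * Λ
            ≤ η₀ * (t : ℝ) ^ (-a) * (κ * (2 * (t : ℝ) ^ (a / 2)) * CN) := by
              simp only [Λ]
              gcongr
              exact hLκ.trans (by gcongr)
          _ = (2 * η₀ * CN * κ) * ((t : ℝ) ^ (-a) * (t : ℝ) ^ (a / 2)) := by ring
          _ = (t : ℝ) ^ (-a) * (t : ℝ) ^ (a / 2) := by
              simp only [κ]
              rw [mul_inv_cancel₀ (by positivity), one_mul]
      -- The truncation level `t^{a/4}` is below `t^{a/2}`, so the quadratic bound for the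
      -- exponential applies.
      have hsmall : ∀ ω, |η * ℓ (e t ω)| ≤ 1 := by
        intro ω
        rw [abs_mul, abs_of_pos hηpos]
        calc η * |ℓ (e t ω)| ≤ η * (Λ * (t : ℝ) ^ (a / 4)) := by
              gcongr
              exact (hΛ _).trans (by gcongr; exact hebd t ω)
          _ = (η * Λ) * (t : ℝ) ^ (a / 4) := by ring
          _ ≤ (t : ℝ) ^ (-(a / 2)) * (t : ℝ) ^ (a / 4) := by gcongr
          _ = (t : ℝ) ^ (-(a / 4)) := by
              rw [← Real.rpow_add htpos]
              congr 1
              ring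
          _ ≤ 1 := Real.rpow_le_one_of_one_le_of_nonpos ht1' (by linarith)
      set φ : Ω → ℝ := fun ω => Real.exp (ℓ' (Z t ω))
      have hφm : Measurable[ℱ t] φ :=
        Real.measurable_exp.comp (ℓ'.continuous.measurable.comp (hZ t))
      have hφ0 : ∀ ω, 0 ≤ φ ω := fun ω => (Real.exp_pos _).le
      have hφint : Integrable φ P := hexpint t ℓ'
      have hℓem : Measurable fun ω => ℓ (e t ω) := ℓ.continuous.measurable.comp (he t)
      have hℓebd : ∀ ω, |ℓ (e t ω)| ≤ Λ * (t : ℝ) ^ (a / 4) := fun ω =>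
        (hΛ _).trans (by gcongr; exact hebd t ω)
      have hI1 : Integrable (fun ω => φ ω * ℓ (e t ω)) P :=
        hφint.mul_bdd hℓem.aestronglyMeasurable (Eventually.of_forall hℓebd)
      have hI2 : Integrable (fun ω => φ ω * ℓ (e t ω) ^ 2) P :=
        hφint.mul_bdd (c := (Λ * (t : ℝ) ^ (a / 4)) ^ 2) (hℓem.pow_const 2).aestronglyMeasurable
          (Eventually.of_forall fun ω => by
            rw [norm_pow]
            exact pow_le_pow_left₀ (norm_nonneg _) (hℓebd ω) 2)
      have hb := hbt φ hφm hφ0 (hexpbd t ℓ') ℓ Λ hΛ0 hΛ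
      have hv := hvt φ hφm hφ0 (hexpbd t ℓ') ℓ Λ hΛ0 hΛ
      set m := ∫ ω, φ ω ∂P
      have hm0 : 0 ≤ m := integral_nonneg hφ0
      have hadd : Integrable (fun ω => φ ω + η * (φ ω * ℓ (e t ω))) P :=
        hφint.add (hI1.const_mul η)
      have hstep : ∫ ω, Real.exp (ℓ (Z (t + 1) ω)) ∂P
          ≤ m + η * ∫ ω, φ ω * ℓ (e t ω) ∂P + η ^ 2 * ∫ ω, φ ω * ℓ (e t ω) ^ 2 ∂P := by
        calc ∫ ω, Real.exp (ℓ (Z (t + 1) ω)) ∂P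
            ≤ ∫ ω, (φ ω + η * (φ ω * ℓ (e t ω)) + η ^ 2 * (φ ω * ℓ (e t ω) ^ 2)) ∂P := by
              refine integral_mono (hexpint (t + 1) ℓ) (hadd.add (hI2.const_mul _)) fun ω => ?_
              simp only
              rw [hrec t ω, map_add, map_smul, smul_eq_mul, ← hℓ'eq, Real.exp_add]
              have h1 := (abs_le.1 (Real.abs_exp_sub_one_sub_id_le (hsmall ω))).2
              have h2 : Real.exp (η * ℓ (e t ω))
                  ≤ 1 + η * ℓ (e t ω) + (η * ℓ (e t ω)) ^ 2 := by linarith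
              calc Real.exp (ℓ' (Z t ω)) * Real.exp (η * ℓ (e t ω))
                  ≤ φ ω * (1 + η * ℓ (e t ω) + (η * ℓ (e t ω)) ^ 2) :=
                    mul_le_mul_of_nonneg_left h2 (hφ0 ω)
                _ = _ := by ring
          _ = _ := by
              rw [integral_add hadd (hI2.const_mul _), integral_add hφint (hI1.const_mul η),
                integral_const_mul, integral_const_mul]
      -- The bias `ηΛ/t` is split by the arithmetic–geometric mean inequality into `t⁻²` and
      -- `(ηΛ)²`; the latter is the `+1` in `C`.
      have hcoef : 1 + η * (Λ * (t : ℝ)⁻¹) + η ^ 2 * (Λ ^ 2 * K)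
          ≤ Real.exp (((t : ℝ) ^ 2)⁻¹ + L ^ 2 * (C * ((t : ℝ) ^ (-a) * (t : ℝ) ^ (-a)))) := by
        have h1 : L ^ 2 * (C * ((t : ℝ) ^ (-a) * (t : ℝ) ^ (-a))) = (η * Λ) ^ 2 * (K + 1) := by
          rw [hηeq]
          simp only [C, Λ]
          ring
        rw [h1, ← inv_pow]
        refine le_trans ?_ (Real.add_one_le_exp _)
        nlinarith [sq_nonneg (η * Λ - (t : ℝ)⁻¹), sq_nonneg (η * Λ), sq_nonneg ((t : ℝ)⁻¹)]
      have hle : ∫ ω, Real.exp (ℓ (Z (t + 1) ω)) ∂P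
          ≤ Real.exp (((t : ℝ) ^ 2)⁻¹ + L ^ 2 * (C * ((t : ℝ) ^ (-a) * (t : ℝ) ^ (-a)))) * m := by
        refine hstep.trans (le_trans ?_ (mul_le_mul_of_nonneg_right hcoef hm0))
        have h1 := mul_le_mul_of_nonneg_left hb hηpos.le
        have h2 := mul_le_mul_of_nonneg_left hv (sq_nonneg η)
        have h3 : (1 + η * (Λ * (t : ℝ)⁻¹) + η ^ 2 * (Λ ^ 2 * K)) * m
            = m + η * (Λ * (t : ℝ)⁻¹ * m) + η ^ 2 * (Λ ^ 2 * K * m) := by ring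
        rw [h3]
        linarith
      refine hle.trans ((mul_le_mul_of_nonneg_left hIH (Real.exp_pos _).le).trans ?_)
      rw [← Real.exp_add]
      refine Real.exp_le_exp.2 ?_
      have hfin := hrecu B C hB hCB
      rw [mul_assoc c, ← hηeq] at hfin
      rw [Finset.sum_range_succ]
      have h3 : (L * (1 - c * η)) ^ 2 * (B * (t : ℝ) ^ (-a))
          ≤ L ^ 2 * ((1 - c * η) * (B * (t : ℝ) ^ (-a))) := by
        rw [mul_pow, mul_assoc]
        have h4 : (1 - c * η) ^ 2 ≤ 1 - c * η := by nlinarith [mul_pos hc hηpos]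
        gcongr
      have h5 := mul_le_mul_of_nonneg_left hfin (sq_nonneg L)
      rw [mul_add] at h5
      push_cast
      linarith
  set S := ∑' s : ℕ, ((s : ℝ) ^ 2)⁻¹
  refine ⟨κ, Real.exp (K₀ + S + κ ^ 2 * B), hκ, eventually_atTop.2 ⟨max T 1, fun t ht ℓ hℓ => ?_⟩⟩
  have htpos : (0 : ℝ) < t := by
    have : 1 ≤ t := (le_max_right _ _).trans ht
    positivity
  have h := key t ((le_max_left _ _).trans ht) ((κ * (t : ℝ) ^ (a / 2)) • ℓ)
    (κ * (t : ℝ) ^ (a / 2)) (by positivity) le_rfl (fun z => by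
      rw [smul_apply, smul_eq_mul, abs_mul, abs_of_nonneg (by positivity)]
      exact mul_le_mul_of_nonneg_left (hℓ z) (by positivity))
  simp only [smul_apply, smul_eq_mul] at h
  refine h.trans (Real.exp_le_exp.2 ?_)
  have h1 : ∑ s ∈ Finset.range t, ((s : ℝ) ^ 2)⁻¹ ≤ S :=
    (Real.summable_nat_pow_inv.2 one_lt_two).sum_le_tsum _ fun s _ => by positivity
  have h2 : (κ * (t : ℝ) ^ (a / 2)) ^ 2 * (B * (t : ℝ) ^ (-a)) = κ ^ 2 * B := by
    have h3 : ((t : ℝ) ^ (a / 2)) ^ 2 * (t : ℝ) ^ (-a) = 1 := by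
      rw [← Real.rpow_natCast, ← Real.rpow_mul htpos.le, ← Real.rpow_add htpos]
      simp
    linear_combination κ ^ 2 * B * h3
  linarith

end ExponentialMoments

/-! ### Independence of the next data point from the past. -/

section FreshData

variable {d : ℕ} {Ω Ξ : Type*} [mΩ : MeasurableSpace Ω] [mΞ : MeasurableSpace Ξ]
  {P : Measure Ω} [IsProbabilityMeasure P] {ℱ : Filtration ℕ mΩ} {G : Vec d → Ξ → Vec d}
  {ξ : ℕ → Ω → Ξ} {x₀ : Ω → Vec d}

lemma Sampling.measurable_succ (hs : Sampling P ℱ G ξ x₀) (t : ℕ) : Measurable (ξ (t + 1)) :=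
  (hs.measurable_data t).mono (ℱ.le _) le_rfl

lemma Sampling.measurable_iter (hs : Sampling P ℱ G ξ x₀) (η : ℕ → ℝ) (t : ℕ) :
    Measurable[ℱ t] (iter G ξ x₀ η t) := by
  induction t with
  | zero => exact hs.measurable_init
  | succ t ih =>
    have h1 : Measurable[ℱ (t + 1)] (iter G ξ x₀ η t) := ih.mono (ℱ.mono (Nat.le_succ t)) le_rfl
    have h2 : Measurable fun q : Vec d × Ξ => q.1 - η t • Function.uncurry G q :=
      measurable_fst.sub (hs.measurable_G.const_smul (η t))
    exact h2.comp (h1.prodMk (hs.measurable_data t))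

/-- Replaces conditioning on `ℱ t` by Fubini: anything known at time `t` may be frozen while the new
data point is averaged under its law. -/
lemma Sampling.map_prodMk (hs : Sampling P ℱ G ξ x₀) (t : ℕ) {𝒳 : Type*} [MeasurableSpace 𝒳]
    {X : Ω → 𝒳} (hX : Measurable[ℱ t] X) :
    P.map (fun ω => (X ω, ξ (t + 1) ω)) = (P.map X).prod (P.map (ξ 1)) := by
  have hXm : Measurable X := hX.mono (ℱ.le t) le_rfl
  have hind : IndepFun X (ξ (t + 1)) P := by
    rw [IndepFun_iff_Indep]
    exact indep_of_indep_of_le_left (hs.indep_past t).symm hX.comap_le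
  rw [(indepFun_iff_map_prod_eq_prod_map_map hXm.aemeasurable
    (hs.measurable_succ t).aemeasurable).1 hind, (hs.identDistrib t).map_eq]

lemma Sampling.lintegral_fresh (hs : Sampling P ℱ G ξ x₀) (t : ℕ) {𝒳 : Type*}
    [MeasurableSpace 𝒳] {X : Ω → 𝒳} (hX : Measurable[ℱ t] X) {f : 𝒳 × Ξ → ℝ≥0∞}
    (hf : Measurable f) :
    ∫⁻ ω, f (X ω, ξ (t + 1) ω) ∂P = ∫⁻ ω, ∫⁻ ω', f (X ω, ξ 1 ω') ∂P ∂P := by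
  have hXm : Measurable X := hX.mono (ℱ.le t) le_rfl
  have h1 : Measurable fun ω => (X ω, ξ (t + 1) ω) := hXm.prodMk (hs.measurable_succ t)
  rw [← lintegral_map hf h1, hs.map_prodMk t hX, lintegral_prod _ hf.aemeasurable,
    lintegral_map hf.lintegral_prod_right' hXm]
  refine lintegral_congr fun ω => ?_
  exact lintegral_map (hf.comp measurable_prodMk_left) (hs.measurable_succ 0)

lemma Sampling.integral_fresh (hs : Sampling P ℱ G ξ x₀) (t : ℕ) {𝒳 : Type*}
    [MeasurableSpace 𝒳] {X : Ω → 𝒳} (hX : Measurable[ℱ t] X) {f : 𝒳 × Ξ → ℝ}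
    (hf : Measurable f) (hint : Integrable (fun ω => f (X ω, ξ (t + 1) ω)) P) :
    ∫ ω, f (X ω, ξ (t + 1) ω) ∂P = ∫ ω, ∫ ω', f (X ω, ξ 1 ω') ∂P ∂P := by
  have hXm : Measurable X := hX.mono (ℱ.le t) le_rfl
  have h1 : Measurable fun ω => (X ω, ξ (t + 1) ω) := hXm.prodMk (hs.measurable_succ t)
  have hint' : Integrable f ((P.map X).prod (P.map (ξ 1))) := by
    rw [← hs.map_prodMk t hX]
    exact (integrable_map_measure hf.aestronglyMeasurable h1.aemeasurable).2 hint
  have : IsProbabilityMeasure (P.map (ξ 1)) :=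
    Measure.isProbabilityMeasure_map (hs.measurable_succ 0).aemeasurable
  rw [← integral_map h1.aemeasurable hf.aestronglyMeasurable, hs.map_prodMk t hX,
    integral_prod _ hint',
    integral_map hXm.aemeasurable hint'.integral_prod_left.aestronglyMeasurable]
  refine integral_congr_ae (Eventually.of_forall fun ω => ?_)
  exact integral_map (hs.measurable_succ 0).aemeasurable
    (hf.comp measurable_prodMk_left).aestronglyMeasurable

/-- A field with mean zero, evaluated at the current iterate and fresh data, is orthogonal to the
past. -/
lemma Sampling.orthogonalToPast (hs : Sampling P ℱ G ξ x₀) {x : ℕ → Ω → Vec d}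
    (hx : ∀ t, Measurable[ℱ t] (x t)) {k : Vec d → Ξ → Vec d}
    (hk : Measurable (Function.uncurry k))
    (hint : ∀ z, Integrable (fun ω => k z (ξ 1 ω)) P) (hmean : ∀ z, ∫ ω, k z (ξ 1 ω) ∂P = 0) :
    OrthogonalToPast P ℱ fun t ω => k (x t ω) (ξ (t + 1) ω) := by
  intro t φ hφ ℓ hI
  have hX : Measurable[ℱ t] fun ω => (φ ω, x t ω) := hφ.prodMk (hx t)
  have hf : Measurable fun q : (ℝ × Vec d) × Ξ => q.1.1 * ℓ (k q.1.2 q.2) :=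
    (measurable_fst.comp measurable_fst).mul (ℓ.continuous.measurable.comp
      (hk.comp ((measurable_snd.comp measurable_fst).prodMk measurable_snd)))
  rw [hs.integral_fresh t hX hf hI]
  refine integral_eq_zero_of_ae (Eventually.of_forall fun ω => ?_)
  simp only [Pi.zero_apply]
  rw [integral_const_mul, ℓ.integral_comp_comm (hint _), hmean, map_zero, mul_zero]

end FreshData

/-! ### The centred noise field and its Lipschitz bounds. -/

section NoiseField

variable {d : ℕ} {Ω Ξ : Type*} [mΩ : MeasurableSpace Ω] [mΞ : MeasurableSpace Ξ]
  {P : Measure Ω} [IsProbabilityMeasure P] {ℱ : Filtration ℕ mΩ} {G : Vec d → Ξ → Vec d}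
  {ξ : ℕ → Ω → Ξ} {x₀ : Ω → Vec d} {xs : Vec d} {H : Matrix (Fin d) (Fin d) ℝ}

/-- The centred field `g(x) - G(x, s)`. -/
def noiseField (P : Measure Ω) (G : Vec d → Ξ → Vec d) (ξ : ℕ → Ω → Ξ) (x : Vec d) (s : Ξ) :
    Vec d :=
  meanField P G ξ x - G x s

lemma noise_succ (x : ℕ → Ω → Vec d) (t : ℕ) (ω : Ω) :
    noise P G ξ x (t + 1) ω = noiseField P G ξ (x t ω) (ξ (t + 1) ω) := rfl

lemma IsLinearField.meanField_eq (hlin : IsLinearField (meanField P G ξ) xs H) (x : Vec d) :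
    meanField P G ξ x = toCLM H (x - xs) := hlin.linear x

lemma measurable_noiseField (hs : Sampling P ℱ G ξ x₀)
    (hlin : IsLinearField (meanField P G ξ) xs H) :
    Measurable (Function.uncurry (noiseField P G ξ)) := by
  have h1 : Measurable fun x => meanField P G ξ x := by
    simp_rw [hlin.meanField_eq]
    exact (toCLM H).continuous.measurable.comp (measurable_id.sub_const xs)
  exact (h1.comp measurable_fst).sub hs.measurable_G

lemma isLinearRecursion_iter (hlin : IsLinearField (meanField P G ξ) xs H) (η : ℕ → ℝ) :
    IsLinearRecursion H η (fun t ω => iter G ξ x₀ η t ω - xs)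
      (fun t => noise P G ξ (iter G ξ x₀ η) (t + 1)) := by
  intro t ω
  simp only [noise, Nat.add_sub_cancel, hlin.meanField_eq, smul_sub, iter]
  abel

lemma memLp_field (hs : Sampling P ℱ G ξ x₀) (hlip : IsMeanSquareLipschitz P G ξ) {p : ℝ}
    (hp : 1 < p) {C : ℝ≥0} (hmom : ∫⁻ ω, ‖G xs (ξ 1 ω)‖ₑ ^ (2 * p) ∂P ≤ C) (x : Vec d) :
    MemLp (fun ω => G x (ξ 1 ω)) 2 P := by
  obtain ⟨LG, -, hLG⟩ := hlip
  have hm : ∀ x, Measurable fun ω => G x (ξ 1 ω) := fun x =>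
    hs.measurable_G.comp (measurable_const.prodMk (hs.measurable_succ 0))
  have h1 : MemLp (fun ω => G xs (ξ 1 ω)) 2 P := by
    refine (memLp_of_lintegral_rpow_le (by linarith) (hm xs) hmom).mono_exponent ?_
    rw [← ENNReal.ofReal_ofNat]
    exact ENNReal.ofReal_le_ofReal (by linarith)
  have h2 : MemLp (fun ω => G x (ξ 1 ω) - G xs (ξ 1 ω)) 2 P :=
    ⟨((hm x).sub (hm xs)).aestronglyMeasurable, (hLG x xs).trans_lt ENNReal.ofReal_lt_top⟩
  refine (h2.add h1).ae_eq (Eventually.of_forall fun ω => ?_)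
  simp

lemma memLp_noiseField (hG : ∀ x, MemLp (fun ω => G x (ξ 1 ω)) 2 P) (x : Vec d) :
    MemLp (fun ω => noiseField P G ξ x (ξ 1 ω)) 2 P :=
  (memLp_const _).sub (hG x)

lemma integral_noiseField (hG : ∀ x, MemLp (fun ω => G x (ξ 1 ω)) 2 P) (x : Vec d) :
    ∫ ω, noiseField P G ξ x (ξ 1 ω) ∂P = 0 := by
  simp only [noiseField]
  rw [integral_sub (integrable_const _) ((hG x).integrable one_le_two)]
  simp [meanField]

/-- Centring costs a factor 2, because the norm of a mean is at most the `L²` norm. -/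
lemma eLpNorm_noiseField_sub_le (hG : ∀ x, MemLp (fun ω => G x (ξ 1 ω)) 2 P) {LG : ℝ}
    (hLG0 : 0 ≤ LG) (hLG : ∀ x y : Vec d, eLpNorm (fun ω => G x (ξ 1 ω) - G y (ξ 1 ω)) 2 P
      ≤ ENNReal.ofReal (LG * ‖x - y‖)) (x y : Vec d) :
    eLpNorm (fun ω => noiseField P G ξ x (ξ 1 ω) - noiseField P G ξ y (ξ 1 ω)) 2 P
      ≤ ENNReal.ofReal (2 * LG) * ‖x - y‖ₑ := by
  set Y : Ω → Vec d := fun ω => G x (ξ 1 ω) - G y (ξ 1 ω)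
  have hY : MemLp Y 2 P := (hG x).sub (hG y)
  have h1 : (fun ω => noiseField P G ξ x (ξ 1 ω) - noiseField P G ξ y (ξ 1 ω))
      = (fun _ => ∫ ω, Y ω ∂P) - Y := by
    ext1 ω
    simp only [Y, Pi.sub_apply, noiseField]
    rw [integral_sub ((hG x).integrable one_le_two) ((hG y).integrable one_le_two)]
    simp only [meanField]
    abel
  have h2 : eLpNorm (fun _ : Ω => ∫ ω, Y ω ∂P) 2 P ≤ eLpNorm Y 2 P := by
    rw [eLpNorm_const _ two_ne_zero (NeZero.ne P)]
    simp only [measure_univ, ENNReal.one_rpow, mul_one]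
    calc ‖∫ ω, Y ω ∂P‖ₑ ≤ ∫⁻ ω, ‖Y ω‖ₑ ∂P := enorm_integral_le_lintegral_enorm _
      _ = eLpNorm Y 1 P := eLpNorm_one_eq_lintegral_enorm.symm
      _ ≤ eLpNorm Y 2 P := eLpNorm_le_eLpNorm_of_exponent_le one_le_two hY.1
  rw [h1]
  calc eLpNorm ((fun _ => ∫ ω, Y ω ∂P) - Y) 2 P
      ≤ eLpNorm (fun _ : Ω => ∫ ω, Y ω ∂P) 2 P + eLpNorm Y 2 P :=
        eLpNorm_sub_le aestronglyMeasurable_const hY.1 one_le_two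
    _ ≤ ENNReal.ofReal (LG * ‖x - y‖) + ENNReal.ofReal (LG * ‖x - y‖) :=
        add_le_add (h2.trans (hLG x y)) (hLG x y)
    _ = ENNReal.ofReal (2 * LG) * ‖x - y‖ₑ := by
        rw [← ENNReal.ofReal_add (by positivity) (by positivity), ← ofReal_norm,
          ← ENNReal.ofReal_mul (by positivity)]
        congr 1
        ring

lemma lintegral_enorm_rpow_two_eq {f : Ω → Vec d} :
    ∫⁻ ω, ‖f ω‖ₑ ^ (2 : ℝ) ∂P = eLpNorm f 2 P ^ (2 : ℝ) := by
  have := eLpNorm_nnreal_pow_eq_lintegral (f := f) (μ := P) (p := 2) two_ne_zero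
  simpa using this.symm

/-- The second moment of the centred field is bounded near the root. -/
lemma exists_lintegral_noiseField_le (hG : ∀ x, MemLp (fun ω => G x (ξ 1 ω)) 2 P) {LG : ℝ}
    (hLG0 : 0 ≤ LG) (hLG : ∀ x y : Vec d, eLpNorm (fun ω => G x (ξ 1 ω) - G y (ξ 1 ω)) 2 P
      ≤ ENNReal.ofReal (LG * ‖x - y‖)) (xs : Vec d) :
    ∃ K : ℝ≥0, ∀ x : Vec d, ‖x - xs‖ ≤ 1 →
      ∫⁻ ω, ‖noiseField P G ξ x (ξ 1 ω)‖ₑ ^ (2 : ℝ) ∂P ≤ K := by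
  set A := ENNReal.ofReal (2 * LG) + eLpNorm (fun ω => noiseField P G ξ xs (ξ 1 ω)) 2 P
  have hA : A ^ (2 : ℝ) ≠ ∞ := by
    refine ENNReal.rpow_ne_top_of_nonneg (by norm_num) ?_
    exact ENNReal.add_ne_top.2 ⟨ENNReal.ofReal_ne_top, (memLp_noiseField hG xs).2.ne⟩
  refine ⟨(A ^ (2 : ℝ)).toNNReal, fun x hx => ?_⟩
  rw [ENNReal.coe_toNNReal hA, lintegral_enorm_rpow_two_eq]
  refine ENNReal.rpow_le_rpow ?_ (by norm_num)
  have h1 : (fun ω => noiseField P G ξ x (ξ 1 ω))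
      = (fun ω => noiseField P G ξ x (ξ 1 ω) - noiseField P G ξ xs (ξ 1 ω))
        + fun ω => noiseField P G ξ xs (ξ 1 ω) := by
    ext1 ω
    simp
  rw [h1]
  refine (eLpNorm_add_le ((memLp_noiseField hG x).sub (memLp_noiseField hG xs)).1
    (memLp_noiseField hG xs).1 one_le_two).trans ?_
  refine add_le_add_left ((eLpNorm_noiseField_sub_le hG hLG0 hLG x xs).trans ?_) _
  calc ENNReal.ofReal (2 * LG) * ‖x - xs‖ₑ ≤ ENNReal.ofReal (2 * LG) * 1 := by
        gcongr
        rw [← ofReal_norm, ← ENNReal.ofReal_one]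
        exact ENNReal.ofReal_le_ofReal hx
    _ = _ := mul_one _

end NoiseField

/-! ### Rates of the iterates and of the noise-difference martingale under finite moments. -/

section AlmostSureRates

variable {d : ℕ} {Ω Ξ : Type*} [mΩ : MeasurableSpace Ω] [mΞ : MeasurableSpace Ξ]
  {P : Measure Ω} [IsProbabilityMeasure P] {ℱ : Filtration ℕ mΩ} {G : Vec d → Ξ → Vec d}
  {ξ : ℕ → Ω → Ξ} {x₀ : Ω → Vec d} {xs : Vec d} {H : Matrix (Fin d) (Fin d) ℝ} {η₀ a : ℝ}

/-- The indicator of the event that the initial point is within `K` of the root. -/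
def cutoff (x₀ : Ω → Vec d) (xs : Vec d) (K : ℕ) : Ω → ℝ :=
  Set.indicator {ω | ‖x₀ ω - xs‖ ≤ K} fun _ => 1

lemma measurable_cutoff (hs : Sampling P ℱ G ξ x₀) (K : ℕ) (t : ℕ) :
    Measurable[ℱ t] (cutoff x₀ xs K) := by
  have h1 : Measurable[ℱ t] x₀ := hs.measurable_init.mono (ℱ.mono (Nat.zero_le t)) le_rfl
  have h2 : MeasurableSet {z : Vec d | ‖z - xs‖ ≤ K} :=
    measurableSet_le (measurable_id.sub_const xs).norm measurable_const
  have h3 : MeasurableSet[ℱ t] {ω | ‖x₀ ω - xs‖ ≤ K} := h1 h2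
  exact measurable_const.indicator h3

lemma abs_cutoff_le (K : ℕ) (ω : Ω) : |cutoff x₀ xs K ω| ≤ 1 := by
  unfold cutoff
  by_cases h : ω ∈ {ω | ‖x₀ ω - xs‖ ≤ K} <;> simp [h]

lemma cutoff_eq_one {K : ℕ} {ω : Ω} (h : ‖x₀ ω - xs‖ ≤ K) : cutoff x₀ xs K ω = 1 :=
  Set.indicator_of_mem (s := {ω | ‖x₀ ω - xs‖ ≤ K}) h _

lemma norm_cutoff_smul_le (K : ℕ) (ω : Ω) (z : Vec d) : ‖cutoff x₀ xs K ω • z‖ ≤ ‖z‖ := by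
  rw [norm_smul, Real.norm_eq_abs]
  exact mul_le_of_le_one_left (norm_nonneg _) (abs_cutoff_le K ω)

/-- Every outcome lies in the cutoff event for some `K`, and there the cutoff equals 1; countably
many null sets are discarded. -/
lemma ae_of_forall_cutoff {q : (ℕ → ℝ) → Ω → Prop}
    (h : ∀ K : ℕ, ∀ᵐ ω ∂P, q (fun _ => cutoff x₀ xs K ω) ω) : ∀ᵐ ω ∂P, q (fun _ => 1) ω := by
  filter_upwards [ae_all_iff.2 h] with ω hω
  obtain ⟨K, hK⟩ := exists_nat_ge ‖x₀ ω - xs‖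
  have := hω K
  rwa [cutoff_eq_one hK] at this

/-- The moment condition on the noise. -/
def HasNoiseMoments (P : Measure Ω) (G : Vec d → Ξ → Vec d) (ξ : ℕ → Ω → Ξ) (x : ℕ → Ω → Vec d)
    (xs : Vec d) (p : ℝ) : Prop :=
  ∃ Cε : ℝ≥0, (∀ t : ℕ, ∫⁻ ω, ‖noise P G ξ x (t + 1) ω‖ₑ ^ (2 * p) ∂P ≤ Cε) ∧
    ∫⁻ ω, ‖G xs (ξ 1 ω)‖ₑ ^ (2 * p) ∂P ≤ Cε

lemma measurable_noise (hs : Sampling P ℱ G ξ x₀) (hlin : IsLinearField (meanField P G ξ) xs H)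
    (η : ℕ → ℝ) (t : ℕ) : Measurable[ℱ (t + 1)] (noise P G ξ (iter G ξ x₀ η) (t + 1)) :=
  (measurable_noiseField hs hlin).comp
    (((hs.measurable_iter η t).mono (ℱ.mono (Nat.le_succ t)) le_rfl).prodMk (hs.measurable_data t))

lemma orthogonalToPast_noise (hs : Sampling P ℱ G ξ x₀)
    (hlin : IsLinearField (meanField P G ξ) xs H) (hlip : IsMeanSquareLipschitz P G ξ)
    (η : ℕ → ℝ) {p : ℝ} (hp : 1 < p) (hmom : HasNoiseMoments P G ξ (iter G ξ x₀ η) xs p) :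
    OrthogonalToPast P ℱ fun t => noise P G ξ (iter G ξ x₀ η) (t + 1) := by
  obtain ⟨C, -, hC⟩ := hmom
  have hG := memLp_field hs hlip hp hC
  exact hs.orthogonalToPast (hs.measurable_iter η) (measurable_noiseField hs hlin)
    (fun z => (memLp_noiseField hG z).integrable one_le_two) (integral_noiseField hG)

/-- Moments of the iterates on the event that the initial point is bounded. -/
lemma exists_cutoff_moment_le (hs : Sampling P ℱ G ξ x₀)
    (hlin : IsLinearField (meanField P G ξ) xs H) (hlip : IsMeanSquareLipschitz P G ξ)
    (hη₀ : 0 < η₀) (ha : 0 < a) (ha1 : a < 1) {p : ℝ} (hp : 1 < p)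
    (hmom : HasNoiseMoments P G ξ (iter G ξ x₀ (stepSize η₀ a)) xs p) (K : ℕ) :
    (∀ t, MemLp (fun ω => cutoff x₀ xs K ω • (iter G ξ x₀ (stepSize η₀ a) t ω - xs))
      (ENNReal.ofReal (2 * p)) P) ∧
    ∃ B : ℝ, 0 ≤ B ∧ ∀ᶠ t : ℕ in atTop, ∀ i : Fin d,
      ∫ ω, |cutoff x₀ xs K ω * (iter G ξ x₀ (stepSize η₀ a) t ω - xs) i| ^ (2 * p) ∂P
        ≤ B * (t : ℝ) ^ (-(a * p)) := by
  have horth := orthogonalToPast_noise hs hlin hlip (stepSize η₀ a) hp hmom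
  obtain ⟨C, hC, -⟩ := hmom
  obtain ⟨N, CN, c, η₁, hCN, hc, hη₁, hleN, hNle, hcontr⟩ :=
    exists_contracting_seminorm H hlin.eigenvalues
  set x := iter G ξ x₀ (stepSize η₀ a)
  set χ := cutoff x₀ xs K
  set Z : ℕ → Ω → Vec d := fun t ω => χ ω • (x t ω - xs)
  set e : ℕ → Ω → Vec d := fun t ω => χ ω • noise P G ξ x (t + 1) ω
  have hχ : ∀ t, Measurable[ℱ t] χ := measurable_cutoff hs K
  -- The cutoff is a scalar constant in time, so it passes through the linear recursion, and being
  -- known at time 0 it preserves orthogonality.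
  have hrec : IsLinearRecursion H (stepSize η₀ a) Z e := by
    intro t ω
    have h := isLinearRecursion_iter (x₀ := x₀) hlin (stepSize η₀ a) t ω
    simp only [Z, e]
    simp only [x] at h ⊢
    rw [h, smul_add, smul_sub, map_smul, smul_comm (χ ω), smul_comm (χ ω)]
  have hZ : ∀ t, Measurable[ℱ t] (Z t) := fun t =>
    (hχ t).smul ((hs.measurable_iter (stepSize η₀ a) t).sub_const xs)
  have he : ∀ t, Measurable (e t) := fun t =>
    ((hχ t).mono (ℱ.le t) le_rfl).smul
      ((measurable_noise hs hlin (stepSize η₀ a) t).mono (ℱ.le _) le_rfl)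
  have hZ0 : MemLp (Z 0) (ENNReal.ofReal (2 * p)) P := by
    refine MemLp.of_bound ((hZ 0).mono (ℱ.le 0) le_rfl).aestronglyMeasurable K
      (Eventually.of_forall fun ω => ?_)
    simp only [Z, χ, cutoff]
    by_cases h : ‖x₀ ω - xs‖ ≤ K
    · rw [Set.indicator_of_mem (by exact h), one_smul]
      exact h
    · rw [Set.indicator_of_notMem (by exact h), zero_smul, norm_zero]
      positivity
  have hmome : ∀ t, ∫⁻ ω, ‖e t ω‖ₑ ^ (2 * p) ∂P ≤ C := fun t => by
    refine (lintegral_mono fun ω => ?_).trans (hC t)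
    refine ENNReal.rpow_le_rpow ?_ (by linarith)
    exact enorm_le_iff_norm_le.2 (norm_cutoff_smul_le K ω _)
  have hortho : OrthogonalToPast P ℱ e := by
    intro t φ hφ ℓ hI
    have h1 : ∀ ω, φ ω * ℓ (e t ω) = (φ ω * χ ω) * ℓ (noise P G ξ x (t + 1) ω) := fun ω => by
      simp only [e, map_smul, smul_eq_mul]
      ring
    simp_rw [h1] at hI ⊢
    exact horth t _ (hφ.mul (hχ t)) ℓ hI
  refine ⟨hrec.memLp hZ0 fun t => memLp_of_lintegral_rpow_le (by linarith) (he t) (hmome t), ?_⟩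
  obtain ⟨B, hB, hev⟩ := exists_integral_abs_rpow_le hCN hc hη₁ hNle hcontr hη₀ ha ha1 hp.le hrec hZ
    he hZ0 hmome hortho
  refine ⟨B, hB, ?_⟩
  filter_upwards [hev] with t ht i
  have h := ht (EuclideanSpace.proj i) 1 zero_le_one (fun z => by
    rw [one_mul]
    exact (PiLp.norm_apply_le z i).trans (hleN z))
  rw [Real.one_rpow, one_mul] at h
  exact h

/-- The almost sure rate of the iterates under finite moments. -/
lemma ae_isLittleO_iter (hs : Sampling P ℱ G ξ x₀)
    (hlin : IsLinearField (meanField P G ξ) xs H) (hlip : IsMeanSquareLipschitz P G ξ)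
    (hη₀ : 0 < η₀) (ha : 0 < a) (ha1 : a < 1) {p : ℝ} (hp : 1 < p)
    (hmom : HasNoiseMoments P G ξ (iter G ξ x₀ (stepSize η₀ a)) xs p) {ε : ℝ} (hε : 0 < ε) :
    ∀ᵐ ω ∂P, (fun t => iter G ξ x₀ (stepSize η₀ a) t ω - xs)
      =o[atTop] powLog (1 / p / 2 - a / 2) (1 / p / 2 + ε) := by
  set x := iter G ξ x₀ (stepSize η₀ a)
  have key : ∀ K : ℕ, ∀ᵐ ω ∂P, (fun t => cutoff x₀ xs K ω • (x t ω - xs))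
      =o[atTop] powLog (1 / p / 2 - a / 2) (1 / p / 2 + ε) := by
    intro K
    obtain ⟨hLp, B, hB, hev⟩ := exists_cutoff_moment_le hs hlin hlip hη₀ ha ha1 hp hmom K
    have hcoord : ∀ i : Fin d, ∀ᵐ ω ∂P, (fun t => cutoff x₀ xs K ω * (x t ω - xs) i)
        =o[atTop] powLog (1 / p / 2 - a / 2) (1 / p / 2 + ε) := by
      intro i
      -- The normalised moment is a multiple of `t⁻¹ (log t)^{-(1 + 2pε)}`; summability of this
      -- sequence costs the factor `t^{1/(2p)} (log t)^{1/(2p)+ε}`.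
      refine ae_isLittleO_of_integral_rpow_le (q := 2 * p) (by linarith) (fun t => ?_)
        (fun t => ?_) ?_
        ((summable_powLog (m := -(1 + 2 * p * ε)) (by nlinarith)).mul_left B) ?_
      · have h1 : Measurable (cutoff x₀ xs K) :=
          (measurable_cutoff hs K 0).mono (ℱ.le 0) le_rfl
        have h2 : Measurable (x t) := (hs.measurable_iter _ t).mono (ℱ.le t) le_rfl
        exact h1.mul ((EuclideanSpace.proj i : Vec d →L[ℝ] ℝ).continuous.measurable.comp
          (h2.sub_const xs))
      · exact integrable_norm_rpow_of_memLp (by linarith)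
          ((EuclideanSpace.proj i : Vec d →L[ℝ] ℝ).comp_memLp' (hLp t))
      · filter_upwards [eventually_ge_atTop 2] with t ht
        exact powLog_pos ht
      · filter_upwards [hev, eventually_ge_atTop 2] with t ht ht2
        refine (ht i).trans (le_of_eq ?_)
        rw [powLog_rpow, mul_assoc, powLog_mul ht2]
        have h1 : -1 + (1 / p / 2 - a / 2) * (2 * p) = -(a * p) := by
          field_simp
          ring
        have h2 : -(1 + 2 * p * ε) + (1 / p / 2 + ε) * (2 * p) = 0 := by
          field_simp
          ring
        rw [h1, h2, powLog, Real.rpow_zero, mul_one]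
    filter_upwards [ae_all_iff.2 hcoord] with ω hω
    exact isLittleO_of_forall_coord hω
  have := ae_of_forall_cutoff (P := P) (x₀ := x₀) (xs := xs)
    (q := fun χ ω => (fun t => χ t • (x t ω - xs))
      =o[atTop] powLog (1 / p / 2 - a / 2) (1 / p / 2 + ε)) key
  simpa using this

/-- With the cutoff and the iterate frozen, the fresh data point sees two deterministic arguments,
to which the mean-square Lipschitz bound applies. -/
lemma eLpNorm_cutoff_noise_sub_le (hs : Sampling P ℱ G ξ x₀)
    (hlin : IsLinearField (meanField P G ξ) xs H)
    (hG : ∀ x, MemLp (fun ω => G x (ξ 1 ω)) 2 P) {LG : ℝ}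
    (hLG0 : 0 ≤ LG) (hLG : ∀ x y : Vec d, eLpNorm (fun ω => G x (ξ 1 ω) - G y (ξ 1 ω)) 2 P
      ≤ ENNReal.ofReal (LG * ‖x - y‖)) (η : ℕ → ℝ) (K t : ℕ) :
    eLpNorm (fun ω => cutoff x₀ xs K ω •
        (noise P G ξ (iter G ξ x₀ η) (t + 1) ω - rootNoise P G ξ xs (t + 1) ω)) 2 P
      ≤ ENNReal.ofReal (2 * LG) *
        eLpNorm (fun ω => cutoff x₀ xs K ω • (iter G ξ x₀ η t ω - xs)) 2 P := by
  set x := iter G ξ x₀ η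
  set χ := cutoff x₀ xs K
  have hX : Measurable[ℱ t] fun ω => (χ ω, x t ω) :=
    (measurable_cutoff hs K t).prodMk (hs.measurable_iter η t)
  have hnf := measurable_noiseField hs hlin
  have hf : Measurable fun q : (ℝ × Vec d) × Ξ => ‖q.1.1 •
      (noiseField P G ξ q.1.2 q.2 - noiseField P G ξ xs q.2)‖ₑ ^ (2 : ℝ) :=
    (((measurable_fst.comp measurable_fst).smul
      ((hnf.comp ((measurable_snd.comp measurable_fst).prodMk measurable_snd)).sub
        (hnf.comp (measurable_const.prodMk measurable_snd)))).enorm.pow_const _)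
  rw [← ENNReal.rpow_le_rpow_iff (z := 2) (by norm_num),
    ENNReal.mul_rpow_of_nonneg _ _ (by norm_num), ← lintegral_enorm_rpow_two_eq,
    ← lintegral_enorm_rpow_two_eq, ← lintegral_const_mul']
  · rw [show ∫⁻ ω, ‖χ ω • (noise P G ξ x (t + 1) ω - rootNoise P G ξ xs (t + 1) ω)‖ₑ ^ (2 : ℝ) ∂P
      = ∫⁻ ω, ∫⁻ ω', ‖χ ω • (noiseField P G ξ (x t ω) (ξ 1 ω')
        - noiseField P G ξ xs (ξ 1 ω'))‖ₑ ^ (2 : ℝ) ∂P ∂P from hs.lintegral_fresh t hX hf]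
    refine lintegral_mono fun ω => ?_
    rw [lintegral_enorm_rpow_two_eq, ← ENNReal.mul_rpow_of_nonneg _ _ (by norm_num)]
    refine ENNReal.rpow_le_rpow ?_ (by norm_num)
    have h1 := eLpNorm_noiseField_sub_le hG hLG0 hLG (x t ω) xs
    have h2 := eLpNorm_const_smul (χ ω) (fun ω' => noiseField P G ξ (x t ω) (ξ 1 ω')
        - noiseField P G ξ xs (ξ 1 ω')) 2 P
    refine (le_of_eq h2).trans ?_
    rw [enorm_smul, mul_left_comm]
    gcongr
  · exact ENNReal.rpow_ne_top_of_nonneg (by norm_num) ENNReal.ofReal_ne_top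

/-- The almost sure rate of the martingale of noise differences. -/
lemma ae_isLittleO_sum_noise_sub (hs : Sampling P ℱ G ξ x₀)
    (hlin : IsLinearField (meanField P G ξ) xs H) (hlip : IsMeanSquareLipschitz P G ξ)
    (hη₀ : 0 < η₀) (ha : 0 < a) (ha1 : a < 1) {p : ℝ} (hp : 1 < p)
    (hmom : HasNoiseMoments P G ξ (iter G ξ x₀ (stepSize η₀ a)) xs p) {ε : ℝ} (hε : 0 < ε) :
    ∀ᵐ ω ∂P, (fun T => ∑ t ∈ Finset.range T,
        (noise P G ξ (iter G ξ x₀ (stepSize η₀ a)) (t + 1) ω - rootNoise P G ξ xs (t + 1) ω))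
      =o[atTop] powLog ((1 - a) / 2) (1 / 2 + ε) := by
  set x := iter G ξ x₀ (stepSize η₀ a)
  have hG := memLp_field hs hlip hp hmom.choose_spec.2
  obtain ⟨LG, hLG0, hLG⟩ := hlip
  have hnf := measurable_noiseField hs hlin
  set D : ℕ → Ω → Vec d := fun t ω =>
    noise P G ξ x (t + 1) ω - rootNoise P G ξ xs (t + 1) ω
  have horth : OrthogonalToPast P ℱ D := by
    refine hs.orthogonalToPast (hs.measurable_iter (stepSize η₀ a))
      (k := fun z s => noiseField P G ξ z s - noiseField P G ξ xs s) ?_ ?_ ?_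
    · exact hnf.sub (hnf.comp (measurable_const.prodMk measurable_snd))
    · exact fun z => ((memLp_noiseField hG z).sub (memLp_noiseField hG xs)).integrable one_le_two
    · intro z
      rw [integral_sub ((memLp_noiseField hG z).integrable one_le_two)
        ((memLp_noiseField hG xs).integrable one_le_two), integral_noiseField hG,
        integral_noiseField hG, sub_zero]
  have hDm : ∀ t, Measurable[ℱ (t + 1)] (D t) := fun t =>
    (measurable_noise hs hlin (stepSize η₀ a) t).sub
      (hnf.comp (measurable_const.prodMk (hs.measurable_data t)))
  -- The added 1 keeps the weights positive at small `t`, where the logarithm vanishes.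
  set w : ℕ → ℝ := fun t => 1 + powLog ((1 - a) / 2) (1 / 2 + ε) t
  have hwpos : ∀ t, 0 < w t := fun t => by
    have := powLog_nonneg ((1 - a) / 2) (1 / 2 + ε) t
    simp only [w]
    linarith
  have hβ : 0 < (1 - a) / 2 := by linarith
  have hmε : 0 ≤ 1 / 2 + ε := by linarith
  have hwmono : Monotone w := fun s t hst => by
    have := powLog_mono hβ.le hmε hst
    simp only [w]
    linarith
  have htop := tendsto_powLog_atTop hβ hmε
  have hwtop : Tendsto w atTop atTop := tendsto_atTop_add_const_left _ _ htop
  have hwO : w =O[atTop] powLog ((1 - a) / 2) (1 / 2 + ε) :=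
    (isLittleO_const_left.2 (Or.inr (tendsto_norm_atTop_atTop.comp htop))).isBigO.add
      (isBigO_refl _ _)
  have key : ∀ K : ℕ, ∀ᵐ ω ∂P, (fun T => ∑ t ∈ Finset.range T, cutoff x₀ xs K ω • D t ω)
      =o[atTop] powLog ((1 - a) / 2) (1 / 2 + ε) := by
    intro K
    obtain ⟨hLp, B, hB, hev⟩ := exists_cutoff_moment_le hs hlin ⟨LG, hLG0, hLG⟩ hη₀ ha ha1 hp hmom K
    set χ := cutoff x₀ xs K
    have hχ : ∀ t, Measurable[ℱ t] χ := measurable_cutoff hs K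
    have hZ2 : ∀ t, MemLp (fun ω => χ ω • (x t ω - xs)) 2 P := fun t =>
      (hLp t).mono_exponent (by
        rw [← ENNReal.ofReal_ofNat]
        exact ENNReal.ofReal_le_ofReal (by linarith))
    have hDle := eLpNorm_cutoff_noise_sub_le (x₀ := x₀) hs hlin hG hLG0.le hLG (stepSize η₀ a) K
    have hD2 : ∀ t, MemLp (fun ω => χ ω • D t ω) 2 P := fun t =>
      ⟨(((hχ t).mono (ℱ.le t) le_rfl).smul
        ((hDm t).mono (ℱ.le _) le_rfl)).aestronglyMeasurable,
        (hDle t).trans_lt (ENNReal.mul_lt_top ENNReal.ofReal_lt_top (hZ2 t).2)⟩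
    have hsqZ : ∀ᶠ t : ℕ in atTop, ∫ ω, ‖χ ω • (x t ω - xs)‖ ^ 2 ∂P
        ≤ (d * (1 + B)) * (t : ℝ) ^ (-a) := by
      filter_upwards [hev, eventually_ge_atTop 1] with t ht ht1
      have htpos : (0 : ℝ) < t := by positivity
      have hci : ∀ i : Fin d, Integrable (fun ω => |χ ω * (x t ω - xs) i| ^ (2 * p)) P := fun i =>
        integrable_norm_rpow_of_memLp (by linarith)
          ((EuclideanSpace.proj i : Vec d →L[ℝ] ℝ).comp_memLp' (hLp t))
      have hci2 : ∀ i : Fin d, Integrable (fun ω => (χ ω * (x t ω - xs) i) ^ 2) P := fun i =>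
        ((EuclideanSpace.proj i : Vec d →L[ℝ] ℝ).comp_memLp' (hZ2 t)).integrable_sq
      have h1 : ∀ ω, ‖χ ω • (x t ω - xs)‖ ^ 2 = ∑ i, (χ ω * (x t ω - xs) i) ^ 2 := fun ω => by
        rw [EuclideanSpace.norm_sq_eq]
        exact Finset.sum_congr rfl fun i _ => sq_abs _
      simp_rw [h1]
      rw [integral_finsetSum _ fun i _ => hci2 i]
      have h2 : ∀ i : Fin d, ∫ ω, (χ ω * (x t ω - xs) i) ^ 2 ∂P ≤ (1 + B) * (t : ℝ) ^ (-a) := by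
        intro i
        calc ∫ ω, (χ ω * (x t ω - xs) i) ^ 2 ∂P
            ≤ ∫ ω, (t : ℝ) ^ (-a) * (1 + (t : ℝ) ^ (a * p)
              * |χ ω * (x t ω - xs) i| ^ (2 * p)) ∂P := by
              refine integral_mono (hci2 i)
                (((integrable_const 1).add ((hci i).const_mul _)).const_mul _) fun ω => ?_
              simp only
              set u := χ ω * (x t ω - xs) i
              set v := (t : ℝ) ^ a * u ^ 2
              have hv0 : 0 ≤ v := by positivity
              -- Second moments from the moment of order `2p`, after scaling the square by `t^a`.
              have hv : v ≤ 1 + v ^ p := by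
                rcases le_total v 1 with h | h
                · have : 0 ≤ v ^ p := by positivity
                  linarith
                · have : v ^ (1 : ℝ) ≤ v ^ p := Real.rpow_le_rpow_of_exponent_le h hp.le
                  rw [Real.rpow_one] at this
                  linarith
              have e1 : v ^ p = (t : ℝ) ^ (a * p) * |u| ^ (2 * p) := by
                simp only [v]
                rw [Real.mul_rpow (by positivity) (sq_nonneg u), ← Real.rpow_mul htpos.le,
                  ← sq_abs, ← Real.rpow_two, ← Real.rpow_mul (abs_nonneg u)]
              have e2 : (t : ℝ) ^ (-a) * v = u ^ 2 := by
                simp only [v]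
                rw [← mul_assoc, ← Real.rpow_add htpos, neg_add_cancel, Real.rpow_zero, one_mul]
              rw [← e1, ← e2]
              gcongr
          _ = (t : ℝ) ^ (-a) * (1 + (t : ℝ) ^ (a * p)
              * ∫ ω, |χ ω * (x t ω - xs) i| ^ (2 * p) ∂P) := by
              rw [integral_const_mul, integral_add (integrable_const 1) ((hci i).const_mul _),
                integral_const_mul]
              simp
          _ ≤ (t : ℝ) ^ (-a) * (1 + (t : ℝ) ^ (a * p) * (B * (t : ℝ) ^ (-(a * p)))) := by
              gcongr
              exact ht i
          _ = (1 + B) * (t : ℝ) ^ (-a) := by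
              have : (t : ℝ) ^ (a * p) * (t : ℝ) ^ (-(a * p)) = 1 := by
                rw [← Real.rpow_add htpos, add_neg_cancel, Real.rpow_zero]
              linear_combination (t : ℝ) ^ (-a) * B * this
      calc ∑ i, ∫ ω, (χ ω * (x t ω - xs) i) ^ 2 ∂P ≤ ∑ _i : Fin d, (1 + B) * (t : ℝ) ^ (-a) :=
            Finset.sum_le_sum fun i _ => h2 i
        _ = _ := by
            rw [Finset.sum_const, Finset.card_univ, Fintype.card_fin, nsmul_eq_mul]
            ring
    have hsqD : ∀ t, ∫ ω, ‖χ ω • D t ω‖ ^ 2 ∂P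
        ≤ (2 * LG) ^ 2 * ∫ ω, ‖χ ω • (x t ω - xs)‖ ^ 2 ∂P := by
      intro t
      have h1 : ∀ {f : Ω → Vec d}, MemLp f 2 P →
          ∫ ω, ‖f ω‖ ^ 2 ∂P = (eLpNorm f 2 P).toReal ^ 2 := by
        intro f hf
        have h2 := lintegral_enorm_rpow_two_eq (P := P) (f := f)
        rw [integral_eq_lintegral_of_nonneg_ae (f := fun ω => ‖f ω‖ ^ 2)
          (Eventually.of_forall fun ω => sq_nonneg ‖f ω‖) (hf.1.norm.pow 2),
          ← ENNReal.toReal_pow, ← ENNReal.rpow_two, ← h2]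
        congr 1
        refine lintegral_congr fun ω => ?_
        rw [ENNReal.rpow_two, ← ofReal_norm, ENNReal.ofReal_pow (norm_nonneg _)]
      rw [h1 (hD2 t), h1 (hZ2 t), ← mul_pow]
      refine pow_le_pow_left₀ ENNReal.toReal_nonneg ?_ 2
      have h3 := ENNReal.toReal_mono
        (ENNReal.mul_ne_top ENNReal.ofReal_ne_top (hZ2 t).2.ne) (hDle t)
      rwa [ENNReal.toReal_mul, ENNReal.toReal_ofReal (by positivity)] at h3
    have hcoord : ∀ i : Fin d, ∀ᵐ ω ∂P,
        (fun T => ∑ t ∈ Finset.range T, χ ω * D t ω i) =o[atTop] w := by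
      intro i
      set ℓ : Vec d →L[ℝ] ℝ := EuclideanSpace.proj i
      have hy2 : ∀ t, MemLp (fun ω => χ ω * D t ω i) 2 P := fun t => ℓ.comp_memLp' (hD2 t)
      refine ae_isLittleO_sum_of_orthogonal (ℱ := ℱ) (fun t => ?_) hy2 ?_ hwpos hwmono hwtop ?_
      · exact (hχ (t + 1)).mul (ℓ.continuous.measurable.comp (hDm t))
      · intro t φ hφ hI
        have h1 : ∀ ω, φ ω * (χ ω * D t ω i) = (φ ω * χ ω) * ℓ (D t ω) := fun ω => by
          rw [mul_assoc]
          rfl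
        simp_rw [h1] at hI ⊢
        exact horth t _ (hφ.mul (hχ t)) ℓ hI
      -- Variances of order `t^{-a}` over squared weights of order `t^{1-a} (log t)^{1+2ε}` leave
      -- `t⁻¹ (log t)^{-(1+2ε)}`.
      · have hsumm : Summable fun t => ((2 * LG) ^ 2 * (d * (1 + B)))
            * powLog (-1) (-(1 + 2 * ε)) t :=
          (summable_powLog (by linarith)).mul_left _
        refine Summable.of_norm_bounded_eventually_nat hsumm ?_
        filter_upwards [hsqZ, eventually_ge_atTop 2] with t ht ht2
        have hy : ∫ ω, (χ ω * D t ω i) ^ 2 ∂P ≤ ∫ ω, ‖χ ω • D t ω‖ ^ 2 ∂P := by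
          refine integral_mono (hy2 t).integrable_sq ((hD2 t).integrable_norm_pow (by norm_num))
            fun ω => ?_
          simp only
          rw [← sq_abs]
          exact pow_le_pow_left₀ (abs_nonneg _) (PiLp.norm_apply_le (χ ω • D t ω) i) 2
        have h0 : 0 ≤ ∫ ω, (χ ω * D t ω i) ^ 2 ∂P := integral_nonneg fun ω => sq_nonneg _
        have hpl : 0 < powLog ((1 - a) / 2) (1 / 2 + ε) t := powLog_pos ht2
        rw [Real.norm_of_nonneg (div_nonneg h0 (sq_nonneg _)), div_le_iff₀ (pow_pos (hwpos t) 2)]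
        have h1 : ∫ ω, (χ ω * D t ω i) ^ 2 ∂P
            ≤ ((2 * LG) ^ 2 * (d * (1 + B))) * (t : ℝ) ^ (-a) := by
          refine hy.trans ((hsqD t).trans ?_)
          rw [mul_assoc]
          gcongr
        have h2 : (t : ℝ) ^ (-a)
            = powLog (-1) (-(1 + 2 * ε)) t * powLog ((1 - a) / 2) (1 / 2 + ε) t ^ 2 := by
          rw [← Real.rpow_two, powLog_rpow, powLog_mul ht2]
          have h3 : -1 + (1 - a) / 2 * 2 = -a := by ring
          have h4 : -(1 + 2 * ε) + (1 / 2 + ε) * 2 = 0 := by ring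
          rw [h3, h4, powLog, Real.rpow_zero, mul_one]
        refine h1.trans ?_
        rw [h2, ← mul_assoc]
        have h5 := powLog_nonneg (-1) (-(1 + 2 * ε)) t
        have h6 : powLog ((1 - a) / 2) (1 / 2 + ε) t ≤ w t := by
          simp only [w]
          linarith
        gcongr
    filter_upwards [ae_all_iff.2 hcoord] with ω hω
    refine isLittleO_of_forall_coord fun i => ?_
    refine ((hω i).trans_isBigO hwO).congr_left fun T => ?_
    simp
  have := ae_of_forall_cutoff (P := P) (x₀ := x₀) (xs := xs)
    (q := fun χ ω => (fun T => ∑ t ∈ Finset.range T, χ t • D t ω)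
      =o[atTop] powLog ((1 - a) / 2) (1 / 2 + ε)) key
  simpa only [one_smul] using this

end AlmostSureRates

/-! ### Truncation of the noise. -/

section Truncation

variable {d : ℕ} {Ω Ξ : Type*} [mΩ : MeasurableSpace Ω] [mΞ : MeasurableSpace Ξ]
  {P : Measure Ω} [IsProbabilityMeasure P] {ℱ : Filtration ℕ mΩ} {G : Vec d → Ξ → Vec d}
  {ξ : ℕ → Ω → Ξ} {x₀ : Ω → Vec d} {xs : Vec d} {H : Matrix (Fin d) (Fin d) ℝ} {η₀ a : ℝ}

/-- The points near the root at which the moment of order `q` of the noise is at most `t²`. -/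
def goodSet (P : Measure Ω) (G : Vec d → Ξ → Vec d) (ξ : ℕ → Ω → Ξ) (xs : Vec d) (q : ℝ) (t : ℕ) :
    Set (Vec d) :=
  {z | ‖z - xs‖ ≤ 1 ∧
    ∫⁻ ω, ‖noiseField P G ξ z (ξ 1 ω)‖ₑ ^ q ∂P ≤ ENNReal.ofReal ((t : ℝ) ^ 2)}

/-- The noise field, restricted to good points and truncated at level `t^{a/4}`. -/
def truncField (P : Measure Ω) (G : Vec d → Ξ → Vec d) (ξ : ℕ → Ω → Ξ) (xs : Vec d) (a q : ℝ)
    (t : ℕ) (z : Vec d) (s : Ξ) : Vec d :=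
  Set.indicator {v : Vec d × Ξ | v.1 ∈ goodSet P G ξ xs q t ∧
    ‖noiseField P G ξ v.1 v.2‖ ≤ (t : ℝ) ^ (a / 4)} (Function.uncurry (noiseField P G ξ)) (z, s)

lemma truncField_of_mem {q : ℝ} {t : ℕ} {z : Vec d} {s : Ξ} (hz : z ∈ goodSet P G ξ xs q t)
    (hs : ‖noiseField P G ξ z s‖ ≤ (t : ℝ) ^ (a / 4)) :
    truncField P G ξ xs a q t z s = noiseField P G ξ z s := by
  unfold truncField
  exact Set.indicator_of_mem (show (z, s) ∈ {v : Vec d × Ξ | v.1 ∈ goodSet P G ξ xs q t ∧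
    ‖noiseField P G ξ v.1 v.2‖ ≤ (t : ℝ) ^ (a / 4)} from ⟨hz, hs⟩) _

lemma truncField_of_notMem {q : ℝ} {t : ℕ} {z : Vec d} {s : Ξ}
    (h : ¬ (z ∈ goodSet P G ξ xs q t ∧ ‖noiseField P G ξ z s‖ ≤ (t : ℝ) ^ (a / 4))) :
    truncField P G ξ xs a q t z s = 0 := by
  unfold truncField
  exact Set.indicator_of_notMem (fun h' => h ⟨h'.1, h'.2⟩) _

lemma norm_truncField_le (q : ℝ) (t : ℕ) (z : Vec d) (s : Ξ) :
    ‖truncField P G ξ xs a q t z s‖ ≤ (t : ℝ) ^ (a / 4) := by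
  by_cases h : z ∈ goodSet P G ξ xs q t ∧ ‖noiseField P G ξ z s‖ ≤ (t : ℝ) ^ (a / 4)
  · rw [truncField_of_mem h.1 h.2]
    exact h.2
  · rw [truncField_of_notMem h, norm_zero]
    positivity

lemma norm_truncField_le_norm (q : ℝ) (t : ℕ) (z : Vec d) (s : Ξ) :
    ‖truncField P G ξ xs a q t z s‖ ≤ ‖noiseField P G ξ z s‖ := by
  by_cases h : z ∈ goodSet P G ξ xs q t ∧ ‖noiseField P G ξ z s‖ ≤ (t : ℝ) ^ (a / 4)
  · rw [truncField_of_mem h.1 h.2]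
  · rw [truncField_of_notMem h, norm_zero]
    positivity

lemma measurable_lintegral_noiseField (hs : Sampling P ℱ G ξ x₀)
    (hlin : IsLinearField (meanField P G ξ) xs H) (q : ℝ) :
    Measurable fun z : Vec d => ∫⁻ ω, ‖noiseField P G ξ z (ξ 1 ω)‖ₑ ^ q ∂P := by
  have h1 : Measurable fun v : Vec d × Ω => ‖noiseField P G ξ v.1 (ξ 1 v.2)‖ₑ ^ q :=
    ((measurable_noiseField hs hlin).comp (measurable_fst.prodMk
      ((hs.measurable_succ 0).comp measurable_snd))).enorm.pow_const q
  exact h1.lintegral_prod_right'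

lemma measurable_truncField (hs : Sampling P ℱ G ξ x₀)
    (hlin : IsLinearField (meanField P G ξ) xs H) (q : ℝ) (t : ℕ) :
    Measurable (Function.uncurry (truncField P G ξ xs a q t)) := by
  have hnf := measurable_noiseField hs hlin
  have hgood : MeasurableSet (goodSet P G ξ xs q t) :=
    (measurableSet_le (measurable_id.sub_const xs).norm measurable_const).inter
      (measurableSet_le (measurable_lintegral_noiseField hs hlin q) measurable_const)
  exact hnf.indicator ((measurable_fst hgood).inter (measurableSet_le hnf.norm measurable_const))

attribute [irreducible] truncField

/-- The full noise has mean zero, so at a good point the truncated mean equals, up to sign, that of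
the discarded tail. The moment of order `q` bounds it by `t² · t^{(a/4)(1-q)}`, and `q = 12/a + 1`
makes the last exponent `-3`. -/
lemma norm_integral_truncField_le (hs : Sampling P ℱ G ξ x₀)
    (hlin : IsLinearField (meanField P G ξ) xs H)
    (hG : ∀ x, MemLp (fun ω => G x (ξ 1 ω)) 2 P) (ha : 0 < a) {q : ℝ} (hq : q = 12 / a + 1)
    {t : ℕ} (ht : 1 ≤ t) (z : Vec d) :
    ‖∫ ω, truncField P G ξ xs a q t z (ξ 1 ω) ∂P‖ ≤ (t : ℝ)⁻¹ := by
  have htpos : (0 : ℝ) < t := by positivity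
  have hq0 : 0 < 12 / a := by positivity
  have hξ := hs.measurable_succ 0
  set f : Ω → Vec d := fun ω => noiseField P G ξ z (ξ 1 ω)
  have hf : Measurable f :=
    (measurable_noiseField hs hlin).comp (measurable_const.prodMk hξ)
  have hfint : Integrable f P := (memLp_noiseField hG z).integrable one_le_two
  by_cases hz : z ∈ goodSet P G ξ xs q t
  swap
  · have : ∀ ω, truncField P G ξ xs a q t z (ξ 1 ω) = 0 := fun ω =>
      truncField_of_notMem fun h => hz h.1
    simp [this]
  have hmom : ∫⁻ ω, ‖f ω‖ₑ ^ q ∂P ≤ (((t : ℝ) ^ 2).toNNReal : ℝ≥0) := hz.2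
  have hTm : Measurable fun ω => truncField P G ξ xs a q t z (ξ 1 ω) :=
    (measurable_truncField (a := a) hs hlin q t).of_uncurry_left.comp hξ
  have hTint : Integrable (fun ω => truncField P G ξ xs a q t z (ξ 1 ω)) P :=
    hfint.mono hTm.aestronglyMeasurable
      (Eventually.of_forall fun ω => norm_truncField_le_norm q t z (ξ 1 ω))
  set b : ℝ := (t : ℝ) ^ (a / 4)
  have hb : 0 < b := by positivity
  have h1 : ∫ ω, truncField P G ξ xs a q t z (ξ 1 ω) ∂P
      = ∫ ω, (truncField P G ξ xs a q t z (ξ 1 ω) - f ω) ∂P := by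
    rw [integral_sub hTint hfint, integral_noiseField hG, sub_zero]
  have h2 : ∀ ω, ‖truncField P G ξ xs a q t z (ξ 1 ω) - f ω‖ ≤ ‖f ω‖ ^ q * b ^ (1 - q) := by
    intro ω
    by_cases h : ‖f ω‖ ≤ b
    · rw [truncField_of_mem hz h, sub_self, norm_zero]
      positivity
    · rw [truncField_of_notMem fun h' => h h'.2, zero_sub, norm_neg]
      push Not at h
      have hfpos : 0 < ‖f ω‖ := hb.trans h
      calc ‖f ω‖ = ‖f ω‖ ^ q * ‖f ω‖ ^ (1 - q) := by
            rw [← Real.rpow_add hfpos]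
            simp
        _ ≤ ‖f ω‖ ^ q * b ^ (1 - q) := by
            gcongr ‖f ω‖ ^ q * ?_
            exact Real.rpow_le_rpow_of_nonpos hb h.le (by rw [hq]; linarith)
  have hint : Integrable (fun ω => ‖f ω‖ ^ q) P :=
    integrable_norm_rpow_of_memLp (by rw [hq]; positivity)
      (memLp_of_lintegral_rpow_le (by rw [hq]; positivity) hf hmom)
  rw [h1]
  refine (norm_integral_le_of_norm_le (hint.mul_const _) (Eventually.of_forall h2)).trans ?_
  rw [integral_mul_const]
  have h3 : ∫ ω, ‖f ω‖ ^ q ∂P ≤ (t : ℝ) ^ 2 := by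
    have := integral_norm_rpow_le (by rw [hq]; positivity) hf hmom
    rwa [Real.coe_toNNReal _ (sq_nonneg _)] at this
  have h4 : b ^ (1 - q) = (t : ℝ) ^ (-3 : ℝ) := by
    simp only [b]
    rw [← Real.rpow_mul htpos.le, hq]
    congr 1
    field_simp
    ring
  calc (∫ ω, ‖f ω‖ ^ q ∂P) * b ^ (1 - q) ≤ (t : ℝ) ^ 2 * b ^ (1 - q) := by gcongr
    _ = (t : ℝ)⁻¹ := by
        rw [h4, ← Real.rpow_two, ← Real.rpow_add htpos, ← Real.rpow_neg_one]
        norm_num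

lemma integral_truncField_sq_le (hs : Sampling P ℱ G ξ x₀)
    (hlin : IsLinearField (meanField P G ξ) xs H)
    (hG : ∀ x, MemLp (fun ω => G x (ξ 1 ω)) 2 P) {K : ℝ≥0}
    (hK : ∀ x : Vec d, ‖x - xs‖ ≤ 1 → ∫⁻ ω, ‖noiseField P G ξ x (ξ 1 ω)‖ₑ ^ (2 : ℝ) ∂P ≤ K)
    (q : ℝ) (t : ℕ) (z : Vec d) {ℓ : Vec d →L[ℝ] ℝ} {Λ : ℝ} (hΛ : 0 ≤ Λ)
    (hℓ : ∀ z, |ℓ z| ≤ Λ * ‖z‖) :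
    ∫ ω, ℓ (truncField P G ξ xs a q t z (ξ 1 ω)) ^ 2 ∂P ≤ Λ ^ 2 * K := by
  by_cases hz : z ∈ goodSet P G ξ xs q t
  swap
  · have : ∀ ω, truncField P G ξ xs a q t z (ξ 1 ω) = 0 := fun ω =>
      truncField_of_notMem fun h => hz h.1
    simp only [this, map_zero]
    simp
    positivity
  have hf : Measurable fun ω => noiseField P G ξ z (ξ 1 ω) :=
    (measurable_noiseField hs hlin).comp (measurable_const.prodMk (hs.measurable_succ 0))
  have hint : Integrable (fun ω => ‖noiseField P G ξ z (ξ 1 ω)‖ ^ 2) P :=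
    (memLp_noiseField hG z).integrable_norm_pow (by norm_num)
  have h1 := integral_norm_rpow_le (by norm_num) hf (hK z hz.1)
  simp only [Real.rpow_two] at h1
  calc ∫ ω, ℓ (truncField P G ξ xs a q t z (ξ 1 ω)) ^ 2 ∂P
      ≤ ∫ ω, Λ ^ 2 * ‖noiseField P G ξ z (ξ 1 ω)‖ ^ 2 ∂P := by
        refine integral_mono_of_nonneg (Eventually.of_forall fun ω => sq_nonneg _)
          (hint.const_mul _) (Eventually.of_forall fun ω => ?_)
        simp only
        rw [← mul_pow, ← sq_abs]
        refine pow_le_pow_left₀ (abs_nonneg _) ((hℓ _).trans ?_) 2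
        exact mul_le_mul_of_nonneg_left (norm_truncField_le_norm q t z _) hΛ
    _ = Λ ^ 2 * ∫ ω, ‖noiseField P G ξ z (ξ 1 ω)‖ ^ 2 ∂P := integral_const_mul _ _
    _ ≤ Λ ^ 2 * K := by gcongr

/-- Integrability of `f` can be skipped: otherwise its integral is 0 by convention. -/
lemma integral_le_integral_of_nonneg_right {f g : Ω → ℝ} (hg : Integrable g P) (hg0 : ∀ ω, 0 ≤ g ω)
    (hfg : ∀ ω, f ω ≤ g ω) : ∫ ω, f ω ∂P ≤ ∫ ω, g ω ∂P := by
  by_cases hf : Integrable f P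
  · exact integral_mono hf hg hfg
  · rw [integral_undef hf]
    exact integral_nonneg hg0

/-- If a bounded field has conditional functional averages at most `m`, then so has its
weighted mean. -/
lemma Sampling.integral_mul_le (hs : Sampling P ℱ G ξ x₀) {t : ℕ} {z : Ω → Vec d}
    (hz : Measurable[ℱ t] z) {k : Vec d × Ξ → ℝ} (hk : Measurable k) {R : ℝ}
    (hkR : ∀ v, |k v| ≤ R) {m : ℝ} (hm : 0 ≤ m) (hkm : ∀ y, ∫ ω, k (y, ξ 1 ω) ∂P ≤ m) {φ : Ω → ℝ}
    (hφ : Measurable[ℱ t] φ) (hφ0 : ∀ ω, 0 ≤ φ ω) (hφR : ∃ R', ∀ ω, φ ω ≤ R') :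
    ∫ ω, φ ω * k (z ω, ξ (t + 1) ω) ∂P ≤ m * ∫ ω, φ ω ∂P := by
  obtain ⟨R', hR'⟩ := hφR
  have hφm : Measurable φ := hφ.mono (ℱ.le t) le_rfl
  have hzm : Measurable z := hz.mono (ℱ.le t) le_rfl
  have hφint : Integrable φ P := Integrable.of_bound hφm.aestronglyMeasurable R'
    (Eventually.of_forall fun ω => by rw [Real.norm_of_nonneg (hφ0 ω)]; exact hR' ω)
  have hint : Integrable (fun ω => φ ω * k (z ω, ξ (t + 1) ω)) P :=
    hφint.mul_bdd (c := R)
      (hk.comp (hzm.prodMk (hs.measurable_succ t))).aestronglyMeasurable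
      (Eventually.of_forall fun ω => hkR _)
  have hf : Measurable fun v : (ℝ × Vec d) × Ξ => v.1.1 * k (v.1.2, v.2) :=
    (measurable_fst.comp measurable_fst).mul
      (hk.comp ((measurable_snd.comp measurable_fst).prodMk measurable_snd))
  have h1 := hs.integral_fresh t (hφ.prodMk hz) hf hint
  simp only at h1
  rw [h1, ← integral_const_mul]
  refine integral_le_integral_of_nonneg_right (hφint.const_mul m)
    (fun ω => mul_nonneg hm (hφ0 ω)) fun ω => ?_
  rw [integral_const_mul, mul_comm m]
  exact mul_le_mul_of_nonneg_left (hkm _) (hφ0 ω)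

/-- The solution, started at zero, of the linear recursion driven by `e`. -/
def driven (H : Matrix (Fin d) (Fin d) ℝ) (η : ℕ → ℝ) (e : ℕ → Ω → Vec d) : ℕ → Ω → Vec d
  | 0 => fun _ => 0
  | t + 1 => fun ω => (driven H η e t ω - η t • toCLM H (driven H η e t ω)) + η t • e t ω

lemma measurable_driven (η : ℕ → ℝ) {e : ℕ → Ω → Vec d} (he : ∀ t, Measurable[ℱ (t + 1)] (e t))
    (t : ℕ) : Measurable[ℱ t] (driven H η e t) := by
  induction t with
  | zero => exact measurable_const
  | succ t ih =>
    have h1 : Measurable[ℱ (t + 1)] (driven H η e t) := ih.mono (ℱ.mono (Nat.le_succ t)) le_rfl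
    have h2 : Measurable fun z : Vec d => z - η t • toCLM H z :=
      measurable_id.sub ((toCLM H).continuous.measurable.const_smul (η t))
    exact (h2.comp h1).add ((he t).const_smul (η t))

/-- With bounded means, `∑ f_t / t²` has finite expectation. This shows both that the noise stays
below its truncation level and that the iterates eventually satisfy the moment condition of the good
sets. -/
lemma ae_eventually_le_sq {f : ℕ → Ω → ℝ≥0∞} (hf : ∀ t, Measurable (f t)) {C : ℝ≥0}
    (hC : ∀ t, ∫⁻ ω, f t ω ∂P ≤ C) :
    ∀ᵐ ω ∂P, ∀ᶠ t : ℕ in atTop, f t ω ≤ ENNReal.ofReal ((t : ℝ) ^ 2) := by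
  have hsum : Summable fun t : ℕ => ((t : ℝ) ^ 2)⁻¹ * (C : ℝ) :=
    (Real.summable_nat_pow_inv.2 one_lt_two).mul_right _
  filter_upwards [ae_tendsto_zero_of_lintegral_le (P := P)
    (u := fun t ω => ENNReal.ofReal (((t : ℝ) ^ 2)⁻¹) * f t ω)
    (fun t => (hf t).const_mul _) hsum (Eventually.of_forall fun t => by
      rw [lintegral_const_mul _ (hf t), ENNReal.ofReal_mul (by positivity),
        ENNReal.ofReal_coe_nnreal]
      exact mul_le_mul_right (hC t) _)] with ω hω
  filter_upwards [hω.eventually_le_const one_pos, eventually_ge_atTop 1] with t ht ht1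
  have htpos : (0 : ℝ) < (t : ℝ) ^ 2 := by positivity
  rw [ENNReal.ofReal_inv_of_pos htpos, ENNReal.inv_mul_le_iff (by simpa using htpos.ne')
    ENNReal.ofReal_ne_top, mul_one] at ht
  exact ht

end Truncation

/-! ### The iterates when all moments are finite. -/

section AllMoments

variable {d : ℕ} {Ω Ξ : Type*} [mΩ : MeasurableSpace Ω] [mΞ : MeasurableSpace Ξ]
  {P : Measure Ω} [IsProbabilityMeasure P] {ℱ : Filtration ℕ mΩ} {G : Vec d → Ξ → Vec d}
  {ξ : ℕ → Ω → Ξ} {x₀ : Ω → Vec d} {xs : Vec d} {H : Matrix (Fin d) (Fin d) ℝ} {η₀ a : ℝ}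

lemma isBigO_of_forall_coord {v : ℕ → Vec d} {r : ℕ → ℝ}
    (h : ∀ i, (fun t => v t i) =O[atTop] r) : v =O[atTop] r := by
  have h1 : (fun t => (v t).ofLp) =O[atTop] r := isBigO_pi.2 h
  have h2 := ((PiLp.continuousLinearEquiv 2 ℝ (fun _ : Fin d => ℝ)).symm :
    (Fin d → ℝ) →L[ℝ] Vec d).isBigO_comp (fun t => (v t).ofLp) atTop
  exact IsBigO.trans h2 h1

/-- Sequences with uniformly bounded exponential moments at scale `t^{a/2}` are almost surely of
order `t^{-a/2} log t`. -/
lemma ae_eventually_le_of_integral_exp_le {κ B : ℝ} (hκ : 0 < κ) {f : ℕ → Ω → ℝ}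
    (hf : ∀ t, Measurable (f t))
    (hint : ∀ t : ℕ, Integrable (fun ω => Real.exp (κ * (t : ℝ) ^ (a / 2) * f t ω)) P)
    (hB : ∀ᶠ t : ℕ in atTop, ∫ ω, Real.exp (κ * (t : ℝ) ^ (a / 2) * f t ω) ∂P ≤ B) :
    ∀ᵐ ω ∂P, ∀ᶠ t : ℕ in atTop, f t ω ≤ 2 / κ * powLog (-(a / 2)) 1 t := by
  have hsum : Summable fun t : ℕ => ((t : ℝ) ^ 2)⁻¹ * B :=
    (Real.summable_nat_pow_inv.2 one_lt_two).mul_right _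
  filter_upwards [ae_tendsto_zero_of_lintegral_le (P := P)
    (u := fun t ω => ENNReal.ofReal (((t : ℝ) ^ 2)⁻¹ * Real.exp (κ * (t : ℝ) ^ (a / 2) * f t ω)))
    (fun t => (((Real.measurable_exp.comp ((hf t).const_mul _))).const_mul _).ennreal_ofReal)
    hsum (by
      filter_upwards [hB] with t ht
      rw [← ofReal_integral_eq_lintegral_ofReal ((hint t).const_mul _)
        (Eventually.of_forall fun ω => by positivity), integral_const_mul]
      exact ENNReal.ofReal_le_ofReal (by gcongr))] with ω hω
  filter_upwards [hω.eventually_le_const one_pos, eventually_ge_atTop 1] with t ht ht1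
  have htpos : (0 : ℝ) < t := by positivity
  -- Eventually the exponential is at most `t²`; taking logarithms gives the constant `2/κ` and the
  -- factor `log t`.
  rw [ENNReal.ofReal_le_one, inv_mul_le_iff₀ (by positivity), mul_one] at ht
  have h1 := Real.log_le_log (Real.exp_pos _) ht
  rw [Real.log_exp, Real.log_pow] at h1
  have h2 : (t : ℝ) ^ (-(a / 2)) * (t : ℝ) ^ (a / 2) = 1 := by
    rw [← Real.rpow_add htpos, neg_add_cancel, Real.rpow_zero]
  have h3 : 0 < (t : ℝ) ^ (-(a / 2)) := by positivity
  unfold powLog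
  rw [Real.rpow_one]
  have h4 := mul_le_mul_of_nonneg_left h1 (mul_pos (inv_pos.2 hκ) h3).le
  calc f t ω = (κ⁻¹ * κ) * ((t : ℝ) ^ (-(a / 2)) * (t : ℝ) ^ (a / 2)) * f t ω := by
        rw [h2, inv_mul_cancel₀ hκ.ne', one_mul, one_mul]
    _ = κ⁻¹ * (t : ℝ) ^ (-(a / 2)) * (κ * (t : ℝ) ^ (a / 2) * f t ω) := by ring
    _ ≤ κ⁻¹ * (t : ℝ) ^ (-(a / 2)) * (((2 : ℕ) : ℝ) * Real.log t) := h4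
    _ = _ := by
        push_cast
        ring

/-- A recursion driven by a bounded field of fresh data, of order `t^{a/4}`, with small bias and
bounded variance is of order `t^{-a/2} log t`. -/
lemma ae_isBigO_driven (hs : Sampling P ℱ G ξ x₀) (hH : ∀ z ∈ spectrum ℂ (H.map (algebraMap ℝ ℂ)),
      0 < z.re)
    (hη₀ : 0 < η₀) (ha : 0 < a) (ha1 : a < 1) {k : ℕ → Vec d × Ξ → Vec d}
    (hk : ∀ t, Measurable (k t)) (hkbd : ∀ t v, ‖k t v‖ ≤ (t : ℝ) ^ (a / 4))
    (hkbias : ∀ t, 1 ≤ t → ∀ y, ‖∫ ω, k t (y, ξ 1 ω) ∂P‖ ≤ (t : ℝ)⁻¹) {K : ℝ≥0}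
    (hkvar : ∀ t y (ℓ : Vec d →L[ℝ] ℝ) (Λ : ℝ), 0 ≤ Λ → (∀ z, |ℓ z| ≤ Λ * ‖z‖) →
      ∫ ω, ℓ (k t (y, ξ 1 ω)) ^ 2 ∂P ≤ Λ ^ 2 * K)
    {x : ℕ → Ω → Vec d} (hx : ∀ t, Measurable[ℱ t] (x t)) :
    ∀ᵐ ω ∂P, (fun t => driven H (stepSize η₀ a) (fun t ω => k t (x t ω, ξ (t + 1) ω)) t ω)
      =O[atTop] powLog (-(a / 2)) 1 := by
  obtain ⟨N, CN, c, η₁, hCN, hc, hη₁, hleN, hNle, hcontr⟩ := exists_contracting_seminorm H hH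
  set e : ℕ → Ω → Vec d := fun t ω => k t (x t ω, ξ (t + 1) ω)
  have he : ∀ t, Measurable[ℱ (t + 1)] (e t) := fun t => (hk t).comp
    (((hx t).mono (ℱ.mono (Nat.le_succ t)) le_rfl).prodMk (hs.measurable_data t))
  set Z := driven H (stepSize η₀ a) e
  have hZ : ∀ t, Measurable[ℱ t] (Z t) := measurable_driven (stepSize η₀ a) he
  have hebd : ∀ (t : ℕ) ω, ‖e t ω‖ ≤ (t : ℝ) ^ (a / 4) := fun t ω => hkbd _ _
  have hrec : IsLinearRecursion H (stepSize η₀ a) Z e := fun t ω => rfl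
  have hbias : ∀ᶠ t : ℕ in atTop, ∀ φ : Ω → ℝ, Measurable[ℱ t] φ → (∀ ω, 0 ≤ φ ω) →
      (∃ R, ∀ ω, φ ω ≤ R) → ∀ (ℓ : Vec d →L[ℝ] ℝ) (Λ : ℝ), 0 ≤ Λ → (∀ z, |ℓ z| ≤ Λ * ‖z‖) →
        ∫ ω, φ ω * ℓ (e t ω) ∂P ≤ Λ * (t : ℝ)⁻¹ * ∫ ω, φ ω ∂P := by
    filter_upwards [eventually_ge_atTop 1] with t ht φ hφ hφ0 hφR ℓ Λ hΛ hℓ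
    refine hs.integral_mul_le (hx t) (k := fun v => ℓ (k t v))
      (R := Λ * (t : ℝ) ^ (a / 4)) (ℓ.continuous.measurable.comp (hk t)) (fun v => ?_)
      (by positivity) (fun y => ?_) hφ hφ0 hφR
    · exact (hℓ _).trans (mul_le_mul_of_nonneg_left (hkbd _ _) hΛ)
    · have hint : Integrable (fun ω => k t (y, ξ 1 ω)) P :=
        Integrable.of_bound ((hk t).comp
          (measurable_const.prodMk (hs.measurable_succ 0))).aestronglyMeasurable ((t : ℝ) ^ (a / 4))
          (Eventually.of_forall fun ω => hkbd _ _)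
      rw [ℓ.integral_comp_comm hint]
      exact (le_abs_self _).trans ((hℓ _).trans (mul_le_mul_of_nonneg_left (hkbias t ht y) hΛ))
  have hvar : ∀ᶠ t : ℕ in atTop, ∀ φ : Ω → ℝ, Measurable[ℱ t] φ → (∀ ω, 0 ≤ φ ω) →
      (∃ R, ∀ ω, φ ω ≤ R) → ∀ (ℓ : Vec d →L[ℝ] ℝ) (Λ : ℝ), 0 ≤ Λ → (∀ z, |ℓ z| ≤ Λ * ‖z‖) →
        ∫ ω, φ ω * ℓ (e t ω) ^ 2 ∂P ≤ Λ ^ 2 * K * ∫ ω, φ ω ∂P := by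
    refine Eventually.of_forall fun t φ hφ hφ0 hφR ℓ Λ hΛ hℓ => ?_
    refine hs.integral_mul_le (hx t) (k := fun v => ℓ (k t v) ^ 2)
      (R := (Λ * (t : ℝ) ^ (a / 4)) ^ 2) ((ℓ.continuous.measurable.comp (hk t)).pow_const 2)
      (fun v => ?_) (by positivity) (fun y => hkvar t y ℓ Λ hΛ hℓ) hφ hφ0 hφR
    rw [abs_pow]
    exact pow_le_pow_left₀ (abs_nonneg _)
      ((hℓ _).trans (mul_le_mul_of_nonneg_left (hkbd _ _) hΛ)) 2
  obtain ⟨κ, B, hκ, hev⟩ := exists_integral_exp_le hCN hc hη₁ hNle hcontr hη₀ ha ha1 hrec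
    (fun ω => rfl) hZ (fun t => (he t).mono (ℱ.le _) le_rfl) hebd K.2 hbias hvar
  have hone : ∀ ℓ : Vec d →L[ℝ] ℝ, (∀ z, |ℓ z| ≤ N z) → ∀ᵐ ω ∂P, ∀ᶠ t : ℕ in atTop,
      ℓ (Z t ω) ≤ 2 / κ * powLog (-(a / 2)) 1 t := by
    intro ℓ hℓ
    have hm : ∀ t, Measurable fun ω => ℓ (Z t ω) := fun t =>
      ℓ.continuous.measurable.comp ((hZ t).mono (ℱ.le t) le_rfl)
    refine ae_eventually_le_of_integral_exp_le hκ hm (fun t => ?_) (hev.mono fun t ht => ht ℓ hℓ)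
    obtain ⟨R, hR0, hR⟩ := hrec.exists_norm_le (fun ω => rfl) hebd t
    refine Integrable.of_bound
      (Real.measurable_exp.comp ((hm t).const_mul _)).aestronglyMeasurable
      (Real.exp (κ * (t : ℝ) ^ (a / 2) * (‖ℓ‖ * R))) (Eventually.of_forall fun ω => ?_)
    rw [Real.norm_of_nonneg (Real.exp_pos _).le]
    refine Real.exp_le_exp.2 (mul_le_mul_of_nonneg_left ?_ (by positivity))
    exact (le_abs_self _).trans ((ℓ.le_opNorm _).trans (by gcongr; exact hR ω))
  have hproj : ∀ (i : Fin d) (z : Vec d), |z i| ≤ N z := fun i z =>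
    (PiLp.norm_apply_le z i).trans (hleN z)
  have h1 : ∀ i : Fin d, ∀ᵐ ω ∂P, (fun t => Z t ω i) =O[atTop] powLog (-(a / 2)) 1 := by
    intro i
    filter_upwards [hone (EuclideanSpace.proj i) (hproj i),
      hone (-EuclideanSpace.proj i) (fun z => by
        rw [neg_apply, abs_neg]
        exact hproj i z)] with ω hω1 hω2
    refine IsBigO.of_bound (2 / κ) ?_
    filter_upwards [hω1, hω2] with t h2 h3
    rw [Real.norm_of_nonneg (powLog_nonneg _ _ _), Real.norm_eq_abs]
    rw [neg_apply] at h3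
    exact abs_le'.2 ⟨h2, h3⟩
  filter_upwards [ae_all_iff.2 h1] with ω hω
  exact isBigO_of_forall_coord hω

/-- The recursion driven by the truncated noise is of order `t^{-a/2} log t`. -/
lemma ae_isBigO_driven_trunc (hs : Sampling P ℱ G ξ x₀)
    (hlin : IsLinearField (meanField P G ξ) xs H) (hlip : IsMeanSquareLipschitz P G ξ)
    (hη₀ : 0 < η₀) (ha : 0 < a) (ha1 : a < 1) (hG : ∀ x, MemLp (fun ω => G x (ξ 1 ω)) 2 P)
    {q : ℝ} (hq : q = 12 / a + 1) {x : ℕ → Ω → Vec d} (hx : ∀ t, Measurable[ℱ t] (x t)) :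
    ∀ᵐ ω ∂P, (fun t => driven H (stepSize η₀ a)
        (fun t ω => truncField P G ξ xs a q t (x t ω) (ξ (t + 1) ω)) t ω)
      =O[atTop] powLog (-(a / 2)) 1 := by
  obtain ⟨LG, hLG0, hLG⟩ := hlip
  obtain ⟨K, hK⟩ := exists_lintegral_noiseField_le hG hLG0.le hLG xs
  exact ae_isBigO_driven hs hlin.eigenvalues hη₀ ha ha1
    (k := fun t v => truncField P G ξ xs a q t v.1 v.2) (measurable_truncField hs hlin q)
    (fun t v => norm_truncField_le q t v.1 v.2)
    (fun t ht y => norm_integral_truncField_le hs hlin hG ha hq ht y)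
    (fun t y ℓ Λ hΛ hℓ => integral_truncField_sq_le hs hlin hG hK q t y hΛ hℓ) hx

/-- The almost sure rate of the iterates when all moments are finite. -/
lemma ae_isBigO_iter (hs : Sampling P ℱ G ξ x₀)
    (hlin : IsLinearField (meanField P G ξ) xs H) (hlip : IsMeanSquareLipschitz P G ξ)
    (hη₀ : 0 < η₀) (ha : 0 < a) (ha1 : a < 1)
    (hmom : ∀ p, 1 < p → HasNoiseMoments P G ξ (iter G ξ x₀ (stepSize η₀ a)) xs p) :
    ∀ᵐ ω ∂P, (fun t => iter G ξ x₀ (stepSize η₀ a) t ω - xs) =O[atTop] powLog (-(a / 2)) 1 := by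
  set x := iter G ξ x₀ (stepSize η₀ a)
  set q : ℝ := 12 / a + 1
  have hq12 : 12 < 12 / a := by
    rw [lt_div_iff₀ ha]
    linarith
  set p : ℝ := q / 2
  have hp : 1 < p := by
    simp only [p, q]
    linarith
  have h2p : 2 * p = q := by
    simp only [p]
    ring
  have hxm : ∀ t, Measurable[ℱ t] (x t) := hs.measurable_iter _
  obtain ⟨N, CN, c, η₁, hCN, hc, hη₁, hleN, hNle, hcontr⟩ :=
    exists_contracting_seminorm H hlin.eigenvalues
  obtain ⟨C, hC, hC0⟩ := hmom p hp
  have hG := memLp_field hs hlip hp hC0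
  rw [h2p] at hC
  have hnf := measurable_noiseField hs hlin
  have hnoise : ∀ t, Measurable (noise P G ξ x (t + 1)) := fun t =>
    (measurable_noise hs hlin _ t).mono (ℱ.le _) le_rfl
  have hf1 : Measurable fun v : Vec d × Ξ => ‖noiseField P G ξ v.1 v.2‖ₑ ^ q :=
    hnf.enorm.pow_const q
  have hinner := measurable_lintegral_noiseField hs hlin q
  -- The finite-moment rate at order `q` already gives convergence, because `1/q < a/2`; so the
  -- iterates enter the unit ball of the good sets.
  have hzero : ∀ᵐ ω ∂P, Tendsto (fun t => x t ω - xs) atTop (𝓝 0) := by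
    filter_upwards [ae_isLittleO_iter hs hlin hlip hη₀ ha ha1 hp (hmom p hp) one_pos] with ω hω
    have hneg : 1 / p / 2 - a / 2 < 0 := by
      have h1 : 1 / p / 2 = 1 / q := by
        rw [← h2p]
        field_simp
      have h2 : 1 / q < a / 2 := by
        rw [div_lt_iff₀ (by positivity)]
        simp only [q]
        have : a / 2 * (12 / a + 1) = 6 + a / 2 := by
          field_simp
          ring
        rw [this]
        linarith
      rw [h1]
      linarith
    have h3 := hω.trans (powLog_isLittleO_of_lt hneg (1 / p / 2 + 1) 0)
    have h4 : powLog 0 0 = fun _ => (1 : ℝ) := by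
      ext t
      simp [powLog]
    rw [h4] at h3
    exact (isLittleO_one_iff ℝ).1 h3
  filter_upwards [ae_isBigO_driven_trunc (x := x) hs hlin hlip hη₀ ha ha1 hG (q := q) rfl hxm, hzero,
    ae_eventually_le_sq (P := P) (C := C)
      (f := fun t ω => ‖noise P G ξ x (t + 1) ω‖ₑ ^ q)
      (fun t => (hnoise t).enorm.pow_const q) hC,
    ae_eventually_le_sq (P := P) (C := C)
      (f := fun t ω => ∫⁻ ω', ‖noiseField P G ξ (x t ω) (ξ 1 ω')‖ₑ ^ q ∂P)
      (fun t => hinner.comp ((hxm t).mono (ℱ.le t) le_rfl)) (fun t => by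
        -- The moment of order `q` conditional on the past has the same expectation as the moment
        -- itself.
        rw [← hs.lintegral_fresh t (hxm t) hf1]
        exact hC t)] with ω hZ h0 hsmall hgood
  set e : ℕ → Ω → Vec d := fun t ω => truncField P G ξ xs a q t (x t ω) (ξ (t + 1) ω)
  set Z := driven H (stepSize η₀ a) e
  have heq : ∀ᶠ t : ℕ in atTop, e t ω = noise P G ξ x (t + 1) ω := by
    have hclose : ∀ᶠ t in atTop, ‖x t ω - xs‖ ≤ 1 := by
      have := h0.norm
      rw [norm_zero] at this
      exact this.eventually_le_const one_pos
    filter_upwards [hclose, hsmall, hgood, eventually_ge_atTop 1] with t h1 h2 h3 h4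
    have ht1 : (1 : ℝ) ≤ t := by exact_mod_cast h4
    refine truncField_of_mem ⟨h1, h3⟩ ?_
    rw [← noise_succ]
    rw [← ofReal_norm, ENNReal.ofReal_rpow_of_nonneg (norm_nonneg _) (by positivity),
      ENNReal.ofReal_le_ofReal_iff (by positivity)] at h2
    -- `(a/4) q = 3 + a/4` exceeds 2, so a `q`-th power of at most `t²` forces the noise below
    -- `t^{a/4}`.
    have h5 : (t : ℝ) ^ 2 ≤ ((t : ℝ) ^ (a / 4)) ^ q := by
      rw [← Real.rpow_mul (by positivity), ← Real.rpow_two]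
      refine Real.rpow_le_rpow_of_exponent_le ht1 ?_
      have : a / 4 * q = 3 + a / 4 := by
        simp only [q]
        field_simp
        ring
      rw [this]
      linarith
    exact (Real.rpow_le_rpow_iff (norm_nonneg _) (by positivity) (by positivity)).1 (h2.trans h5)
  -- Once the two noises agree, the difference obeys the noiseless recursion and decays faster than
  -- any power.
  have hdiff : (fun t => (x t ω - xs) - Z t ω) =O[atTop] powLog (-(a / 2)) 1 := by
    obtain ⟨B, hB⟩ := exists_forall_le_of_contraction ha ha1 (mul_pos hc hη₀) (a / 2)
      (v := fun t => N ((x t ω - xs) - Z t ω)) (fun t => apply_nonneg N _) (by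
        filter_upwards [heq, eventually_stepSize_le (η₀ := η₀) ha hη₁, eventually_ge_atTop 1]
          with t h1 h2 h3
        have h4 := isLinearRecursion_iter (x₀ := x₀) hlin (stepSize η₀ a) t ω
        have h5 : (x (t + 1) ω - xs) - Z (t + 1) ω = ((x t ω - xs) - Z t ω)
            - stepSize η₀ a t • toCLM H ((x t ω - xs) - Z t ω) := by
          have h6 : Z (t + 1) ω = (Z t ω - stepSize η₀ a t • toCLM H (Z t ω))
              + stepSize η₀ a t • e t ω := rfl
          simp only at h4
          rw [h6, h4, h1, map_sub (toCLM H) (x t ω - xs), smul_sub]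
          abel
        rw [h5]
        refine (hcontr _ (stepSize_pos hη₀ t).le h2 _).trans (le_of_eq ?_)
        rw [stepSize_of_ne_zero (by omega), mul_assoc c])
    have h1 : (fun t => (x t ω - xs) - Z t ω) =O[atTop] powLog (-(a / 2)) 0 := by
      refine IsBigO.of_bound B ?_
      filter_upwards [hB] with t ht
      rw [Real.norm_of_nonneg (powLog_nonneg _ _ _)]
      refine (hleN _).trans (ht.trans (le_of_eq ?_))
      simp [powLog]
    exact h1.trans (powLog_isBigO zero_le_one)
  refine (hdiff.add hZ).congr_left fun t => ?_
  simp only [Z]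
  abel

end AllMoments

/-! ### The exact error expansion and its rate. -/

section Assembly

variable {d : ℕ} {Ω Ξ : Type*} [mΩ : MeasurableSpace Ω] [mΞ : MeasurableSpace Ξ]
  {P : Measure Ω} [IsProbabilityMeasure P] {ℱ : Filtration ℕ mΩ} {G : Vec d → Ξ → Vec d}
  {ξ : ℕ → Ω → Ξ} {x₀ : Ω → Vec d} {xs : Vec d} {H : Matrix (Fin d) (Fin d) ℝ} {η₀ a : ℝ}

/-- The exact expression of the approximation error. -/
lemma approxError_eq (hlin : IsLinearField (meanField P G ξ) xs H) (hη₀ : 0 < η₀) {T : ℕ}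
    (hT : T ≠ 0) (ω : Ω) :
    approxError P G ξ (iter G ξ x₀ (stepSize η₀ a)) xs H T ω
      = (T : ℝ)⁻¹ • ((iter G ξ x₀ (stepSize η₀ a) T ω - xs) - (x₀ ω - xs)
        + toCLM H⁻¹ (∑ t ∈ Finset.range T, (stepSize η₀ a t)⁻¹ •
          ((iter G ξ x₀ (stepSize η₀ a) t ω - xs)
            - (iter G ξ x₀ (stepSize η₀ a) (t + 1) ω - xs)))
        + toCLM H⁻¹ (∑ t ∈ Finset.range T,
          (noise P G ξ (iter G ξ x₀ (stepSize η₀ a)) (t + 1) ω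
            - rootNoise P G ξ xs (t + 1) ω))) := by
  set x := iter G ξ x₀ (stepSize η₀ a)
  have hT0 : (T : ℝ) ≠ 0 := by positivity
  have hterm : ∀ t, x t ω - xs = toCLM H⁻¹ ((stepSize η₀ a t)⁻¹ • ((x t ω - xs)
      - (x (t + 1) ω - xs))) + toCLM H⁻¹ (noise P G ξ x (t + 1) ω) := by
    intro t
    have h1 := isLinearRecursion_iter (x₀ := x₀) hlin (stepSize η₀ a) t ω
    simp only at h1
    have h2 : (x t ω - xs) - (x (t + 1) ω - xs)
        = stepSize η₀ a t • (toCLM H (x t ω - xs) - noise P G ξ x (t + 1) ω) := by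
      rw [h1, smul_sub]
      abel
    rw [h2, inv_smul_smul₀ (stepSize_pos hη₀ t).ne', ← map_add, sub_add_cancel,
      toCLM_inv_apply H hlin.eigenvalues]
  -- The average runs over `1, …, T` and the recursion over `0, …, T-1`; the shift produces the
  -- boundary term.
  have hsum : ∑ s ∈ Finset.Icc 1 T, x s ω
      = (T : ℝ) • xs + (∑ t ∈ Finset.range T, (x t ω - xs)) + (x T ω - xs) - (x₀ ω - xs) := by
    have h1 : ∑ s ∈ Finset.Icc 1 T, x s ω = ∑ t ∈ Finset.range T, x (t + 1) ω := by
      rw [Finset.range_eq_Ico, Finset.sum_Ico_add' (fun s => x s ω) 0 T 1]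
      rfl
    have h2 := Finset.sum_range_sub (fun t => x t ω) T
    rw [Finset.sum_sub_distrib] at h2
    have h3 : x 0 ω = x₀ ω := rfl
    rw [h1, eq_add_of_sub_eq h2, Finset.sum_sub_distrib, Finset.sum_const, Finset.card_range, h3,
      Nat.cast_smul_eq_nsmul ℝ]
    abel
  have hroot : ∑ j ∈ Finset.Icc 1 T, mulVec H⁻¹ (rootNoise P G ξ xs j ω)
      = ∑ t ∈ Finset.range T, toCLM H⁻¹ (rootNoise P G ξ xs (t + 1) ω) := by
    rw [Finset.range_eq_Ico,
      Finset.sum_Ico_add' (fun j => toCLM H⁻¹ (rootNoise P G ξ xs j ω)) 0 T 1]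
    rfl
  have hmain : ∑ t ∈ Finset.range T, (x t ω - xs)
      = ∑ t ∈ Finset.range T, toCLM H⁻¹ ((stepSize η₀ a t)⁻¹ • ((x t ω - xs)
      - (x (t + 1) ω - xs))) + ∑ t ∈ Finset.range T, toCLM H⁻¹ (noise P G ξ x (t + 1) ω) := by
    rw [← Finset.sum_add_distrib]
    exact Finset.sum_congr rfl fun t _ => hterm t
  have hxs : ∀ S : Vec d, (T : ℝ)⁻¹ • ((T : ℝ) • xs + S) - xs = (T : ℝ)⁻¹ • S := fun S => by
    rw [smul_add, inv_smul_smul₀ hT0, add_sub_cancel_left]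
  unfold approxError average
  rw [hsum, hroot, hmain, Finset.sum_sub_distrib (fun t => noise P G ξ x (t + 1) ω), map_sub,
    map_sum, map_sum, map_sum, add_assoc, add_sub_assoc, hxs, ← smul_sub]
  congr 1
  abel

/-- The rate of the approximation error, from the rates of the iterates and of the noise
martingale. -/
lemma approxError_isLittleO (hlin : IsLinearField (meanField P G ξ) xs H) (hη₀ : 0 < η₀)
    (ha : 0 < a) (ha1 : a < 1) {θ m : ℝ} (hθ : 0 ≤ θ) (hm : 0 ≤ m) {ω : Ω} {r : ℕ → ℝ}
    (hiter : (fun t => iter G ξ x₀ (stepSize η₀ a) t ω - xs) =o[atTop] powLog (θ - a / 2) m)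
    {β m' : ℝ} (hnoise : (fun T => ∑ t ∈ Finset.range T,
        (noise P G ξ (iter G ξ x₀ (stepSize η₀ a)) (t + 1) ω - rootNoise P G ξ xs (t + 1) ω))
      =o[atTop] powLog β m')
    (hr : powLog (θ + a / 2 - 1) m =O[atTop] r) (hr' : powLog (β - 1) m' =O[atTop] r) :
    (fun T => approxError P G ξ (iter G ξ x₀ (stepSize η₀ a)) xs H T ω) =o[atTop] r := by
  set x := iter G ξ x₀ (stepSize η₀ a)
  have hscale : ∀ {v : ℕ → Vec d} {β m : ℝ}, v =o[atTop] powLog β m →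
      powLog (β - 1) m =O[atTop] r → (fun T : ℕ => (T : ℝ)⁻¹ • v T) =o[atTop] r := by
    intro v β m hv hO
    have h1 := (isBigO_refl (fun T : ℕ => (T : ℝ)⁻¹) atTop).smul_isLittleO hv
    refine (h1.congr' (EventuallyEq.refl _ _) ?_).trans_isBigO hO
    filter_upwards [eventually_ge_atTop 1] with T hT
    exact inv_mul_powLog β m (by omega)
  have hβ : 0 < θ + a / 2 := by linarith
  have hA : (fun T => (x T ω - xs) - (x₀ ω - xs)) =o[atTop] powLog (θ + a / 2) m :=
    (hiter.trans (powLog_isLittleO_of_lt (by linarith) m m)).sub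
      (isLittleO_const_left.2 (Or.inr
        (tendsto_norm_atTop_atTop.comp (tendsto_powLog_atTop hβ hm))))
  have hS := ((toCLM H⁻¹).isBigO_comp _ atTop).trans_isLittleO
    (isLittleO_sum_inv_stepSize hη₀ ha ha1 hθ hm hiter)
  have hD := ((toCLM H⁻¹).isBigO_comp _ atTop).trans_isLittleO hnoise
  refine ((hscale (hA.add hS) hr).add (hscale hD hr')).congr' ?_ (EventuallyEq.refl _ _)
  filter_upwards [eventually_ge_atTop 1] with T hT
  rw [approxError_eq hlin hη₀ (by omega), ← smul_add]

end Assembly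

end

end LinearSA

/-! ### The main theorem. -/

open LinearSA in
theorem mainTheorem2 {d : ℕ} {Ω Ξ : Type*} [mΩ : MeasurableSpace Ω] [MeasurableSpace Ξ]
    (P : Measure Ω) [IsProbabilityMeasure P] (ℱ : Filtration ℕ mΩ)
    (G : Vec d → Ξ → Vec d) (ξ : ℕ → Ω → Ξ) (x₀ : Ω → Vec d) (xs : Vec d)
    (H : Matrix (Fin d) (Fin d) ℝ) (η₀ a : ℝ) (x : ℕ → Ω → Vec d)
    (hx : x = iter G ξ x₀ (stepSize η₀ a))
    (hsamp : Sampling P ℱ G ξ x₀)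
    (hlyap : HasLyapunov (meanField P G ξ) xs)
    (hlin : IsLinearField (meanField P G ξ) xs H)
    (hlip : IsMeanSquareLipschitz P G ξ)
    (hη₀ : 0 < η₀) (ha : 0 < a) :
    -- finite moment parameter `p`
    (∀ p : ℝ, 1 < p → a < (p - 1) / p → NoiseAssumption P ℱ G ξ x xs p →
      (∀ ε : ℝ, 0 < ε → ∀ᵐ ω ∂P,
        (fun t => approxError P G ξ x xs H t ω) =o[atTop] linearRate (1 / p) a ε) ∧
      (a = (p - 1) / (2 * p) →
        AELittleOTilde P (approxError P G ξ x xs H)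
          (fun t => (t : ℝ) ^ (-((3 * p - 1) / (4 * p)))))) ∧
    -- `p = ∞`: moments of all orders
    (a < 1 → (∀ p : ℝ, 1 < p → NoiseAssumption P ℱ G ξ x xs p) →
      (∀ ε : ℝ, 0 < ε →
        AELittleOTilde P (approxError P G ξ x xs H) (linearRate 0 a ε)) ∧
      (a = 1 / 2 →
        AELittleOTilde P (approxError P G ξ x xs H)
          (fun t => (t : ℝ) ^ (-(3 / 4) : ℝ)))) ∧
    -- optimality of `(p - 1) / (2 p)` among all admissible step exponents `b`
    (∀ p b ε k : ℝ, 1 < p → 0 < b → b < (p - 1) / p → 0 < ε → b ≠ (p - 1) / (2 * p) →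
      (fun t : ℕ => (t : ℝ) ^ (-((3 * p - 1) / (4 * p))) * Real.log t ^ k)
        =o[atTop] linearRate (1 / p) b ε) ∧
    -- optimality of `1 / 2` among all admissible step exponents `b` when `p = ∞`
    (∀ b ε k : ℝ, 0 < b → b < 1 → 0 < ε → b ≠ 1 / 2 →
      (fun t : ℕ => (t : ℝ) ^ (-(3 / 4) : ℝ) * Real.log t ^ k)
        =o[atTop] linearRate 0 b ε) := by
  subst hx
  have hexp : ∀ p : ℝ, 1 < p → -((3 * p - 1) / (4 * p)) = -((3 - 1 / p) / 4) := by
    intro p hp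
    field_simp
  have hhalf : ∀ p : ℝ, 1 < p → (p - 1) / (2 * p) = (1 - 1 / p) / 2 := by
    intro p hp
    field_simp
  refine ⟨fun p hp hap hN => ?_, fun ha1 hN => ?_, fun p b ε k hp _ _ _ hb => ?_,
    fun b ε k _ _ _ hb => ?_⟩
  · have hp0 : 0 < 1 / p := by positivity
    have hp1 : 1 / p < 1 := by
      rw [div_lt_one (by linarith)]
      exact hp
    have ha1 : a < 1 := by
      refine hap.trans_le ?_
      rw [div_le_one (by linarith)]
      linarith
    have hrate : ∀ ε : ℝ, 0 < ε → ∀ᵐ ω ∂P,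
        (fun t => approxError P G ξ (iter G ξ x₀ (stepSize η₀ a)) xs H t ω)
          =o[atTop] linearRate (1 / p) a ε := by
      intro ε hε
      filter_upwards [ae_isLittleO_iter hsamp hlin hlip hη₀ ha ha1 hp hN.moments hε,
        ae_isLittleO_sum_noise_sub hsamp hlin hlip hη₀ ha ha1 hp hN.moments hε] with ω h1 h2
      refine approxError_isLittleO hlin hη₀ ha ha1 (by positivity) (by positivity) h1 h2 ?_ ?_
      · have h3 := powLog_isBigO_linearRate_moment (1 / p) a ε
        have h4 : 1 / p / 2 - (2 - a) / 2 = 1 / p / 2 + a / 2 - 1 := by ring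
        rwa [h4] at h3
      · have h3 := powLog_isBigO_linearRate_martingale (1 / p) a ε
        have h4 : -((1 + a) / 2) = (1 - a) / 2 - 1 := by ring
        rwa [h4] at h3
    refine ⟨hrate, fun hap => ⟨1 / 2 + 1, ?_⟩⟩
    filter_upwards [hrate 1 one_pos] with ω hω
    rw [hhalf p hp] at hap
    rw [hexp p hp]
    refine hω.trans_isBigO ?_
    rw [hap]
    exact linearRate_isBigO_powLog hp0.le hp1
  -- The power `(log t)²` serves both terms: it exceeds the `log t` of the iterates, turning O into
  -- o, and the `(log t)^{3/2}` of the martingale with `ε = 1`.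
  · have hall : ∀ᵐ ω ∂P, ∀ r : ℕ → ℝ, powLog (a / 2 - 1) 2 =O[atTop] r →
        powLog ((1 - a) / 2 - 1) 2 =O[atTop] r →
        (fun t => approxError P G ξ (iter G ξ x₀ (stepSize η₀ a)) xs H t ω) =o[atTop] r := by
      filter_upwards [ae_isBigO_iter hsamp hlin hlip hη₀ ha ha1 fun p hp => (hN p hp).moments,
        ae_isLittleO_sum_noise_sub hsamp hlin hlip hη₀ ha ha1 one_lt_two (hN 2 one_lt_two).moments
          one_pos] with ω h1 h2 r hr hr'
      have h3 : (fun t => iter G ξ x₀ (stepSize η₀ a) t ω - xs)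
          =o[atTop] powLog (0 - a / 2) 2 := by
        rw [zero_sub]
        exact h1.trans_isLittleO (powLog_isLittleO one_lt_two)
      refine approxError_isLittleO hlin hη₀ ha ha1 le_rfl (by norm_num) h3
        (h2.trans_isBigO (powLog_isBigO (m' := 2) (by norm_num))) ?_ hr'
      rwa [zero_add]
    refine ⟨fun ε hε => ⟨2, ?_⟩, fun ha2 => ⟨2, ?_⟩⟩
    · have hmul : ∀ {β m : ℝ}, 0 ≤ m → powLog β m =O[atTop] linearRate 0 a ε →
          powLog β 2 =O[atTop] fun t : ℕ => linearRate 0 a ε t * Real.log t ^ (2 : ℝ) := by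
        intro β m hm h
        have h1 := ((powLog_isBigO (β := β) hm).trans h).mul
          (isBigO_refl (fun t : ℕ => Real.log t ^ (2 : ℝ)) atTop)
        refine h1.congr_left fun t => ?_
        simp [powLog]
      filter_upwards [hall] with ω hω
      refine hω _ ?_ ?_
      · have h3 := powLog_isBigO_linearRate_moment 0 a ε
        have h4 : 0 / 2 - (2 - a) / 2 = a / 2 - 1 := by ring
        rw [h4] at h3
        exact hmul (by linarith) h3
      · have h3 := powLog_isBigO_linearRate_martingale 0 a ε
        have h4 : -((1 + a) / 2) = (1 - a) / 2 - 1 := by ring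
        rw [h4] at h3
        exact hmul (by linarith) h3
    · filter_upwards [hall] with ω hω
      refine hω _ ?_ ?_
      · have h1 : a / 2 - 1 = -(3 / 4) := by
          rw [ha2]
          norm_num
        rw [h1]
        exact isBigO_refl _ _
      · have h1 : (1 - a) / 2 - 1 = -(3 / 4) := by
          rw [ha2]
          norm_num
        rw [h1]
        exact isBigO_refl _ _
  · rw [hexp p hp]
    rw [hhalf p hp] at hb
    exact powLog_isLittleO_linearRate hb ε k
  · have h1 : (-(3 / 4) : ℝ) = -((3 - 0) / 4) := by norm_num
    rw [h1]
    exact powLog_isLittleO_linearRate (by simpa using hb) ε k
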